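/- Let $d\ge 1$. Write $\widehat f(\xi)=\int_{\mathbb{R}^d} f(x)e^{-2\pi i\langle x,\xi\rangle}\,dx$, extended to the tempered distributions $S'=S'(\mathbb{R}^d)$. Fix a Schwartz function $\phi$ on $\mathbb{R}^d$ such that $\widehat\phi$ is supported in $\{\xi: 2^{-1}\le|\xi|\le 2\}$ and $\sum_{k\in\mathbb{Z}}\widehat{\phi_k}(\xi)=1$ for $\xi\ne 0$, where $\phi_k:=2^{kd}\phi(2^k\cdot)$, and let $\Phi$ be the Schwartz function with $\widehat\Phi=1-\sum_{k\ge 1}\widehat{\phi_k}$. For $f\in S'$ put $\Pi_0f:=\Phi*f$ and $\Pi_kf:=\phi_k*f$ for $k\ge 1$. For $s\in\mathbb{R}$ and $0<q<\infty$ let $F_\infty^{s,q}$ be the space of all $f\in S'$ with $$\|f\|_{F_\infty^{s,q}}:=\|\Pi_0f\|_{L^\infty}+\sup_{l(P)<1}\Big(\frac1{|P|}\int_P\sum_{k=-\log_2 l(P)}^\infty 2^{skq}|\Pi_kf(x)|^q\,dx\Big)^{1/q}<\infty,$$ the supremum being over all dyadic cubes $P$ in $\mathbb{R}^d$ of side length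 $l(P)<1$. Let $\mathcal{S}^m_{1,1}$ be the class of smooth $a:\mathbb{R}^d\times\mathbb{R}^d\to\mathbb{C}$ such that for all multi-indices $\alpha,\beta$ there is $c_{\alpha,\beta}$ with $|\partial_\xi^\alpha\partial_x^\beta a(x,\xi)|\le c_{\alpha,\beta}(1+|\xi|)^{m-|\alpha|+|\beta|}$ for all $x,\xi$. For such $a$ and $j,k\ge 0$ let $a_{j,k}(x,\xi):=\big(\phi_j*a(\cdot,\xi)\big)(x)\,\widehat{\phi_k}(\xi)$, with $\Phi$ in place of $\phi_0$ when $j=0$ or $k=0$; for $f\in S'$ let $T_{[a_{j,k}]}f\in S'$ be the function $x\mapsto\langle \widehat f, a_{j,k}(x,\cdot)e^{2\pi i\langle x,\cdot\rangle}\rangle$, and define $$T_{[a]}f:=\lim_{N\to\infty}\sum_{k=0}^N\sum_{j=0}^N T_{[a_{j,k}]}f$$ whenever the limit exists in $S'$. Let $m\in\mathbb{R}$, $0<q<\infty$, $a\in\mathcal{S}^m_{1,1}$ and $s>\tau_q:=\frac{d}{\min(1,q)}-d$. Then $T_{[a]}$ maps $F_\infty^{s+m,q}$ boundedly into $F_\infty^{s,q}$: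 for every $f\in F_\infty^{s+m,q}$ the limit defining $T_{[a]}f$ exists in $S'$, and there is a constant $C<\infty$, independent of $f$, such that $$\|T_{[a]}f\|_{F_\infty^{s,q}}\le C\,\|f\|_{F_\infty^{s+m,q}}\qquad\text{for all } f\in F_\infty^{s+m,q}.$$ -/

import Mathlib

open scoped SchwartzMap FourierTransform ENNReal NNReal ContDiff

noncomputable section

namespace TypeOneOne

open MeasureTheory Filter

/-- The Euclidean space `ℝ^d`. -/
abbrev E (d : ℕ) : Type := EuclideanSpace ℝ (Fin d)

variable {d : ℕ}

/-! ### Littlewood-Paley decomposition -/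

/-- Multiplication by `2 ^ k` as a linear automorphism of `ℝ^d`. -/
def scale (d : ℕ) (k : ℤ) : E d ≃L[ℝ] E d :=
  ContinuousLinearEquiv.smulLeft (Units.mk0 ((2 : ℝ) ^ k) (by positivity))

@[simp]
theorem scale_apply (k : ℤ) (x : E d) : scale d k x = (2 : ℝ) ^ k • x := rfl

/-- The dilation `φ_k := 2^{kd} φ(2^k ·)` of a Schwartz function. -/
def dilate (φ : 𝓢(E d, ℂ)) (k : ℤ) : 𝓢(E d, ℂ) :=
  (((2 : ℝ) ^ k) ^ d) • SchwartzMap.compCLMOfContinuousLinearEquiv ℂ (scale d k) φ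

theorem dilate_apply (φ : 𝓢(E d, ℂ)) (k : ℤ) (x : E d) :
    dilate φ k x = (((2 : ℝ) ^ k) ^ d) • φ ((2 : ℝ) ^ k • x) := rfl

/-- `φ` generates a dyadic resolution of unity: `φ^` is supported in `{1/2 ≤ |ξ| ≤ 2}` and
`∑_{k ∈ ℤ} (φ_k)^(ξ) = 1` for `ξ ≠ 0`. -/
structure IsLittlewoodPaley (φ : 𝓢(E d, ℂ)) : Prop where
  support_subset : Function.support (𝓕 φ : 𝓢(E d, ℂ)) ⊆ {ξ : E d | 1 / 2 ≤ ‖ξ‖ ∧ ‖ξ‖ ≤ 2}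
  hasSum_one : ∀ ξ : E d, ξ ≠ 0 → HasSum (fun k : ℤ => 𝓕 (dilate φ k) ξ) 1

theorem fourier_dilate (φ : 𝓢(E d, ℂ)) (k : ℤ) (ξ : E d) :
    𝓕 (dilate φ k) ξ = 𝓕 φ ((2 : ℝ) ^ (-k) • ξ) := by
  have h2 : (0 : ℝ) < (2 : ℝ) ^ k := by positivity
  rw [SchwartzMap.fourier_coe, SchwartzMap.fourier_coe, Real.fourier_eq, Real.fourier_eq]
  have h := Measure.integral_comp_smul (volume : Measure (E d))
    (fun v : E d => Real.fourierChar (-(inner ℝ v ((2 : ℝ) ^ (-k) • ξ))) • φ v) ((2 : ℝ) ^ k)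
  have h3 : ∀ v : E d, Real.fourierChar (-(inner ℝ v ξ)) • dilate φ k v
      = (((2 : ℝ) ^ k) ^ d) • (Real.fourierChar (-(inner ℝ ((2 : ℝ) ^ k • v)
        ((2 : ℝ) ^ (-k) • ξ))) • φ ((2 : ℝ) ^ k • v)) := by
    intro v
    have h4 : inner ℝ ((2 : ℝ) ^ k • v) ((2 : ℝ) ^ (-k) • ξ) = inner ℝ v ξ := by
      rw [real_inner_smul_left, real_inner_smul_right, zpow_neg, ← mul_assoc,
        mul_inv_cancel₀ h2.ne', one_mul]
    rw [h4, dilate_apply, smul_comm]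
  simp_rw [h3]
  rw [integral_smul, h, finrank_euclideanSpace_fin, smul_smul, abs_of_pos (by positivity),
    mul_inv_cancel₀ (by positivity), one_smul]

/-- The function `1 - ∑_{k ≥ 1} (φ_k)^`, the Fourier transform of `Φ`. -/
def lowPassSymbol (φ : 𝓢(E d, ℂ)) (ξ : E d) : ℂ :=
  1 - ∑' k : ℕ, 𝓕 (dilate φ ((k : ℤ) + 1)) ξ

theorem IsLittlewoodPaley.fourier_dilate_eq_zero {φ : 𝓢(E d, ℂ)} (h : IsLittlewoodPaley φ)
    {k : ℤ} {ξ : E d} (hξ : ‖ξ‖ < (2 : ℝ) ^ (k - 1) ∨ (2 : ℝ) ^ (k + 1) < ‖ξ‖) :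
    𝓕 (dilate φ k) ξ = 0 := by
  rw [fourier_dilate]
  by_contra hne
  obtain ⟨h1, h2⟩ := h.support_subset (Function.mem_support.2 hne)
  have hk : (0 : ℝ) < (2 : ℝ) ^ k := by positivity
  rw [norm_smul, norm_zpow, Real.norm_ofNat, zpow_neg] at h1 h2
  rw [zpow_sub_one₀ (by norm_num), zpow_add_one₀ (by norm_num)] at hξ
  rw [inv_mul_eq_div, le_div_iff₀ hk] at h1
  rw [inv_mul_eq_div, div_le_iff₀ hk] at h2
  rcases hξ with hξ | hξ <;> linarith

theorem IsLittlewoodPaley.contDiff_lowPassSymbol {φ : 𝓢(E d, ℂ)} (h : IsLittlewoodPaley φ) :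
    ContDiff ℝ ∞ (lowPassSymbol φ) := by
  rw [contDiff_iff_contDiffAt]
  intro ξ
  obtain ⟨K, hK⟩ := pow_unbounded_of_one_lt ‖ξ‖ (one_lt_two : (1 : ℝ) < 2)
  have hev : lowPassSymbol φ =ᶠ[nhds ξ]
      fun η => 1 - ∑ k ∈ Finset.range K, 𝓕 (dilate φ ((k : ℤ) + 1)) η := by
    filter_upwards [continuous_norm.continuousAt.eventually (gt_mem_nhds hK)] with η hη
    unfold lowPassSymbol
    rw [tsum_eq_sum]
    intro k hk
    apply h.fourier_dilate_eq_zero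
    left
    rw [add_sub_cancel_right, zpow_natCast]
    refine hη.trans_le (pow_le_pow_right₀ one_le_two ?_)
    simpa using hk
  refine ContDiffAt.congr_of_eventuallyEq ?_ hev
  refine ContDiff.contDiffAt (contDiff_const.sub (ContDiff.sum fun k _ => ?_))
  exact SchwartzMap.smooth _ _

theorem IsLittlewoodPaley.hasCompactSupport_lowPassSymbol {φ : 𝓢(E d, ℂ)}
    (h : IsLittlewoodPaley φ) : HasCompactSupport (lowPassSymbol φ) := by
  refine HasCompactSupport.intro (isCompact_closedBall (0 : E d) 2) fun ξ hξ => ?_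
  have hξ2 : 2 < ‖ξ‖ := by simpa using hξ
  have hne : ξ ≠ 0 := by
    rintro rfl
    norm_num at hξ2
  have hinj : Function.Injective (fun k : ℕ => (k : ℤ) + 1) := fun a b hab => by
    simpa using hab
  have hs : HasSum (fun k : ℕ => 𝓕 (dilate φ ((k : ℤ) + 1)) ξ) 1 := by
    refine (hinj.hasSum_iff (f := fun k : ℤ => 𝓕 (dilate φ k) ξ) ?_).2 (h.hasSum_one ξ hne)
    intro k hk
    apply h.fourier_dilate_eq_zero
    right
    have hk0 : k ≤ 0 := by
      by_contra hlt
      exact hk ⟨(k - 1).toNat, by simp only; omega⟩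
    calc (2 : ℝ) ^ (k + 1) ≤ (2 : ℝ) ^ (1 : ℤ) := zpow_le_zpow_right₀ one_le_two (by omega)
      _ < ‖ξ‖ := by simpa using hξ2
  simp [lowPassSymbol, hs.tsum_eq]

/-- The Schwartz function `Φ` with `Φ^ = 1 - ∑_{k ≥ 1} (φ_k)^`. -/
def lowPass (φ : 𝓢(E d, ℂ)) (h : IsLittlewoodPaley φ) : 𝓢(E d, ℂ) :=
  𝓕⁻ (h.hasCompactSupport_lowPassSymbol.toSchwartzMap h.contDiff_lowPassSymbol)

/-- The kernels of the inhomogeneous decomposition: `Φ` for `k = 0` and `φ_k` for `k ≥ 1`. -/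
def lpKernel (φ : 𝓢(E d, ℂ)) (h : IsLittlewoodPaley φ) (k : ℕ) : 𝓢(E d, ℂ) :=
  if k = 0 then lowPass φ h else dilate φ k

/-- The Schwartz function `y ↦ ψ (x - y)`. -/
def reflectAt (ψ : 𝓢(E d, ℂ)) (x : E d) : 𝓢(E d, ℂ) :=
  SchwartzMap.compSubConstCLM ℂ x
    (SchwartzMap.compCLMOfContinuousLinearEquiv ℂ (ContinuousLinearEquiv.neg ℝ) ψ)

theorem reflectAt_apply (ψ : 𝓢(E d, ℂ)) (x y : E d) : reflectAt ψ x y = ψ (x - y) := by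
  simp [reflectAt]

/-- The convolution `(ψ * f)(x) = ⟨f, ψ(x - ·)⟩` of a Schwartz function and a tempered
distribution. -/
def conv (ψ : 𝓢(E d, ℂ)) (f : 𝓢'(E d, ℂ)) (x : E d) : ℂ := f (reflectAt ψ x)

/-- The Littlewood-Paley pieces `Π_0 f = Φ * f` and `Π_k f = φ_k * f`, `k ≥ 1`. -/
def lpPiece (φ : 𝓢(E d, ℂ)) (h : IsLittlewoodPaley φ) (k : ℕ) (f : 𝓢'(E d, ℂ)) : E d → ℂ :=
  conv (lpKernel φ h k) f

/-! ### The spaces `F_∞^{s,q}`, `0 < q < ∞` -/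

/-- The dyadic cube `2^{-μ}(n + [0,1)^d)` of side length `2^{-μ}`. -/
def dyadicCube (μ : ℕ) (n : Fin d → ℤ) : Set (E d) :=
  {x | ∀ i, (2 : ℝ) ^ (-(μ : ℤ)) * n i ≤ x i ∧ x i < (2 : ℝ) ^ (-(μ : ℤ)) * (n i + 1)}

/-- The `F_∞^{s,q}` quasi-norm (`0 < q < ∞`), with values in `[0, ∞]`. The dyadic cubes of side
length `< 1` are those of side length `2^{-μ}`, `μ ≥ 1`. -/
def triebelLizorkinNorm (φ : 𝓢(E d, ℂ)) (h : IsLittlewoodPaley φ) (s q : ℝ)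
    (f : 𝓢'(E d, ℂ)) : ℝ≥0∞ :=
  eLpNorm (lpPiece φ h 0 f) ⊤ volume +
    ⨆ (μ : ℕ) (_ : 1 ≤ μ) (n : Fin d → ℤ),
      ((volume (dyadicCube μ n))⁻¹ * ∫⁻ x in dyadicCube μ n,
        ∑' k : Set.Ici μ, ENNReal.ofReal ((2 : ℝ) ^ (s * ((k : ℕ) : ℝ) * q)) *
          ‖lpPiece φ h k f x‖ₑ ^ q) ^ (1 / q)

/-- The space `F_∞^{s,q}` of tempered distributions. -/
def triebelLizorkin (φ : 𝓢(E d, ℂ)) (h : IsLittlewoodPaley φ) (s q : ℝ) : Set 𝓢'(E d, ℂ) :=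
  {f | triebelLizorkinNorm φ h s q f < ⊤}

/-- `τ_q = d / min(1, q) - d`. -/
def tau (d : ℕ) (q : ℝ) : ℝ := d / min 1 q - d

/-! ### Symbols and pseudo-differential operators -/

/-- Hörmander's class `S^m_{ρ,δ}`: smooth `a` with
`|∂_ξ^α ∂_x^β a(x,ξ)| ≤ c_{α,β} (1 + |ξ|)^{m - ρ|α| + δ|β|}`. All partial derivatives with
`|α| = n`, `|β| = k` are collected in the `n`-th derivative in `ξ` of the `k`-th derivative
in `x`. -/
structure IsSymbol (m ρ δ : ℝ) (a : E d → E d → ℂ) : Prop where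
  smooth : ContDiff ℝ ∞ (fun p : E d × E d => a p.1 p.2)
  bound : ∀ n k : ℕ, ∃ C : ℝ, ∀ x ξ : E d,
    ‖iteratedFDeriv ℝ n (fun η => iteratedFDeriv ℝ k (fun y => a y η) x) ξ‖ ≤
      C * (1 + ‖ξ‖) ^ (m - ρ * n + δ * k)

/-- `a_{j,k}(x,ξ) = (φ_j * a(·,ξ))(x) (φ_k)^(ξ)`, with `Φ` in place of `φ_0`. -/
def symbolPiece (φ : 𝓢(E d, ℂ)) (h : IsLittlewoodPaley φ) (a : E d → E d → ℂ) (j k : ℕ)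
    (x ξ : E d) : ℂ :=
  (∫ z, lpKernel φ h j z * a (x - z) ξ) * 𝓕 (lpKernel φ h k) ξ

/-- For a symbol `b` such that every `b(x,·) e^{2πi⟨x,·⟩}` is a Schwartz function (as is the case
for `b = a_{j,k}`), the function
`F(x) = T_[b] f(x) = ∫ b(x,ξ) f^(ξ) e^{2πi⟨x,ξ⟩} dξ = ⟨f^, b(x,·) e^{2πi⟨x,·⟩}⟩`. -/
def IsPseudoDiffFunction (b : E d → E d → ℂ) (f : 𝓢'(E d, ℂ)) (F : E d → ℂ) : Prop :=
  ∀ x : E d, ∃ ψ : 𝓢(E d, ℂ),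
    (∀ ξ : E d, ψ ξ = b x ξ * Complex.exp (2 * Real.pi * Complex.I * (inner ℝ x ξ : ℝ))) ∧
    F x = 𝓕 f ψ

/-- The tempered distribution `v` is (given by integration against) the function `F`. -/
def IsRegularDistribution (v : 𝓢'(E d, ℂ)) (F : E d → ℂ) : Prop :=
  ∀ g : 𝓢(E d, ℂ), Integrable (fun x => F x * g x) ∧ v g = ∫ x, F x * g x

/-- `u = T_[a] f`, that is, `u = lim_{N → ∞} ∑_{k=0}^N ∑_{j=0}^N T_[a_{j,k}] f` in the space of
tempered distributions (and the limit exists). -/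
def IsPseudoDiff (φ : 𝓢(E d, ℂ)) (h : IsLittlewoodPaley φ) (a : E d → E d → ℂ)
    (f u : 𝓢'(E d, ℂ)) : Prop :=
  ∃ (F : ℕ → ℕ → E d → ℂ) (v : ℕ → ℕ → 𝓢'(E d, ℂ)),
    (∀ j k, IsPseudoDiffFunction (symbolPiece φ h a j k) f (F j k)) ∧
    (∀ j k, IsRegularDistribution (v j k) (F j k)) ∧
    Tendsto (fun N : ℕ => ∑ k ∈ Finset.range (N + 1), ∑ j ∈ Finset.range (N + 1), v j k)
      atTop (nhds u)

end TypeOneOne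

end

open scoped SchwartzMap FourierTransform ENNReal NNReal ContDiff

noncomputable section

namespace TypeOneOne

open MeasureTheory Filter
open LineDeriv

variable {d : ℕ}

/-! Localize the symbol at frequency `2^k` by a cutoff equal to one on the spectrum of `Π_k`, and
let `K_k(w, ·)` be the inverse Fourier transform of the localized `a(w, ·)`. The part of `f` at
frequency `2^k` contributes `T_k f(x) = ∫ K_k(x, ζ) Π_k f(x - ζ) dζ` (`pdoPiece`). The symbol
estimates give `|K_k(w, ζ)| ≲ 2^{mk} 2^{kd} (1 + 2^k|ζ|)^{-M}` for every `M`, uniformly in `w`.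

Let `A_k` be the average of `2^{(s+m)kq} |Π_k f|^q` against `2^{kd}(1 + 2^k|·|)^{-L}`. A Peetre-type
inequality (`rpow_le_weight_mul_decayConv`), valid for every `q > 0` because `Π_k f` reproduces
itself under a kernel at scale `2^{-k}`, bounds `|T_k f|` by `2^{-sk} A_k^{1/q}`. The average `A_k`
is essentially constant at scale `2^{-k}`, so the Carleson supremum in the norm of `f` also bounds
it uniformly. As `s > τ_q ≥ 0`, the series `∑ T_k f` converges uniformly. It is `T_[a] f`: summing
the pieces over `j ≤ N` averages the space variable of the symbol against `2^{Nd} Φ(2^N ·)`, an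
approximate identity (`exists_isPseudoDiff`).

For the norm one estimates `Π_l T_k f`. Since the symbol is only of type `1,1`, `T_k f` need not
have spectrum near `2^k`, so both regimes occur. If `l ≥ k`, write `φ` as a divergence of functions
with annular spectrum and integrate by parts. A derivative of the kernel costs `2^k`, whether it
falls on the symbol or on the exponential, so each step gains `2^{k-l}` (`exists_enorm_offDiag_le`).
If `l ≤ k`, only the decay of `φ_l` is used. Passing from an average of `A_k^{1/q}` to the root of
an average of `A_k` at the coarser scale costs `2^{τ_q (k-l)}`, by a Bernstein-type argument when `q
< 1` (`exists_lintegral_decay_mul_rpow_le`). After multiplication by `2^{sl}` the total is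
`2^{-(s-τ_q)|k-l|}`.

It remains to sum over `t = |k-l|` (`exists_carleson_rpow_le`). The Carleson supremum is stable
under averaging the `k`-th entry at scale `2^{-k}` (`exists_carleson_decayConv_le`), does not grow
when scales are shifted forward, and loses a factor `1 + t` when they are shifted back, because the
uniform bound controls the `t` scales that leave the cube. The geometric weight absorbs this loss.
-/

/-! ### Derivatives of superpositions of translates of a Schwartz function. -/

/-- Differentiation under the integral sign: the derivative of `Ψ` is bounded, so a multiple of
`‖κ‖` dominates. -/
theorem lineDerivOp_integral_mul (κ Ψ H : 𝓢(E d, ℂ)) (hH : ∀ y, H y = ∫ z, κ z * Ψ (y + z))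
    (v y : E d) : (∂_{v} H) y = ∫ z, κ z * (∂_{v} Ψ) (y + z) := by
  have hd : HasFDerivAt (fun y => ∫ z, κ z * Ψ (y + z))
      (∫ z, κ z • SchwartzMap.fderivCLM ℂ (E d) ℂ Ψ (y + z)) y := by
    have hc : ∀ y : E d, Continuous fun z => SchwartzMap.fderivCLM ℂ (E d) ℂ Ψ (y + z) := fun y =>
      (SchwartzMap.continuous _).comp (continuous_const.add continuous_id)
    have hc' : ∀ y : E d, Continuous fun z => Ψ (y + z) := fun y =>
      (SchwartzMap.continuous _).comp (continuous_const.add continuous_id)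
    refine hasFDerivAt_integral_of_dominated_of_fderiv_le (s := Set.univ)
      (bound := fun z => ‖κ z‖ * SchwartzMap.seminorm ℂ 0 0 (SchwartzMap.fderivCLM ℂ (E d) ℂ Ψ))
      (F' := fun y z => κ z • SchwartzMap.fderivCLM ℂ (E d) ℂ Ψ (y + z))
      Filter.univ_mem (.of_forall fun y => ?_) ?_ ?_ (.of_forall fun z y _ => ?_) ?_
      (.of_forall fun z y _ => ?_)
    · exact (κ.continuous.mul (hc' y)).aestronglyMeasurable
    · exact κ.integrable.mul_bdd (hc' y).aestronglyMeasurable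
        (.of_forall fun z => SchwartzMap.norm_le_seminorm ℂ Ψ _)
    · exact (κ.continuous.smul (hc y)).aestronglyMeasurable
    · rw [norm_smul]
      gcongr
      exact SchwartzMap.norm_le_seminorm ℂ _ _
    · exact κ.integrable.norm.mul_const _
    · have h1 : HasFDerivAt (fun y => Ψ (y + z)) (fderiv ℝ Ψ (y + z)) y :=
        (hasFDerivAt_comp_add_right z).2 (Ψ.hasFDerivAt (y + z))
      exact h1.const_mul (κ z)
  rw [SchwartzMap.lineDerivOp_apply_eq_fderiv]
  have hHe : (H : E d → ℂ) = fun y => ∫ z, κ z * Ψ (y + z) := funext hH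
  rw [hHe, hd.fderiv, ContinuousLinearMap.integral_apply]
  · rfl
  · refine κ.integrable.smul_bdd _ ?_ (.of_forall fun z => SchwartzMap.norm_le_seminorm ℂ _ _)
    exact ((SchwartzMap.continuous _).comp (continuous_const.add continuous_id)).aestronglyMeasurable

theorem iteratedLineDerivOp_integral_mul (κ Ψ H : 𝓢(E d, ℂ))
    (hH : ∀ y, H y = ∫ z, κ z * Ψ (y + z)) {n : ℕ} (v : Fin n → E d) (y : E d) :
    (∂^{v} H) y = ∫ z, κ z * (∂^{v} Ψ) (y + z) := by
  induction n generalizing y with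
  | zero => simpa using hH y
  | succ n ih =>
    rw [iteratedLineDerivOp_succ_left, iteratedLineDerivOp_succ_left]
    exact lineDerivOp_integral_mul κ _ _ (ih _) _ _

theorem norm_iteratedFDeriv_bdd (Ψ : 𝓢(E d, ℂ)) (n : ℕ) (x : E d) :
    ‖iteratedFDeriv ℝ n Ψ x‖ ≤ SchwartzMap.seminorm ℂ 0 n Ψ := by
  simpa using SchwartzMap.le_seminorm ℂ 0 n Ψ x

theorem continuous_iteratedFDeriv (Ψ : 𝓢(E d, ℂ)) (n : ℕ) :
    Continuous (iteratedFDeriv ℝ n Ψ) := (Ψ.smooth n).continuous_iteratedFDeriv'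

/-- Supplies the pointwise identity of derivatives from which the weak integral of Schwartz
functions is built. It is read off from directional derivatives by testing the multilinear forms on
vectors. -/
theorem iteratedFDeriv_integral_mul (κ Ψ H : 𝓢(E d, ℂ))
    (hH : ∀ y, H y = ∫ z, κ z * Ψ (y + z)) (n : ℕ) (y : E d) :
    iteratedFDeriv ℝ n H y = ∫ z, κ z • iteratedFDeriv ℝ n Ψ (y + z) := by
  ext v
  have hint : Integrable (fun z => κ z • iteratedFDeriv ℝ n Ψ (y + z)) := by
    refine κ.integrable.smul_bdd _ ?_ (.of_forall fun z => norm_iteratedFDeriv_bdd Ψ n _)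
    exact ((continuous_iteratedFDeriv Ψ n).comp
      (continuous_const.add continuous_id)).aestronglyMeasurable
  have := (ContinuousMultilinearMap.apply ℝ (fun _ : Fin n => E d) ℂ v).integral_comp_comm hint
  simp only [ContinuousMultilinearMap.apply_apply] at this
  rw [← this, ← SchwartzMap.iteratedLineDerivOp_eq_iteratedFDeriv,
    iteratedLineDerivOp_integral_mul κ Ψ H hH]
  simp [SchwartzMap.iteratedLineDerivOp_eq_iteratedFDeriv]

/-! ### Weak integrals of Schwartz functions against a tempered distribution. -/

/-- Bounded continuous functions with values in the `n`-linear forms on `ℝ^d`. -/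
def BddForm (d n : ℕ) : Type := BoundedContinuousFunction (E d) (E d [×n]→L[ℝ] ℂ)

instance (n : ℕ) : NormedAddCommGroup (BddForm d n) :=
  inferInstanceAs (NormedAddCommGroup (BoundedContinuousFunction (E d) (E d [×n]→L[ℝ] ℂ)))

instance (n : ℕ) : NormedSpace ℂ (BddForm d n) :=
  inferInstanceAs (NormedSpace ℂ (BoundedContinuousFunction (E d) (E d [×n]→L[ℝ] ℂ)))

instance (n : ℕ) : CompleteSpace (BddForm d n) :=
  inferInstanceAs (CompleteSpace (BoundedContinuousFunction (E d) (E d [×n]→L[ℝ] ℂ)))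

/-- Evaluation of an element of `BddForm d n` at a point. -/
def BddForm.eval {n : ℕ} (y : E d) : BddForm d n →L[ℂ] (E d [×n]→L[ℝ] ℂ) :=
  BoundedContinuousFunction.evalCLM ℂ y

theorem BddForm.ext {n : ℕ} {g h : BddForm d n} (H : ∀ y, eval y g = eval y h) : g = h :=
  BoundedContinuousFunction.ext H

theorem BddForm.norm_eval_le {n : ℕ} (g : BddForm d n) (y : E d) : ‖eval y g‖ ≤ ‖g‖ :=
  BoundedContinuousFunction.norm_coe_le_norm g y

/-- The seminorm `p_{k,n}` of Schwartz space as the norm of a bounded continuous function. -/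
def weightedDeriv (k n : ℕ) : 𝓢(E d, ℂ) →ₗ[ℂ] BddForm d n where
  toFun g := BoundedContinuousFunction.ofNormedAddCommGroup
    (fun x => (‖x‖ ^ k : ℝ) • iteratedFDeriv ℝ n g x)
    (by
      have := continuous_iteratedFDeriv g n
      fun_prop)
    (SchwartzMap.seminorm ℂ k n g)
    (fun x => by
      rw [norm_smul, norm_pow, norm_norm]
      exact SchwartzMap.le_seminorm ℂ k n g x)
  map_add' g h := by
    refine BddForm.ext fun x => ?_
    have := iteratedFDeriv_add_apply (x := x) ((g.smooth n).contDiffAt) ((h.smooth n).contDiffAt)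
    change (‖x‖ ^ k : ℝ) • iteratedFDeriv ℝ n (g + h : 𝓢(E d, ℂ)) x = _
    rw [show ((g + h : 𝓢(E d, ℂ)) : E d → ℂ) = (g : E d → ℂ) + h from rfl, this, smul_add]
    rfl
  map_smul' c g := by
    refine BddForm.ext fun x => ?_
    have := iteratedFDeriv_const_smul_apply (a := c) (x := x) ((g.smooth n).contDiffAt)
    change (‖x‖ ^ k : ℝ) • iteratedFDeriv ℝ n (c • g : 𝓢(E d, ℂ)) x =
      c • ((‖x‖ ^ k : ℝ) • iteratedFDeriv ℝ n g x)
    rw [show ((c • g : 𝓢(E d, ℂ)) : E d → ℂ) = c • (g : E d → ℂ) from rfl, this, smul_comm]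

theorem weightedDeriv_apply (k n : ℕ) (g : 𝓢(E d, ℂ)) (x : E d) :
    BddForm.eval x (weightedDeriv k n g) = (‖x‖ ^ k : ℝ) • iteratedFDeriv ℝ n g x := rfl

theorem norm_weightedDeriv_le (k n : ℕ) (g : 𝓢(E d, ℂ)) :
    ‖weightedDeriv k n g‖ ≤ SchwartzMap.seminorm ℂ k n g :=
  BoundedContinuousFunction.norm_ofNormedAddCommGroup_le _ (apply_nonneg _ _) fun x => by
    rw [norm_smul, norm_pow, norm_norm]
    exact SchwartzMap.le_seminorm ℂ k n g x

theorem seminorm_le_norm_weightedDeriv (k n : ℕ) (g : 𝓢(E d, ℂ)) :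
    SchwartzMap.seminorm ℂ k n g ≤ ‖weightedDeriv k n g‖ := by
  refine SchwartzMap.seminorm_le_bound ℂ k n g ?_ fun x => ?_
  · positivity
  have := (weightedDeriv k n g).norm_eval_le x
  rwa [weightedDeriv_apply, norm_smul, norm_pow, norm_norm] at this

theorem continuous_weightedDeriv (k n : ℕ) : Continuous (weightedDeriv (d := d) k n) := by
  refine WithSeminorms.continuous_normedSpace_rng _
    (schwartz_withSeminorms ℂ (E d) ℂ) (weightedDeriv (d := d) k n)
    ⟨{(k, n)}, 1, fun g => ?_⟩
  simpa using norm_weightedDeriv_le k n g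

/-- A linear functional dominated by `‖J ·‖` factors through `J`. -/
theorem exists_dual_comp_eq {X B : Type*} [AddCommGroup X] [Module ℂ X] [NormedAddCommGroup B]
    [NormedSpace ℂ B] (J : X →ₗ[ℂ] B) (f : X →ₗ[ℂ] ℂ) (C : ℝ≥0) (hbd : ∀ g, ‖f g‖ ≤ C * ‖J g‖) :
    ∃ Λ : StrongDual ℂ B, ∀ g, f g = Λ (J g) := by
  -- The bound forces `f` to vanish wherever `J` does, so `f` descends to the range of `J`.
  -- Hahn–Banach then extends it with the same seminorm bound.
  have hker : LinearMap.ker J ≤ LinearMap.ker f := by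
    intro g hg
    have h0 : J g = 0 := hg
    have := hbd g
    rw [h0, norm_zero, mul_zero] at this
    exact norm_le_zero_iff.1 this
  obtain ⟨F, hF⟩ : ∃ F : Module.Dual ℂ (LinearMap.range J),
      ∀ g, F ⟨J g, LinearMap.mem_range_self J g⟩ = f g := by
    refine ⟨((LinearMap.ker J).liftQ f hker).comp
      (LinearEquiv.toLinearMap J.quotKerEquivRange.symm), fun g => ?_⟩
    have : J.quotKerEquivRange.symm ⟨J g, LinearMap.mem_range_self J g⟩ =
      (LinearMap.ker J).mkQ g := LinearMap.quotKerEquivRange_symm_apply_image J g _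
    simp [this]
  obtain ⟨Λ, hΛ, -⟩ := Module.Dual.exists_continuous_extension_of_le_seminorm (LinearMap.range J) F
    (p := C • normSeminorm ℂ _) (by
      change Continuous fun x => (C : ℝ) * ‖x‖
      fun_prop) (by
      rintro ⟨_, g, rfl⟩
      rw [hF]
      exact hbd g)
  refine ⟨Λ, fun g => ?_⟩
  rw [← hF, ← hΛ]

/-- A tempered distribution is bounded by finitely many seminorms. -/
theorem exists_seminorm_bound (f : 𝓢'(E d, ℂ)) :
    ∃ (s : Finset (ℕ × ℕ)) (C : ℝ≥0), ∀ g : 𝓢(E d, ℂ),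
      ‖f g‖ ≤ C * (s.sup (schwartzSeminormFamily ℂ (E d) ℂ)) g := by
  obtain ⟨s, C, -, hb⟩ := Seminorm.bound_of_continuous (schwartz_withSeminorms ℂ (E d) ℂ)
    ((normSeminorm ℂ ℂ).comp (f : 𝓢(E d, ℂ) →ₗ[ℂ] ℂ)) (by
      change Continuous fun g => ‖f g‖
      fun_prop)
  exact ⟨s, C, hb⟩

/-- A tempered distribution factors through finitely many weighted derivatives. -/
theorem exists_factor_weightedDeriv (f : 𝓢'(E d, ℂ)) :
    ∃ (s : Finset (ℕ × ℕ))
      (Λ : StrongDual ℂ ((i : s) → BddForm d i.1.2)),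
      ∀ g : 𝓢(E d, ℂ), f g = Λ (fun i => weightedDeriv i.1.1 i.1.2 g) := by
  obtain ⟨s, C, hb⟩ := exists_seminorm_bound f
  refine ⟨s, ?_⟩
  refine exists_dual_comp_eq (LinearMap.pi fun i : s => weightedDeriv i.1.1 i.1.2)
    (f : 𝓢(E d, ℂ) →ₗ[ℂ] ℂ) C fun g => (hb g).trans ?_
  gcongr
  refine Seminorm.finset_sup_apply_le (by positivity) fun i hi => ?_
  exact (seminorm_le_norm_weightedDeriv i.1 i.2 g).trans (norm_le_pi_norm
    (LinearMap.pi (fun i : s => weightedDeriv i.1.1 i.1.2) g) ⟨i, hi⟩)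

/-- Weak integration of a family of Schwartz functions against a tempered distribution. -/
theorem integral_apply_of_weightedDeriv (f : 𝓢'(E d, ℂ)) (κ : E d → ℂ) (G : E d → 𝓢(E d, ℂ))
    (H : 𝓢(E d, ℂ)) (hG : Continuous G) (hκ : Continuous κ)
    (hint : ∀ k n, Integrable fun z => ‖κ z‖ * SchwartzMap.seminorm ℂ k n (G z))
    (hH : ∀ n y, iteratedFDeriv ℝ n H y = ∫ z, κ z • iteratedFDeriv ℝ n (G z) y) :
    Integrable (fun z => κ z * f (G z)) ∧ f H = ∫ z, κ z * f (G z) := by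
  obtain ⟨s, Λ, hΛ⟩ := exists_factor_weightedDeriv f
  have hJint : ∀ i : s, Integrable fun z => κ z • weightedDeriv i.1.1 i.1.2 (G z) := by
    intro i
    refine (hint i.1.1 i.1.2).mono' ?_ (.of_forall fun z => ?_)
    · exact (hκ.smul ((continuous_weightedDeriv _ _).comp hG)).aestronglyMeasurable
    · rw [norm_smul]
      gcongr
      exact norm_weightedDeriv_le _ _ _
  have hJ : Integrable fun z => fun i : s => κ z • weightedDeriv i.1.1 i.1.2 (G z) :=
    Integrable.of_eval hJint
  -- The Bochner integral is taken in a finite product of Banach spaces of bounded forms. It is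
  -- identified by evaluating at each point, where the hypothesis on the derivatives of `H` applies.
  have hkey : (fun i : s => weightedDeriv i.1.1 i.1.2 H) =
      ∫ z, (fun i : s => κ z • weightedDeriv i.1.1 i.1.2 (G z)) := by
    funext i
    rw [eval_integral hJint]
    refine BddForm.ext fun y => ?_
    rw [← ContinuousLinearMap.integral_comp_comm _ (hJint i), weightedDeriv_apply, hH,
      ← integral_smul]
    refine integral_congr_ae (.of_forall fun z => ?_)
    simp only [map_smul, weightedDeriv_apply]
    rw [smul_comm]
  have hval : ∀ z, κ z * f (G z) = Λ (fun i : s => κ z • weightedDeriv i.1.1 i.1.2 (G z)) := by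
    intro z
    rw [hΛ, ← smul_eq_mul, ← map_smul]
    rfl
  simp_rw [hval]
  refine ⟨Λ.integrable_comp hJ, ?_⟩
  rw [Λ.integral_comp_comm hJ, hΛ, hkey]

/-! ### Translates of Schwartz functions and associativity of convolution. -/

theorem iteratedFDeriv_reflectAt (ψ : 𝓢(E d, ℂ)) (n : ℕ) (x y : E d) :
    iteratedFDeriv ℝ n (reflectAt ψ x) y = iteratedFDeriv ℝ n (reflectAt ψ 0) (y - x) := by
  have : (reflectAt ψ x : E d → ℂ) = fun y => reflectAt ψ 0 (y - x) := by
    funext y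
    simp [reflectAt_apply]
  rw [this, iteratedFDeriv_comp_sub]

theorem pow_norm_le_two_pow_mul (k : ℕ) (x y : E d) :
    ‖y‖ ^ k ≤ 2 ^ k * (‖y - x‖ ^ k + ‖x‖ ^ k) := by
  have h1 : ‖y‖ ≤ 2 * max ‖y - x‖ ‖x‖ := by
    calc ‖y‖ = ‖(y - x) + x‖ := by simp
      _ ≤ ‖y - x‖ + ‖x‖ := norm_add_le _ _
      _ ≤ _ := by rw [two_mul]; exact add_le_add (le_max_left _ _) (le_max_right _ _)
  calc ‖y‖ ^ k ≤ (2 * max ‖y - x‖ ‖x‖) ^ k := by gcongr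
    _ = 2 ^ k * (max ‖y - x‖ ‖x‖) ^ k := mul_pow _ _ _
    _ ≤ _ := by
      gcongr
      rcases max_cases ‖y - x‖ ‖x‖ with h | h <;> rw [h.1] <;> simp

/-- The seminorms of a translate grow polynomially. -/
theorem seminorm_reflectAt_le (ψ : 𝓢(E d, ℂ)) (k n : ℕ) (x : E d) :
    SchwartzMap.seminorm ℂ k n (reflectAt ψ x) ≤
      2 ^ k * (SchwartzMap.seminorm ℂ k n (reflectAt ψ 0) +
        ‖x‖ ^ k * SchwartzMap.seminorm ℂ 0 n (reflectAt ψ 0)) := by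
  refine SchwartzMap.seminorm_le_bound ℂ k n _ (by positivity) fun y => ?_
  rw [iteratedFDeriv_reflectAt]
  calc ‖y‖ ^ k * ‖iteratedFDeriv ℝ n (reflectAt ψ 0) (y - x)‖
      ≤ 2 ^ k * (‖y - x‖ ^ k + ‖x‖ ^ k) * ‖iteratedFDeriv ℝ n (reflectAt ψ 0) (y - x)‖ := by
        gcongr
        exact pow_norm_le_two_pow_mul k x y
    _ = 2 ^ k * (‖y - x‖ ^ k * ‖iteratedFDeriv ℝ n (reflectAt ψ 0) (y - x)‖ +
        ‖x‖ ^ k * ‖iteratedFDeriv ℝ n (reflectAt ψ 0) (y - x)‖) := by ring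
    _ ≤ _ := by
        gcongr
        · exact SchwartzMap.le_seminorm ℂ k n _ _
        · exact norm_iteratedFDeriv_bdd _ _ _

/-- Mean value inequality for `t ↦ ‖y‖^k • D^n(y - t)` on the ball of radius `ρ`. One more
derivative is spent, and the translation costs `ρ^k` as in the bound for a single translate. -/
theorem seminorm_reflectAt_sub_le (ψ : 𝓢(E d, ℂ)) (k n : ℕ) (ρ : ℝ) (x x' : E d)
    (hx : ‖x‖ ≤ ρ) (hx' : ‖x'‖ ≤ ρ) :
    SchwartzMap.seminorm ℂ k n (reflectAt ψ x - reflectAt ψ x') ≤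
      2 ^ k * (SchwartzMap.seminorm ℂ k (n + 1) (reflectAt ψ 0) +
        ρ ^ k * SchwartzMap.seminorm ℂ 0 (n + 1) (reflectAt ψ 0)) * ‖x - x'‖ := by
  have hρ : 0 ≤ ρ := (norm_nonneg _).trans hx
  refine SchwartzMap.seminorm_le_bound ℂ k n _ (by positivity) fun y => ?_
  have hsub : iteratedFDeriv ℝ n (reflectAt ψ x - reflectAt ψ x' : 𝓢(E d, ℂ)) y =
      iteratedFDeriv ℝ n (reflectAt ψ 0) (y - x) - iteratedFDeriv ℝ n (reflectAt ψ 0) (y - x') := by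
    rw [show ((reflectAt ψ x - reflectAt ψ x' : 𝓢(E d, ℂ)) : E d → ℂ) =
      (reflectAt ψ x : E d → ℂ) - reflectAt ψ x' from rfl,
      iteratedFDeriv_sub_apply ((reflectAt ψ x).smooth n).contDiffAt
        ((reflectAt ψ x').smooth n).contDiffAt, iteratedFDeriv_reflectAt ψ n x,
      iteratedFDeriv_reflectAt ψ n x']
  have hψ := (reflectAt ψ 0).smooth ⊤
  have hdiff : Differentiable ℝ (iteratedFDeriv ℝ n (reflectAt ψ 0)) :=
    hψ.differentiable_iteratedFDeriv (mod_cast ENat.natCast_lt_top n)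
  have hder : ∀ t : E d, HasFDerivAt (fun t => (‖y‖ ^ k : ℝ) • iteratedFDeriv ℝ n (reflectAt ψ 0) (y - t))
      ((‖y‖ ^ k : ℝ) • (-(fderiv ℝ (iteratedFDeriv ℝ n (reflectAt ψ 0)) (y - t)))) t := by
    intro t
    have h1 := (hdiff (y - t)).hasFDerivAt
    have h2 : HasFDerivAt (fun t => y - t) (-(ContinuousLinearMap.id ℝ (E d))) t :=
      (hasFDerivAt_id t).const_sub y
    have h3 := (h1.comp t h2).const_smul (‖y‖ ^ k : ℝ)
    rwa [ContinuousLinearMap.comp_neg, ContinuousLinearMap.comp_id] at h3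
  have hmv := (convex_closedBall (0 : E d) ρ).norm_image_sub_le_of_norm_hasFDerivWithin_le
    (f := fun t => (‖y‖ ^ k : ℝ) • iteratedFDeriv ℝ n (reflectAt ψ 0) (y - t))
    (C := 2 ^ k * (SchwartzMap.seminorm ℂ k (n + 1) (reflectAt ψ 0) +
        ρ ^ k * SchwartzMap.seminorm ℂ 0 (n + 1) (reflectAt ψ 0)))
    (fun t _ => (hder t).hasFDerivWithinAt) (fun t ht => ?_) (x := x') (y := x)
    (by simpa using hx') (by simpa using hx)
  · rw [hsub]
    rwa [← smul_sub, norm_smul, norm_pow, norm_norm] at hmv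
  · have ht' : ‖t‖ ≤ ρ := by simpa using ht
    rw [norm_smul, norm_neg, norm_fderiv_iteratedFDeriv, norm_pow, norm_norm]
    calc ‖y‖ ^ k * ‖iteratedFDeriv ℝ (n + 1) (reflectAt ψ 0) (y - t)‖
        ≤ 2 ^ k * (‖y - t‖ ^ k + ‖t‖ ^ k) * ‖iteratedFDeriv ℝ (n + 1) (reflectAt ψ 0) (y - t)‖ := by
          gcongr
          exact pow_norm_le_two_pow_mul k t y
      _ = 2 ^ k * (‖y - t‖ ^ k * ‖iteratedFDeriv ℝ (n + 1) (reflectAt ψ 0) (y - t)‖ +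
        ‖t‖ ^ k * ‖iteratedFDeriv ℝ (n + 1) (reflectAt ψ 0) (y - t)‖) := by ring
      _ ≤ _ := by
        gcongr
        · exact SchwartzMap.le_seminorm ℂ k (n + 1) _ _
        · exact norm_iteratedFDeriv_bdd _ _ _

theorem continuous_reflectAt (ψ : 𝓢(E d, ℂ)) : Continuous (reflectAt ψ) := by
  rw [continuous_iff_continuousAt]
  intro x₀
  rw [ContinuousAt, (schwartz_withSeminorms ℂ (E d) ℂ).tendsto_nhds]
  rintro ⟨k, n⟩ ε hε
  -- Lipschitz constant on the ball of radius `‖x₀‖ + 1`, which contains the unit ball about `x₀`.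
  set C := 2 ^ k * (SchwartzMap.seminorm ℂ k (n + 1) (reflectAt ψ 0) +
        (‖x₀‖ + 1) ^ k * SchwartzMap.seminorm ℂ 0 (n + 1) (reflectAt ψ 0)) with hC
  have ht : Tendsto (fun x => C * ‖x - x₀‖) (nhds x₀) (nhds (C * ‖x₀ - x₀‖)) :=
    Continuous.tendsto (by fun_prop) x₀
  rw [sub_self, norm_zero, mul_zero] at ht
  filter_upwards [ht.eventually (gt_mem_nhds hε), Metric.ball_mem_nhds x₀ one_pos] with x hx hx1
  refine (seminorm_reflectAt_sub_le ψ k n (‖x₀‖ + 1) x x₀ ?_ (by linarith)).trans_lt hx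
  have := norm_le_norm_add_norm_sub' x x₀
  rw [mem_ball_iff_norm] at hx1
  linarith

theorem exists_seminorm_reflectAt_le (ψ : 𝓢(E d, ℂ)) (k n : ℕ) :
    ∃ C : ℝ, 0 ≤ C ∧ ∀ x, SchwartzMap.seminorm ℂ k n (reflectAt ψ x) ≤ C * (1 + ‖x‖) ^ k := by
  refine ⟨2 ^ k * (SchwartzMap.seminorm ℂ k n (reflectAt ψ 0) +
    SchwartzMap.seminorm ℂ 0 n (reflectAt ψ 0)), by positivity, fun x => ?_⟩
  refine (seminorm_reflectAt_le ψ k n x).trans ?_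
  rw [mul_assoc, add_mul, mul_comm (‖x‖ ^ k)]
  gcongr
  · exact le_mul_of_one_le_right (apply_nonneg _ _) (one_le_pow₀ (by simp))
  · simp

theorem continuous_conv (ψ : 𝓢(E d, ℂ)) (f : 𝓢'(E d, ℂ)) : Continuous (conv ψ f) :=
  (map_continuous f).comp (continuous_reflectAt ψ)

/-- A distribution is controlled by finitely many seminorms, and each of these grows polynomially
under translation. This a priori growth starts the argument for the Peetre inequality. -/
theorem exists_norm_conv_le (ψ : 𝓢(E d, ℂ)) (f : 𝓢'(E d, ℂ)) :
    ∃ (C : ℝ) (N : ℕ), 0 ≤ C ∧ ∀ x, ‖conv ψ f x‖ ≤ C * (1 + ‖x‖) ^ N := by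
  obtain ⟨s, C, hC⟩ := exists_seminorm_bound f
  choose B hB0 hB using fun i : ℕ × ℕ => exists_seminorm_reflectAt_le ψ i.1 i.2
  refine ⟨C * ∑ i ∈ s, B i, s.sup Prod.fst, mul_nonneg C.2 (Finset.sum_nonneg fun i _ => hB0 i),
    fun x => ?_⟩
  refine (hC _).trans ?_
  rw [mul_assoc]
  gcongr
  refine Seminorm.finset_sup_apply_le (mul_nonneg (Finset.sum_nonneg fun i _ => hB0 i)
    (by positivity)) fun i hi => ?_
  refine (hB i x).trans ?_
  refine mul_le_mul (Finset.single_le_sum (fun i _ => hB0 i) hi) ?_ (by positivity)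
    (Finset.sum_nonneg fun i _ => hB0 i)
  exact pow_le_pow_right₀ (by simp) (Finset.le_sup (f := Prod.fst) hi)

theorem integrable_norm_mul_one_add_norm_pow (κ : 𝓢(E d, ℂ)) (N : ℕ) :
    Integrable fun z => ‖κ z‖ * (1 + ‖z‖) ^ N := by
  have h : Integrable fun z => (2 : ℝ) ^ N * ‖κ z‖ + 2 ^ N * (‖z‖ ^ N * ‖κ z‖) :=
    (κ.integrable.norm.const_mul _).add ((κ.integrable_pow_mul volume N).const_mul _)
  refine h.mono' ?_ (.of_forall fun z => ?_)
  · exact Continuous.aestronglyMeasurable (by have := κ.continuous; fun_prop)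
  · rw [Real.norm_of_nonneg (by positivity)]
    have : (1 + ‖z‖) ^ N ≤ 2 ^ N * (1 + ‖z‖ ^ N) := by
      rcases le_total ‖z‖ 1 with hz | hz
      · calc (1 + ‖z‖) ^ N ≤ 2 ^ N := by gcongr; linarith
          _ ≤ _ := le_mul_of_one_le_right (by positivity) (by simp)
      · calc (1 + ‖z‖) ^ N ≤ (2 * ‖z‖) ^ N := by gcongr; linarith
          _ = 2 ^ N * ‖z‖ ^ N := mul_pow _ _ _
          _ ≤ _ := by gcongr; simp
    calc _ ≤ ‖κ z‖ * (2 ^ N * (1 + ‖z‖ ^ N)) := by gcongr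
      _ = _ := by ring

/-- `(κ * φ) * f = κ * (φ * f)`. -/
theorem conv_eq_integral (f : 𝓢'(E d, ℂ)) (κ φ H : 𝓢(E d, ℂ))
    (hH : ∀ w, H w = ∫ z, κ z * φ (w - z)) (x : E d) :
    Integrable (fun z => κ z * conv φ f (x - z)) ∧ conv H f x = ∫ z, κ z * conv φ f (x - z) := by
  -- The reflected `H` is the weak integral of the reflected translates of `φ` with density `κ`.
  -- Their seminorms grow polynomially in `z`, which the rapid decay of `κ` compensates.
  refine integral_apply_of_weightedDeriv f κ (fun z => reflectAt φ (x - z)) (reflectAt H x)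
    ((continuous_reflectAt φ).comp (continuous_const.sub continuous_id)) κ.continuous ?_ ?_
  · intro k n
    obtain ⟨C, hC0, hC⟩ := exists_seminorm_reflectAt_le φ k n
    have h := (integrable_norm_mul_one_add_norm_pow κ k).const_mul (C * (1 + ‖x‖) ^ k)
    refine h.mono' ?_ (.of_forall fun z => ?_)
    · refine Continuous.aestronglyMeasurable (κ.continuous.norm.mul ?_)
      exact ((schwartz_withSeminorms ℂ (E d) ℂ).continuous_seminorm (k, n)).comp
        ((continuous_reflectAt φ).comp (continuous_const.sub continuous_id))
    · rw [Real.norm_of_nonneg (by positivity)]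
      have h1 : 1 + ‖x - z‖ ≤ (1 + ‖x‖) * (1 + ‖z‖) := by
        have := norm_sub_le x z
        nlinarith [norm_nonneg x, norm_nonneg z]
      calc ‖κ z‖ * SchwartzMap.seminorm ℂ k n (reflectAt φ (x - z))
          ≤ ‖κ z‖ * (C * ((1 + ‖x‖) * (1 + ‖z‖)) ^ k) := by
            gcongr
            refine (hC _).trans ?_
            gcongr
        _ = _ := by rw [mul_pow]; ring
  · intro n y
    rw [iteratedFDeriv_integral_mul κ (reflectAt φ x) (reflectAt H x)]
    · refine integral_congr_ae (.of_forall fun z => ?_)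
      simp only
      rw [iteratedFDeriv_reflectAt φ n x, iteratedFDeriv_reflectAt φ n (x - z)]
      rw [sub_sub_eq_add_sub, add_sub_assoc]
    · intro y
      simp only [reflectAt_apply, hH, sub_sub]

/-! ### Polynomially decaying kernels and Carleson-type suprema -/

/-- The weight `1 + 2^k |y|`. -/
def weight (k : ℕ) (y : E d) : ℝ≥0∞ := 1 + 2 ^ k * ‖y‖ₑ

/-- The kernel `2^{kd} (1 + 2^k |y|)^{-L}`. -/
def decay (L : ℝ) (k : ℕ) (y : E d) : ℝ≥0∞ := 2 ^ (k * d) * weight k y ^ (-L)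

/-- The convolution with `decay L k`. -/
def decayConv (L : ℝ) (k : ℕ) (w : E d → ℝ≥0∞) (x : E d) : ℝ≥0∞ :=
  ∫⁻ y, decay L k (x - y) * w y

theorem one_le_weight (k : ℕ) (y : E d) : 1 ≤ weight k y := le_self_add

theorem weight_ne_zero (k : ℕ) (y : E d) : weight k y ≠ 0 :=
  (zero_lt_one.trans_le (one_le_weight k y)).ne'

theorem weight_ne_top (k : ℕ) (y : E d) : weight k y ≠ ⊤ := by
  unfold weight
  finiteness

theorem weight_rpow_ne_zero (k : ℕ) (y : E d) (L : ℝ) : weight k y ^ L ≠ 0 := by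
  simp [ENNReal.rpow_eq_zero_iff, weight_ne_zero, weight_ne_top]

theorem weight_rpow_ne_top (k : ℕ) (y : E d) (L : ℝ) : weight k y ^ L ≠ ⊤ := by
  simp [ENNReal.rpow_eq_top_iff, weight_ne_zero, weight_ne_top]

theorem measurable_weight (k : ℕ) : Measurable (weight (d := d) k) := by
  unfold weight
  fun_prop

theorem measurable_decay (L : ℝ) (k : ℕ) : Measurable (decay (d := d) L k) :=
  ((measurable_weight k).pow_const _).const_mul _

theorem weight_neg (k : ℕ) (y : E d) : weight k (-y) = weight k y := by simp [weight]

theorem weight_sub_comm (k : ℕ) (x y : E d) : weight k (x - y) = weight k (y - x) := by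
  rw [← weight_neg, neg_sub]

theorem weight_add_le (k : ℕ) (x y : E d) : weight k (x + y) ≤ weight k x * weight k y := by
  unfold weight
  calc 1 + 2 ^ k * ‖x + y‖ₑ ≤ 1 + 2 ^ k * (‖x‖ₑ + ‖y‖ₑ) := by gcongr; exact enorm_add_le x y
    _ ≤ 1 + 2 ^ k * (‖x‖ₑ + ‖y‖ₑ) + 2 ^ k * ‖x‖ₑ * (2 ^ k * ‖y‖ₑ) := le_self_add
    _ = _ := by ring

theorem weight_sub_le (k : ℕ) (x y z : E d) :
    weight k (x - z) ≤ weight k (x - y) * weight k (y - z) := by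
  simpa using weight_add_le k (x - y) (y - z)

theorem weight_mono {k l : ℕ} (h : k ≤ l) (y : E d) : weight k y ≤ weight l y := by
  unfold weight
  gcongr
  exact one_le_two

/-- Slow variation of powers of the weight. -/
theorem weight_rpow_neg_le {L : ℝ} (hL : 0 ≤ L) (k : ℕ) (x y z : E d) :
    weight k (y - z) ^ (-L) ≤ weight k (x - y) ^ L * weight k (x - z) ^ (-L) := by
  have h1 : weight k (x - z) ^ L ≤ weight k (x - y) ^ L * weight k (y - z) ^ L := by
    rw [← ENNReal.mul_rpow_of_nonneg _ _ hL]
    gcongr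
    exact weight_sub_le k x y z
  rw [ENNReal.rpow_neg, ENNReal.rpow_neg]
  set a := weight k (y - z) ^ L with ha
  set b := weight k (x - y) ^ L
  set c := weight k (x - z) ^ L with hc
  have ha0 : a ≠ 0 := weight_rpow_ne_zero _ _ _
  have ha1 : a ≠ ⊤ := weight_rpow_ne_top _ _ _
  have hc0 : c ≠ 0 := weight_rpow_ne_zero _ _ _
  have hc1 : c ≠ ⊤ := weight_rpow_ne_top _ _ _
  calc a⁻¹ = a⁻¹ * (c * c⁻¹) := by rw [ENNReal.mul_inv_cancel hc0 hc1, mul_one]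
    _ ≤ a⁻¹ * (b * a * c⁻¹) := by gcongr
    _ = (a * a⁻¹) * (b * c⁻¹) := by ring
    _ = b * c⁻¹ := by rw [ENNReal.mul_inv_cancel ha0 ha1, one_mul]

theorem decay_le {L : ℝ} (hL : 0 ≤ L) (k : ℕ) (x y z : E d) :
    decay L k (y - z) ≤ weight k (x - y) ^ L * decay L k (x - z) := by
  unfold decay
  rw [mul_left_comm]
  gcongr
  exact weight_rpow_neg_le hL k x y z

theorem measurable_decayConv (L : ℝ) (k : ℕ) {w : E d → ℝ≥0∞} (hw : Measurable w) :
    Measurable (decayConv L k w) := by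
  refine Measurable.lintegral_prod_right' (f := fun p : E d × E d => decay L k (p.1 - p.2) * w p.2) ?_
  exact ((measurable_decay L k).comp (measurable_fst.sub measurable_snd)).mul
    (hw.comp measurable_snd)

/-- Moving the centre of the kernel costs a power of the weight, uniformly in the integration
variable, so the comparison passes to the integral against any nonnegative `w`. -/
theorem decayConv_le_weight_mul {L : ℝ} (hL : 0 ≤ L) (k : ℕ) (w : E d → ℝ≥0∞) (x y : E d) :
    decayConv L k w y ≤ weight k (x - y) ^ L * decayConv L k w x := by
  unfold decayConv
  rw [← lintegral_const_mul' _ _ (weight_rpow_ne_top _ _ _)]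
  refine lintegral_mono fun z => ?_
  rw [← mul_assoc]
  gcongr
  exact decay_le hL k x y z

theorem lintegral_comp_two_pow_smul (G : E d → ℝ≥0∞) (k : ℕ) :
    2 ^ (k * d) * ∫⁻ y, G ((2 : ℝ) ^ k • y) = ∫⁻ z, G z := by
  have h2 : (2 : ℝ) ^ k ≠ 0 := by positivity
  have hmap := Measure.map_addHaar_smul (volume : Measure (E d)) h2
  have hemb : MeasurableEmbedding fun y : E d => (2 : ℝ) ^ k • y :=
    (Homeomorph.smulOfNeZero _ h2).measurableEmbedding
  rw [← hemb.lintegral_map, hmap, lintegral_smul_measure, finrank_euclideanSpace_fin, ← pow_mul,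
    abs_of_pos (by positivity), ENNReal.ofReal_inv_of_pos (by positivity),
    ENNReal.ofReal_pow (by norm_num), ENNReal.ofReal_ofNat, smul_eq_mul, ← mul_assoc,
    ENNReal.mul_inv_cancel (by simp) (by simp), one_mul]

theorem weight_two_pow_smul (k : ℕ) (y : E d) : weight 0 ((2 : ℝ) ^ k • y) = weight k y := by
  unfold weight
  rw [enorm_smul, enorm_pow]
  simp [enorm_eq_nnnorm]

/-- After rescaling the density no longer depends on `k`; only the translation by `2^{-k} z` does.
Averaging is thereby reduced to translations of cubes. -/
theorem decayConv_eq_lintegral (L : ℝ) (k : ℕ) (w : E d → ℝ≥0∞) (x : E d) :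
    decayConv L k w x = ∫⁻ z, weight 0 z ^ (-L) * w (x - ((2 : ℝ) ^ k)⁻¹ • z) := by
  rw [← lintegral_comp_two_pow_smul _ k, ← lintegral_const_mul' _ _ (by simp), decayConv,
    ← lintegral_sub_left_eq_self _ x]
  congr 1 with y
  have h2 : (2 : ℝ) ^ k ≠ 0 := by positivity
  rw [sub_sub_cancel, decay, weight_two_pow_smul, smul_smul, inv_mul_cancel₀ h2, one_smul, mul_assoc]

/-- `∫ (1 + |z|)^{-L} dz` -/
theorem lintegral_weight_lt_top {L : ℝ} (hL : (d : ℝ) < L) :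
    ∫⁻ z : E d, weight 0 z ^ (-L) < ⊤ := by
  have h := finite_integral_one_add_norm (E := E d) (μ := volume) (r := L) (by simpa using hL)
  convert h using 3 with z
  rw [← ENNReal.ofReal_rpow_of_pos (by positivity), ENNReal.ofReal_add (by norm_num) (by positivity)]
  simp [weight]

theorem lintegral_decay (L : ℝ) (k : ℕ) (x : E d) :
    ∫⁻ y, decay L k (x - y) = ∫⁻ z : E d, weight 0 z ^ (-L) := by
  have := decayConv_eq_lintegral L k (fun _ => 1) x
  simpa [decayConv] using this

/-! #### Dyadic cubes -/

theorem measurableSet_dyadicCube (μ : ℕ) (n : Fin d → ℤ) : MeasurableSet (dyadicCube μ n) := by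
  unfold dyadicCube
  simp only [Set.ofPred_forall]
  refine MeasurableSet.iInter fun i => ?_
  have hi : Measurable fun x : E d => x i := by fun_prop
  exact (measurableSet_le measurable_const hi).inter (measurableSet_lt hi measurable_const)

theorem volume_dyadicCube (μ : ℕ) (n : Fin d → ℤ) :
    volume (dyadicCube μ n) = (2 ^ (μ * d))⁻¹ := by
  have h := (PiLp.volume_preserving_ofLp (Fin d)).measure_preimage
    (s := Set.pi Set.univ fun i => Set.Ico ((2 : ℝ) ^ (-(μ : ℤ)) * n i)
      ((2 : ℝ) ^ (-(μ : ℤ)) * (n i + 1)))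
    (MeasurableSet.univ_pi fun i => measurableSet_Ico).nullMeasurableSet
  have he : dyadicCube μ n = (@WithLp.ofLp 2 (Fin d → ℝ)) ⁻¹'
      (Set.pi Set.univ fun i => Set.Ico ((2 : ℝ) ^ (-(μ : ℤ)) * n i)
      ((2 : ℝ) ^ (-(μ : ℤ)) * (n i + 1))) := by
    ext x
    simp [dyadicCube]
  rw [he, h, Real.volume_pi_Ico]
  simp_rw [← mul_sub, add_sub_cancel_left, mul_one]
  rw [Finset.prod_const, Finset.card_univ, Fintype.card_fin, zpow_neg, zpow_natCast,
    ENNReal.ofReal_inv_of_pos (by positivity), ENNReal.ofReal_pow (by norm_num),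
    ENNReal.ofReal_ofNat, ← ENNReal.inv_pow, pow_mul]

theorem volume_dyadicCube_ne_zero (μ : ℕ) (n : Fin d → ℤ) : volume (dyadicCube μ n) ≠ 0 := by
  rw [volume_dyadicCube]
  simp

theorem volume_dyadicCube_ne_top (μ : ℕ) (n : Fin d → ℤ) : volume (dyadicCube μ n) ≠ ⊤ := by
  rw [volume_dyadicCube]
  simp

/-- Every point lies in a dyadic cube of given side length. -/
theorem exists_mem_dyadicCube (μ : ℕ) (x : E d) : ∃ n, x ∈ dyadicCube μ n := by
  refine ⟨fun i => ⌊(2 : ℝ) ^ μ * x i⌋, fun i => ?_⟩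
  have h2 : (0 : ℝ) < (2 : ℝ) ^ μ := by positivity
  rw [zpow_neg, zpow_natCast, inv_mul_le_iff₀ h2, lt_inv_mul_iff₀ h2]
  exact ⟨Int.floor_le _, Int.lt_floor_add_one _⟩

/-- A translate of a dyadic cube is covered by neighbouring cubes of the same size. -/
theorem sub_mem_dyadicCube {μ : ℕ} {n : Fin d → ℤ} {x v : E d} {R : ℕ} (hx : x ∈ dyadicCube μ n)
    (hv : (2 : ℝ) ^ μ * ‖v‖ ≤ R) :
    ∃ n' ∈ Fintype.piFinset fun i => Finset.Icc (n i - R) (n i + R), x - v ∈ dyadicCube μ n' := by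
  obtain ⟨n', hn'⟩ := exists_mem_dyadicCube μ (x - v)
  refine ⟨n', ?_, hn'⟩
  rw [Fintype.mem_piFinset]
  intro i
  have h2 : (0 : ℝ) < (2 : ℝ) ^ μ := by positivity
  have h3 := hn' i
  have h4 := hx i
  rw [zpow_neg, zpow_natCast, inv_mul_le_iff₀ h2, lt_inv_mul_iff₀ h2] at h3 h4
  have h5 : |v i| ≤ ‖v‖ := PiLp.norm_apply_le v i
  have h6 : |(2 : ℝ) ^ μ * v i| ≤ R := by
    rw [abs_mul, abs_of_pos h2]
    exact (mul_le_mul_of_nonneg_left h5 h2.le).trans hv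
  rw [abs_le] at h6
  simp only [PiLp.sub_apply, mul_sub] at h3
  rw [Finset.mem_Icc]
  constructor
  · have : (n i - R : ℝ) < n' i + 1 := by linarith
    have : (n i - R : ℤ) < n' i + 1 := by exact_mod_cast this
    omega
  · have : (n' i : ℝ) < n i + R + 1 := by linarith
    have : (n' i : ℤ) < n i + R + 1 := by exact_mod_cast this
    omega

theorem card_neighbours (n : Fin d → ℤ) (R : ℕ) :
    (Fintype.piFinset fun i => Finset.Icc (n i - (R : ℤ)) (n i + R)).card = (2 * R + 1) ^ d := by
  rw [Fintype.card_piFinset]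
  have : ∀ i, (Finset.Icc (n i - (R : ℤ)) (n i + R)).card = 2 * R + 1 := by
    intro i
    rw [Int.card_Icc]
    omega
  simp [this]

/-- The translated cube is covered by the neighbours within `R` steps in each coordinate, and the
remaining integral is translation invariant. -/
theorem setLIntegral_comp_sub_le {μ : ℕ} (n : Fin d → ℤ) {v : E d} {R : ℕ}
    (hv : (2 : ℝ) ^ μ * ‖v‖ ≤ R) {w : E d → ℝ≥0∞} (hw : Measurable w) :
    ∫⁻ x in dyadicCube μ n, w (x - v) ≤
      ∑ n' ∈ Fintype.piFinset fun i => Finset.Icc (n i - (R : ℤ)) (n i + R),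
        ∫⁻ x in dyadicCube μ n', w x := by
  set S := Fintype.piFinset fun i => Finset.Icc (n i - (R : ℤ)) (n i + R)
  have h1 : ∫⁻ x in dyadicCube μ n, w (x - v) ≤
      ∫⁻ x, ∑ n' ∈ S, (dyadicCube μ n').indicator w (x - v) := by
    rw [← lintegral_indicator (measurableSet_dyadicCube μ n)]
    gcongr with x
    by_cases hx : x ∈ dyadicCube μ n
    · obtain ⟨n', hn', hmem⟩ := sub_mem_dyadicCube hx hv
      rw [Set.indicator_of_mem hx, ← Set.indicator_of_mem hmem w]
      exact Finset.single_le_sum (f := fun n' => (dyadicCube μ n').indicator w (x - v))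
        (fun _ _ => zero_le) hn'
    · simp [Set.indicator_of_notMem hx]
  refine h1.trans ?_
  rw [lintegral_sub_right_eq_self (fun x => ∑ n' ∈ S, (dyadicCube μ n').indicator w x) v]
  rw [lintegral_finsetSum]
  · exact (Finset.sum_congr rfl fun n' _ => lintegral_indicator (measurableSet_dyadicCube μ n') w).le
  · exact fun n' _ => hw.indicator (measurableSet_dyadicCube μ _)

/-- The Carleson-type supremum of a sequence of nonnegative functions. -/
def carleson (w : ℕ → E d → ℝ≥0∞) : ℝ≥0∞ :=
  ⨆ (μ : ℕ) (_ : 1 ≤ μ) (n : Fin d → ℤ),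
    (volume (dyadicCube μ n))⁻¹ * ∫⁻ x in dyadicCube μ n, ∑' k : Set.Ici μ, w k x

/-- The volume of a cube is positive and finite, so it can be cleared. Taken with `B = carleson w`
this also serves as the basic estimate on a single cube. -/
theorem carleson_le_iff {w : ℕ → E d → ℝ≥0∞} {B : ℝ≥0∞} :
    carleson w ≤ B ↔ ∀ μ, 1 ≤ μ → ∀ n : Fin d → ℤ,
      ∫⁻ x in dyadicCube μ n, ∑' k : Set.Ici μ, w k x ≤ volume (dyadicCube μ n) * B := by
  simp only [carleson, iSup_le_iff]
  refine forall₃_congr fun μ _ n => ?_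
  rw [ENNReal.inv_mul_le_iff (volume_dyadicCube_ne_zero μ n) (volume_dyadicCube_ne_top μ n)]

theorem carleson_mono {w w' : ℕ → E d → ℝ≥0∞} (h : ∀ k x, 1 ≤ k → w k x ≤ w' k x) :
    carleson w ≤ carleson w' := by
  refine carleson_le_iff.2 fun μ hμ n => le_trans ?_ (carleson_le_iff.1 le_rfl μ hμ n)
  exact lintegral_mono fun x => ENNReal.tsum_le_tsum fun k => h _ _ (hμ.trans k.2)

theorem carleson_const_mul_le (w : ℕ → E d → ℝ≥0∞) {c : ℝ≥0∞} (hc : c ≠ ⊤) :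
    carleson (fun k x => c * w k x) ≤ c * carleson w := by
  refine carleson_le_iff.2 fun μ hμ n => ?_
  simp_rw [ENNReal.tsum_mul_left]
  rw [lintegral_const_mul' _ _ hc, mul_left_comm]
  gcongr
  exact carleson_le_iff.1 le_rfl μ hμ n

theorem carleson_add_le {w w' : ℕ → E d → ℝ≥0∞} (hw : ∀ k, Measurable (w k)) :
    carleson (fun k x => w k x + w' k x) ≤ carleson w + carleson w' := by
  refine carleson_le_iff.2 fun μ hμ n => ?_
  simp_rw [ENNReal.tsum_add]
  rw [lintegral_add_left (Measurable.tsum fun k : Set.Ici μ => hw k), mul_add]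
  exact add_le_add (carleson_le_iff.1 le_rfl μ hμ n) (carleson_le_iff.1 le_rfl μ hμ n)

theorem carleson_tsum_le {ι : Type*} [Countable ι] (w : ι → ℕ → E d → ℝ≥0∞)
    (hw : ∀ i k, Measurable (w i k)) :
    carleson (fun k x => ∑' i, w i k x) ≤ ∑' i, carleson (w i) := by
  refine carleson_le_iff.2 fun μ hμ n => ?_
  have h1 : ∀ x, ∑' k : Set.Ici μ, ∑' i, w i k x = ∑' i, ∑' k : Set.Ici μ, w i k x :=
    fun x => ENNReal.tsum_comm
  simp_rw [h1]
  rw [lintegral_tsum fun i => (Measurable.tsum fun k : Set.Ici μ => hw i k).aemeasurable,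
    ← ENNReal.tsum_mul_left]
  exact ENNReal.tsum_le_tsum fun i => carleson_le_iff.1 le_rfl μ hμ n

/-- A forward shift maps the scales `k ≥ μ` injectively into themselves, so it only discards terms.
-/
theorem carleson_shift_le (w : ℕ → E d → ℝ≥0∞) (t : ℕ) :
    carleson (fun k => w (k + t)) ≤ carleson w := by
  refine carleson_le_iff.2 fun μ hμ n => le_trans ?_ (carleson_le_iff.1 le_rfl μ hμ n)
  refine lintegral_mono fun x => ?_
  have hinj : Function.Injective fun k : Set.Ici μ => (⟨k + t, le_trans k.2 (Nat.le_add_right _ _)⟩ : Set.Ici μ) := by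
    intro a b hab
    have := congrArg Subtype.val hab
    exact Subtype.ext (Nat.add_right_cancel this)
  exact ENNReal.tsum_comp_le_tsum_of_injective hinj fun k : Set.Ici μ => w k x

theorem tsum_setLIntegral_le_carleson {w : ℕ → E d → ℝ≥0∞} (hw : ∀ k, Measurable (w k))
    {μ : ℕ} (hμ : 1 ≤ μ) (n : Fin d → ℤ) :
    ∑' k : Set.Ici μ, ∫⁻ x in dyadicCube μ n, w k x ≤ volume (dyadicCube μ n) * carleson w := by
  rw [← lintegral_tsum fun k : Set.Ici μ => (hw k).aemeasurable]
  exact carleson_le_iff.1 le_rfl μ hμ n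

/-- Stability of the Carleson supremum under convolution with decaying kernels. -/
theorem exists_carleson_decayConv_le {L : ℝ} (hL : 2 * (d : ℝ) < L) :
    ∃ C : ℝ≥0∞, C ≠ ⊤ ∧ ∀ w : ℕ → E d → ℝ≥0∞, (∀ k, Measurable (w k)) →
      carleson (fun k => decayConv L k (w k)) ≤ C * carleson w := by
  -- Counting the neighbouring cubes costs `d` powers of the weight. Integrability of what is left
  -- requires `L - d > d`, which is the hypothesis on `L`.
  refine ⟨3 ^ d * ∫⁻ z : E d, weight 0 z ^ (-(L - d)), ?_, fun w hw => ?_⟩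
  · exact ENNReal.mul_ne_top (by simp) (lintegral_weight_lt_top (by linarith)).ne
  refine carleson_le_iff.2 fun μ hμ n => ?_
  set P := dyadicCube μ n with hP
  have hmeas : ∀ k, Measurable fun p : E d × E d =>
      weight 0 p.2 ^ (-L) * w k (p.1 - ((2 : ℝ) ^ k)⁻¹ • p.2) := by
    intro k
    refine (((measurable_weight 0).comp measurable_snd).pow_const _).mul ((hw k).comp ?_)
    fun_prop
  have hmeas2 : ∀ k, Measurable fun z : E d =>
      ∫⁻ x in P, w k (x - ((2 : ℝ) ^ k)⁻¹ • z) := by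
    intro k
    refine Measurable.lintegral_prod_right'
      (f := fun p : E d × E d => w k (p.2 - ((2 : ℝ) ^ k)⁻¹ • p.1)) ((hw k).comp ?_)
    fun_prop
  calc ∫⁻ x in P, ∑' k : Set.Ici μ, decayConv L k (w k) x
      = ∑' k : Set.Ici μ, ∫⁻ x in P, ∫⁻ z, weight 0 z ^ (-L) *
          w k (x - ((2 : ℝ) ^ (k : ℕ))⁻¹ • z) := by
        rw [lintegral_tsum fun k : Set.Ici μ => (measurable_decayConv L k (hw k)).aemeasurable]
        simp_rw [decayConv_eq_lintegral]
    _ = ∑' k : Set.Ici μ, ∫⁻ z, weight 0 z ^ (-L) *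
          ∫⁻ x in P, w k (x - ((2 : ℝ) ^ (k : ℕ))⁻¹ • z) := by
        refine tsum_congr fun k => ?_
        rw [lintegral_lintegral_swap (hmeas k).aemeasurable]
        refine lintegral_congr fun z => ?_
        rw [lintegral_const_mul' _ _ (weight_rpow_ne_top _ _ _)]
    _ = ∫⁻ z, weight 0 z ^ (-L) * ∑' k : Set.Ici μ,
          ∫⁻ x in P, w k (x - ((2 : ℝ) ^ (k : ℕ))⁻¹ • z) := by
        simp_rw [← ENNReal.tsum_mul_left]
        rw [lintegral_tsum]
        exact fun k => (((measurable_weight 0).pow_const _).mul (hmeas2 k)).aemeasurable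
    _ ≤ ∫⁻ z, weight 0 z ^ (-L) * ((3 * weight 0 z) ^ d * (volume P * carleson w)) := by
        refine lintegral_mono fun z => mul_le_mul_right ?_ _
        -- For `k ≥ μ` the shift `2^{-k} z` is at most `‖z‖` sides of the cube, so the same family
        -- of neighbours serves every scale in the sum.
        set R := ⌈‖z‖⌉₊ with hR
        set S := Fintype.piFinset fun i => Finset.Icc (n i - (R : ℤ)) (n i + R) with hS
        have hRz : (2 * R + 1 : ℝ≥0∞) ≤ 3 * weight 0 z := by
          have h1 : (R : ℝ) ≤ ‖z‖ + 1 := (Nat.ceil_lt_add_one (norm_nonneg z)).le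
          have h2 : (R : ℝ≥0∞) ≤ ‖z‖ₑ + 1 := by
            rw [← ofReal_norm, ← ENNReal.ofReal_one, ← ENNReal.ofReal_add (by positivity)
              (by norm_num), ← ENNReal.ofReal_natCast]
            exact ENNReal.ofReal_le_ofReal h1
          unfold weight
          calc (2 * R + 1 : ℝ≥0∞) ≤ 2 * (‖z‖ₑ + 1) + 1 := by gcongr
            _ = 3 + 2 * ‖z‖ₑ := by ring
            _ ≤ 3 + 3 * ‖z‖ₑ := by gcongr; norm_num
            _ = _ := by ring
        calc ∑' k : Set.Ici μ, ∫⁻ x in P, w k (x - ((2 : ℝ) ^ (k : ℕ))⁻¹ • z)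
            ≤ ∑' k : Set.Ici μ, ∑ n' ∈ S, ∫⁻ x in dyadicCube μ n', w k x := by
              refine ENNReal.tsum_le_tsum fun k => setLIntegral_comp_sub_le n ?_ (hw k)
              have hk : (2 : ℝ) ^ μ ≤ 2 ^ (k : ℕ) := pow_le_pow_right₀ one_le_two k.2
              have hk0 : (0 : ℝ) < 2 ^ (k : ℕ) := by positivity
              rw [norm_smul, norm_inv, norm_pow, Real.norm_ofNat]
              calc (2 : ℝ) ^ μ * ((2 ^ (k : ℕ))⁻¹ * ‖z‖) ≤ 2 ^ (k : ℕ) * ((2 ^ (k : ℕ))⁻¹ * ‖z‖) := by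
                    gcongr
                _ = ‖z‖ := by rw [← mul_assoc, mul_inv_cancel₀ hk0.ne', one_mul]
                _ ≤ R := Nat.le_ceil _
          _ = ∑ n' ∈ S, ∑' k : Set.Ici μ, ∫⁻ x in dyadicCube μ n', w k x :=
              Summable.tsum_finsetSum fun _ _ => ENNReal.summable
          _ ≤ ∑ n' ∈ S, volume P * carleson w := by
              refine Finset.sum_le_sum fun n' _ => ?_
              have := tsum_setLIntegral_le_carleson hw hμ n'
              rwa [volume_dyadicCube, ← volume_dyadicCube μ n] at this
          _ = (2 * R + 1) ^ d * (volume P * carleson w) := by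
              rw [Finset.sum_const, card_neighbours, nsmul_eq_mul]
              push_cast
              rfl
          _ ≤ _ := by gcongr
    _ = volume P * (3 ^ d * (∫⁻ z : E d, weight 0 z ^ (-(L - d))) * carleson w) := by
        have : ∀ z : E d, weight 0 z ^ (-L) * ((3 * weight 0 z) ^ d * (volume P * carleson w)) =
            weight 0 z ^ (-(L - d)) * (3 ^ d * (volume P * carleson w)) := by
          intro z
          rw [mul_pow, neg_sub, sub_eq_neg_add, ENNReal.rpow_add _ _ (weight_ne_zero 0 z)
            (weight_ne_top 0 z), ENNReal.rpow_natCast]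
          ring
        simp_rw [this]
        rw [lintegral_mul_const _ ((measurable_weight 0).pow_const _)]
        ring

/-! ### Inequalities for powers of integrals and sums -/

/-- Jensen's inequality for a nonnegative kernel. -/
theorem lintegral_mul_rpow_le {α : Type*} [MeasurableSpace α] (ν : Measure α) {q : ℝ} (hq : 1 ≤ q)
    {h g : α → ℝ≥0∞} (hh : AEMeasurable h ν) (hg : AEMeasurable g ν) :
    (∫⁻ a, h a * g a ∂ν) ^ q ≤ (∫⁻ a, h a ∂ν) ^ (q - 1) * ∫⁻ a, h a * g a ^ q ∂ν := by
  rcases hq.eq_or_lt with rfl | hq1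
  · simp
  have hq0 : 0 < q := by linarith
  have hpq : (Real.conjExponent q).HolderConjugate q := (Real.HolderConjugate.conjExponent hq1).symm
  set p := Real.conjExponent q with hp
  have hp0 : 0 < p := hpq.pos
  have hsum : 1 / p + 1 / q = 1 := by simpa using hpq.inv_add_inv_eq_one
  -- Hölder's inequality with the splitting `h g = h^{1/p} · (h^{1/q} g)`.
  have key := ENNReal.lintegral_mul_le_Lp_mul_Lq ν hpq (hh.pow_const (1 / p))
    ((hh.pow_const (1 / q)).mul hg)
  have e1 : ∀ a, (fun a => h a ^ (1 / p)) a * ((fun a => h a ^ (1 / q)) * g) a = h a * g a := by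
    intro a
    simp only [Pi.mul_apply]
    rw [← mul_assoc, ← ENNReal.rpow_add_of_nonneg _ _ (by positivity) (by positivity), hsum,
      ENNReal.rpow_one]
  have e2 : ∀ a, (h a ^ (1 / p)) ^ p = h a := by
    intro a
    rw [← ENNReal.rpow_mul, one_div_mul_cancel hp0.ne', ENNReal.rpow_one]
  have e3 : ∀ a, (((fun a => h a ^ (1 / q)) * g) a) ^ q = h a * g a ^ q := by
    intro a
    simp only [Pi.mul_apply]
    rw [ENNReal.mul_rpow_of_nonneg _ _ hq0.le, ← ENNReal.rpow_mul, one_div_mul_cancel hq0.ne',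
      ENNReal.rpow_one]
  simp only [Pi.mul_apply] at e1 e3 key
  simp_rw [e1, e2, e3] at key
  calc (∫⁻ a, h a * g a ∂ν) ^ q
      ≤ ((∫⁻ a, h a ∂ν) ^ (1 / p) * (∫⁻ a, h a * g a ^ q ∂ν) ^ (1 / q)) ^ q := by gcongr
    _ = _ := by
      rw [ENNReal.mul_rpow_of_nonneg _ _ hq0.le, ← ENNReal.rpow_mul, ← ENNReal.rpow_mul,
        one_div_mul_cancel hq0.ne', ENNReal.rpow_one]
      congr 2
      have : 1 / p = 1 - 1 / q := by linarith
      rw [this]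
      field_simp

theorem tsum_rpow_le {ι : Type*} (a : ι → ℝ≥0∞) {q : ℝ} (hq : 0 < q) (hq1 : q ≤ 1) :
    (∑' i, a i) ^ q ≤ ∑' i, a i ^ q := by
  have hfin : ∀ s : Finset ι, (∑ i ∈ s, a i) ^ q ≤ ∑ i ∈ s, a i ^ q := by
    intro s
    classical
    induction s using Finset.induction_on with
    | empty => simp [hq]
    | insert i s hi ih =>
      rw [Finset.sum_insert hi, Finset.sum_insert hi]
      exact (ENNReal.rpow_add_le_add_rpow _ _ hq.le hq1).trans (by gcongr)
  rw [← ENNReal.le_rpow_inv_iff hq, ENNReal.tsum_eq_iSup_sum]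
  refine iSup_le fun s => ?_
  rw [ENNReal.le_rpow_inv_iff hq]
  exact (hfin s).trans (ENNReal.sum_le_tsum s)

/-- The factor `1 + t` is the loss incurred by shifting a Carleson sequence back by `t` scales. -/
theorem tsum_geometric_lt_top {ε : ℝ} (hε : 0 < ε) :
    ∑' t : ℕ, (2 : ℝ≥0∞) ^ (-(ε * t)) * (1 + t) < ⊤ := by
  set r : ℝ := 2 ^ (-ε) with hr
  have hr0 : 0 < r := by positivity
  have hr1 : r < 1 := Real.rpow_lt_one_of_one_lt_of_neg one_lt_two (by linarith)
  have hs : Summable fun t : ℕ => r ^ t * (1 + t) := by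
    have h1 := summable_geometric_of_lt_one hr0.le hr1
    have h2 := (hasSum_coe_mul_geometric_of_norm_lt_one
      (r := r) (by rwa [Real.norm_of_nonneg hr0.le])).summable
    exact (h1.add h2).congr fun t => by ring
  have he : ∀ t : ℕ, (2 : ℝ≥0∞) ^ (-(ε * t)) * (1 + t) = ENNReal.ofReal (r ^ t * (1 + t)) := by
    intro t
    rw [ENNReal.ofReal_mul (by positivity), ENNReal.ofReal_add (by norm_num) (by positivity),
      ENNReal.ofReal_one, ENNReal.ofReal_natCast, hr, ← Real.rpow_natCast, ← Real.rpow_mul (by norm_num),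
      ← ENNReal.ofReal_rpow_of_pos (by norm_num), ENNReal.ofReal_ofNat, neg_mul]
  simp_rw [he]
  exact hs.tsum_ofReal_lt_top

/-- The `ℓ^q` triangle inequality with geometric weights. -/
theorem exists_geometric_tsum_rpow_le {ε q : ℝ} (hε : 0 < ε) (hq : 0 < q) :
    ∃ (C : ℝ≥0∞) (δ : ℝ), C ≠ ⊤ ∧ 0 < δ ∧ ∀ b : ℕ → ℝ≥0∞,
      (∑' t : ℕ, 2 ^ (-(ε * t)) * b t ^ (1 / q)) ^ q ≤ C * ∑' t : ℕ, 2 ^ (-(δ * t)) * b t := by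
  have hone : ∀ x : ℝ≥0∞, (x ^ (1 / q)) ^ q = x := fun x => by
    rw [← ENNReal.rpow_mul, one_div_mul_cancel hq.ne', ENNReal.rpow_one]
  rcases le_total q 1 with hq1 | hq1
  -- For `q ≤ 1` the power `q` is subadditive. The weights are raised to the power `q` and remain
  -- geometric, with rate `ε q`.
  · refine ⟨1, ε * q, ENNReal.one_ne_top, by positivity, fun b => ?_⟩
    refine (tsum_rpow_le _ hq hq1).trans_eq ?_
    rw [one_mul]
    refine tsum_congr fun t => ?_
    rw [ENNReal.mul_rpow_of_nonneg _ _ hq.le, hone, ← ENNReal.rpow_mul]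
    congr 2
    ring
  -- For `q ≥ 1` Jensen's inequality on `ℕ` keeps the rate `ε`; the constant is the total mass to
  -- the power `q - 1`.
  · refine ⟨(∑' t : ℕ, 2 ^ (-(ε * t))) ^ (q - 1), ε, ?_, hε, fun b => ?_⟩
    · refine ENNReal.rpow_ne_top_of_nonneg (by linarith) (ne_top_of_le_ne_top
        (tsum_geometric_lt_top hε).ne (ENNReal.tsum_le_tsum fun t => ?_))
      exact le_mul_of_one_le_right' le_self_add
    · have := lintegral_mul_rpow_le (Measure.count (α := ℕ)) hq1
        (h := fun t : ℕ => (2 : ℝ≥0∞) ^ (-(ε * t))) (g := fun t => b t ^ (1 / q))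
        (measurable_of_countable _).aemeasurable (measurable_of_countable _).aemeasurable
      simpa only [lintegral_count, hone] using this

theorem add_rpow_le_two_rpow (a b : ℝ≥0∞) {q : ℝ} (hq : 0 < q) :
    (a + b) ^ q ≤ 2 ^ q * (a ^ q + b ^ q) := by
  wlog hab : a ≤ b generalizing a b
  · rw [add_comm, add_comm (a ^ q)]
    exact this b a (le_of_not_ge hab)
  calc (a + b) ^ q ≤ (2 * b) ^ q := by
        gcongr
        rw [two_mul]
        gcongr
    _ = 2 ^ q * b ^ q := ENNReal.mul_rpow_of_nonneg _ _ hq.le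
    _ ≤ _ := by gcongr; exact le_add_self

/-! ### Slowly varying functions -/

/-- A function that is essentially constant at scale `2^{-k}`. -/
def SlowlyVarying (L : ℝ) (k : ℕ) (A : E d → ℝ≥0∞) : Prop :=
  ∀ x y, A y ≤ weight k (x - y) ^ L * A x

theorem slowlyVarying_decayConv {L : ℝ} (hL : 0 ≤ L) (k : ℕ) (w : E d → ℝ≥0∞) :
    SlowlyVarying L k (decayConv L k w) := fun x y => decayConv_le_weight_mul hL k w x y

/-- In units of `2^{-k}` the cube has side one, hence diameter at most `√d`. -/
theorem weight_le_of_mem_dyadicCube {k : ℕ} {n : Fin d → ℤ} {x y : E d}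
    (hx : x ∈ dyadicCube k n) (hy : y ∈ dyadicCube k n) :
    weight k (x - y) ≤ 1 + ENNReal.ofReal (Real.sqrt d) := by
  have h2 : (0 : ℝ) < (2 : ℝ) ^ k := by positivity
  have hi : ∀ i, ‖(2 : ℝ) ^ k * (x - y) i‖ ^ 2 ≤ 1 := by
    intro i
    have h3 := hx i
    have h4 := hy i
    rw [zpow_neg, zpow_natCast, inv_mul_le_iff₀ h2, lt_inv_mul_iff₀ h2] at h3 h4
    rw [Real.norm_eq_abs, sq_abs, sq_le_one_iff_abs_le_one, abs_le, PiLp.sub_apply, mul_sub]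
    constructor <;> linarith
  have hn : ‖(2 : ℝ) ^ k • (x - y)‖ ≤ Real.sqrt d := by
    rw [EuclideanSpace.norm_eq]
    apply Real.sqrt_le_sqrt
    calc ∑ i, ‖((2 : ℝ) ^ k • (x - y)) i‖ ^ 2 ≤ ∑ _i : Fin d, (1 : ℝ) :=
          Finset.sum_le_sum fun i _ => by simpa using hi i
      _ = d := by simp
  rw [← weight_two_pow_smul, weight, pow_zero, one_mul, ← ofReal_norm]
  gcongr

/-- A sequence of slowly varying functions is bounded by its Carleson supremum. -/
theorem exists_slowlyVarying_le_carleson (d : ℕ) {L : ℝ} (hL : 0 ≤ L) :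
    ∃ C : ℝ≥0∞, C ≠ ⊤ ∧ ∀ A : ℕ → E d → ℝ≥0∞, (∀ k, SlowlyVarying L k (A k)) →
      ∀ k, 1 ≤ k → ∀ x, A k x ≤ C * carleson A := by
  refine ⟨(1 + ENNReal.ofReal (Real.sqrt d)) ^ L,
    ENNReal.rpow_ne_top_of_nonneg hL (by finiteness), fun A hA k hk x => ?_⟩
  obtain ⟨n, hn⟩ := exists_mem_dyadicCube k x
  have hC : (1 + ENNReal.ofReal (Real.sqrt d)) ^ L ≠ ⊤ :=
    ENNReal.rpow_ne_top_of_nonneg hL (by finiteness)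
  set C := (1 + ENNReal.ofReal (Real.sqrt d)) ^ L
  -- On the cube of side `2^{-k}` containing `x`, only the term `l = k` of the sum is kept; slow
  -- variation compares it with its value at `x`.
  have h1 : volume (dyadicCube k n) * A k x ≤ volume (dyadicCube k n) * (C * carleson A) := by
    calc volume (dyadicCube k n) * A k x = ∫⁻ _y in dyadicCube k n, A k x := by
          rw [setLIntegral_const, mul_comm]
      _ ≤ ∫⁻ y in dyadicCube k n, C * ∑' l : Set.Ici k, A l y := by
          refine setLIntegral_mono' (measurableSet_dyadicCube k n) fun y hy => ?_
          refine (hA k y x).trans (mul_le_mul' ?_ (ENNReal.le_tsum (f := fun l : Set.Ici k => A l y)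
            ⟨k, Set.self_mem_Ici⟩))
          exact ENNReal.rpow_le_rpow (weight_le_of_mem_dyadicCube hy hn) hL
      _ = C * ∫⁻ y in dyadicCube k n, ∑' l : Set.Ici k, A l y := lintegral_const_mul' _ _ hC
      _ ≤ C * (volume (dyadicCube k n) * carleson A) := by
          gcongr
          exact carleson_le_iff.1 le_rfl k hk n
      _ = _ := by ring
  rwa [ENNReal.mul_le_mul_iff_right (volume_dyadicCube_ne_zero k n)
    (volume_dyadicCube_ne_top k n)] at h1

theorem lintegral_weight_ne_zero (L : ℝ) : ∫⁻ z : E d, weight 0 z ^ (-L) ≠ 0 := by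
  rw [← pos_iff_ne_zero, lintegral_pos_iff_support ((measurable_weight 0).pow_const _)]
  have : Function.support (fun z : E d => weight 0 z ^ (-L)) = Set.univ := by
    ext z
    simpa using weight_rpow_ne_zero 0 z (-L)
  rw [this]
  exact isOpen_univ.measure_pos _ Set.univ_nonempty

/-- A slowly varying function is bounded by its average at scale `2^{-k}`. -/
theorem SlowlyVarying.mul_le_lintegral {L : ℝ} {k : ℕ} {g : E d → ℝ≥0∞} (hg : SlowlyVarying L k g)
    (y : E d) : (∫⁻ z : E d, weight 0 z ^ (-L)) * g y ≤ 2 ^ (k * d) * ∫⁻ z, g z := by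
  have hm : Measurable fun z => decay L k (y - z) :=
    (measurable_decay L k).comp (measurable_const.sub measurable_id)
  rw [← lintegral_decay L k y, ← lintegral_const_mul' _ _ (by simp), ← lintegral_mul_const _ hm]
  refine lintegral_mono fun z => ?_
  simp only [decay]
  rw [mul_assoc]
  gcongr
  calc weight k (y - z) ^ (-L) * g y ≤ weight k (y - z) ^ (-L) * (weight k (z - y) ^ L * g z) := by
        gcongr
        exact hg z y
    _ = g z := by
        rw [weight_sub_comm k z y, ← mul_assoc, ← ENNReal.rpow_add _ _ (weight_ne_zero _ _)
          (weight_ne_top _ _)]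
        simp

theorem SlowlyVarying.mul {L L' : ℝ} {k : ℕ} {g h : E d → ℝ≥0∞} (hg : SlowlyVarying L k g)
    (hh : SlowlyVarying L' k h) : SlowlyVarying (L + L') k fun y => g y * h y := by
  intro x y
  rw [ENNReal.rpow_add _ _ (weight_ne_zero _ _) (weight_ne_top _ _)]
  calc g y * h y ≤ (weight k (x - y) ^ L * g x) * (weight k (x - y) ^ L' * h x) :=
        mul_le_mul' (hg x y) (hh x y)
    _ = _ := by ring

/-- A weight at the coarser scale `2^{-l}` varies even more slowly than scale `2^{-k}` allows,
because the weights increase with the scale index. -/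
theorem slowlyVarying_weight_rpow {L : ℝ} (hL : 0 ≤ L) {l k : ℕ} (hlk : l ≤ k) (x : E d) :
    SlowlyVarying L k fun y => weight l (x - y) ^ (-L) := by
  intro z y
  have h := weight_rpow_neg_le hL l z y x
  rw [weight_sub_comm l y x, weight_sub_comm l z x] at h
  refine h.trans ?_
  gcongr
  exact weight_mono hlk _

theorem two_rpow_ne_top (t : ℝ) : (2 : ℝ≥0∞) ^ t ≠ ⊤ := by
  simp [ENNReal.rpow_eq_top_iff]

theorem two_rpow_ne_zero (t : ℝ) : (2 : ℝ≥0∞) ^ t ≠ 0 := by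
  simp [ENNReal.rpow_eq_zero_iff]

theorem two_rpow_add (a b : ℝ) : (2 : ℝ≥0∞) ^ (a + b) = 2 ^ a * 2 ^ b :=
  ENNReal.rpow_add _ _ two_ne_zero ENNReal.ofNat_ne_top

/-- Averages of `A^{1/q}` at a scale coarser than the one at which `A` is essentially constant. -/
theorem exists_lintegral_decay_mul_rpow_le {L q : ℝ} (hq : 0 < q) (hL : (d : ℝ) < L) :
    ∃ C : ℝ≥0∞, C ≠ ⊤ ∧ ∀ (l k : ℕ), l ≤ k → ∀ A : E d → ℝ≥0∞, Measurable A →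
      SlowlyVarying L k A → ∀ x,
      ∫⁻ y, decay (L / min 1 q) l (x - y) * A y ^ (1 / q) ≤
        C * (2 ^ (tau d q * ((k : ℝ) - l)) * decayConv L l A x ^ (1 / q)) := by
  have hd0 : (0 : ℝ) ≤ d := Nat.cast_nonneg d
  have hL0 : 0 ≤ L := by linarith
  have hmd : ∀ (L : ℝ) (l : ℕ) (x : E d), Measurable fun y => decay L l (x - y) := fun L l x =>
    (measurable_decay L l).comp (measurable_const.sub measurable_id)
  -- For `q ≥ 1` Jensen's inequality suffices and `τ_q = 0`. For `q ≤ 1` the exponent `1/q` is at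
  -- least one and the averages go the wrong way; this is where the loss `τ_q` arises.
  rcases le_total 1 q with hq1 | hq1
  · refine ⟨((∫⁻ z : E d, weight 0 z ^ (-L)) ^ (q - 1)) ^ (1 / q), ?_, fun l k hlk A hA _ x => ?_⟩
    · refine ENNReal.rpow_ne_top_of_nonneg (by positivity)
        (ENNReal.rpow_ne_top_of_nonneg (by linarith) (lintegral_weight_lt_top hL).ne)
    have h := lintegral_mul_rpow_le volume hq1 (hmd L l x).aemeasurable
      (hA.pow_const (1 / q)).aemeasurable
    simp_rw [← ENNReal.rpow_mul, one_div_mul_cancel hq.ne', ENNReal.rpow_one, lintegral_decay] at h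
    rw [min_eq_left hq1, div_one, tau, min_eq_left hq1, div_one, sub_self, zero_mul,
      ENNReal.rpow_zero, one_mul, ← ENNReal.mul_rpow_of_nonneg _ _ (by positivity), one_div,
      ENNReal.le_rpow_inv_iff hq]
    simpa [decayConv] using h
  · have hexp : 0 ≤ 1 / q - 1 := by
      rw [sub_nonneg, le_div_iff₀ hq]
      linarith
    set I := ∫⁻ z : E d, weight 0 z ^ (-(L + L)) with hI
    have hI0 : I ≠ 0 := lintegral_weight_ne_zero _
    have hI1 : I ≠ ⊤ := (lintegral_weight_lt_top (by linarith)).ne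
    refine ⟨(I⁻¹) ^ (1 / q - 1), ENNReal.rpow_ne_top_of_nonneg hexp (ENNReal.inv_ne_top.2 hI0),
      fun l k hlk A hA hslow x => ?_⟩
    -- The coarse weight is absorbed into the function. The product still varies slowly at the fine
    -- scale `2^{-k}`, so its supremum is at most a constant times `2^{kd}` times its integral, as
    -- in Bernstein's inequality.
    set g : E d → ℝ≥0∞ := fun y => weight l (x - y) ^ (-L) * A y with hg
    have hgm : Measurable g :=
      (((measurable_weight l).comp (measurable_const.sub measurable_id)).pow_const _).mul hA
    have hgs : SlowlyVarying (L + L) k g := (slowlyVarying_weight_rpow hL0 hlk x).mul hslow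
    set G := ∫⁻ y, g y with hG
    have hsup : ∀ y, g y ≤ I⁻¹ * (2 ^ (k * d) * G) := by
      intro y
      rw [← ENNReal.mul_le_iff_le_inv hI0 hI1]
      exact hgs.mul_le_lintegral y
    have hdec : decayConv L l A x = 2 ^ (l * d) * G := by
      rw [hG, ← lintegral_const_mul' _ _ (by simp)]
      simp only [decayConv, decay, hg, mul_assoc]
    have hint : ∀ y, decay (L / min 1 q) l (x - y) * A y ^ (1 / q) = 2 ^ (l * d) * g y ^ (1 / q) := by
      intro y
      rw [hg, min_eq_right hq1, decay, ENNReal.mul_rpow_of_nonneg _ _ (by positivity),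
        ← ENNReal.rpow_mul, mul_assoc]
      congr 3
      ring
    -- `L^{1/q}` is estimated between `L^∞` and `L^1`: `1/q - 1` powers are bounded by the supremum
    -- and one power is integrated.
    have h1 : ∫⁻ y, g y ^ (1 / q) ≤ (I⁻¹ * (2 ^ (k * d) * G)) ^ (1 / q - 1) * G := by
      rw [hG, ← lintegral_const_mul _ hgm]
      refine lintegral_mono fun y => ?_
      have : g y ^ (1 / q) = g y ^ (1 / q - 1) * g y := by
        conv_rhs => rw [← ENNReal.rpow_one (g y), ← ENNReal.rpow_mul, one_mul]
        rw [← ENNReal.rpow_add_of_nonneg _ _ hexp zero_le_one]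
        congr 1
        ring
      rw [this]
      exact mul_le_mul' (ENNReal.rpow_le_rpow (hsup y) hexp) le_rfl
    have h2 : G ^ (1 / q - 1) * G = G ^ (1 / q) := by
      conv_lhs => rw [← ENNReal.rpow_one G, ← ENNReal.rpow_mul, one_mul]
      rw [← ENNReal.rpow_add_of_nonneg _ _ hexp zero_le_one]
      congr 1
      ring
    have htwo : ∀ n : ℕ, (2 : ℝ≥0∞) ^ n = 2 ^ (n : ℝ) := fun n => (ENNReal.rpow_natCast 2 n).symm
    simp_rw [hint]
    rw [lintegral_const_mul' _ _ (by simp), hdec]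
    refine (mul_le_mul_right h1 _).trans_eq ?_
    rw [ENNReal.mul_rpow_of_nonneg _ _ hexp, ENNReal.mul_rpow_of_nonneg _ _ hexp,
      ENNReal.mul_rpow_of_nonneg _ _ (by positivity : (0 : ℝ) ≤ 1 / q), ← h2, htwo, htwo,
      ← ENNReal.rpow_mul, ← ENNReal.rpow_mul]
    -- The identity `ld + kd(1/q - 1) = τ_q (k - l) + ld/q`: the mismatch of the two scales is
    -- exactly the factor with `τ_q`.
    have h3 : (2 : ℝ≥0∞) ^ (((l * d : ℕ) : ℝ)) * 2 ^ (((k * d : ℕ) : ℝ) * (1 / q - 1)) =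
        2 ^ (tau d q * ((k : ℝ) - l)) * 2 ^ (((l * d : ℕ) : ℝ) * (1 / q)) := by
      rw [← two_rpow_add, ← two_rpow_add, tau, min_eq_right hq1]
      congr 1
      push_cast
      field_simp
      ring
    calc _ = I⁻¹ ^ (1 / q - 1) * (((2 : ℝ≥0∞) ^ (((l * d : ℕ) : ℝ)) *
          2 ^ (((k * d : ℕ) : ℝ) * (1 / q - 1))) * (G ^ (1 / q - 1) * G)) := by ring
      _ = _ := by rw [h3]; ring

/-! ### A mean value inequality for functions reproduced by a decaying kernel -/

/-- Let `P` be the Peetre maximal function. In the reproducing inequality write `F = F^{1-q} F^q`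
and bound `F^{1-q}` by `P^{1-q}` times a power of the weight, which lowers the decay from `σ` to `σ
q`. This gives `P ≤ P^{1-q} · K · (mean of F^q)`, and the finiteness of `P` allows division by
`P^{1-q}`. -/
theorem rpow_le_decayConv_of_iSup_lt_top {q σ : ℝ} (hq : 0 < q) (hq1 : q ≤ 1) (hσ : 0 ≤ σ)
    {k : ℕ} {F : E d → ℝ≥0∞} {K : ℝ≥0∞}
    (hrep : ∀ z, F z ≤ K * decayConv σ k F z) (x : E d)
    (hfin : ⨆ z, F z * weight k (x - z) ^ (-σ) ≠ ⊤) :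
    (⨆ z, F z * weight k (x - z) ^ (-σ)) ^ q ≤
      K * decayConv (σ * q) k (fun y => F y ^ q) x := by
  set P := ⨆ z, F z * weight k (x - z) ^ (-σ) with hP
  have hq1' : 0 ≤ 1 - q := by linarith
  have hFle : ∀ y, F y ≤ P * weight k (x - y) ^ σ := by
    intro y
    have h1 : F y * weight k (x - y) ^ (-σ) ≤ P := le_iSup (fun z => F z * weight k (x - z) ^ (-σ)) y
    calc F y = F y * weight k (x - y) ^ (-σ) * weight k (x - y) ^ σ := by
          rw [mul_assoc, ← ENNReal.rpow_add _ _ (weight_ne_zero _ _) (weight_ne_top _ _)]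
          simp
      _ ≤ _ := by gcongr
  have hFq : ∀ y, F y ≤ P ^ (1 - q) * (weight k (x - y) ^ (σ * (1 - q)) * F y ^ q) := by
    intro y
    calc F y = F y ^ (1 - q) * F y ^ q := by
          rw [← ENNReal.rpow_add_of_nonneg _ _ hq1' hq.le]
          simp
      _ ≤ (P * weight k (x - y) ^ σ) ^ (1 - q) * F y ^ q := by
          gcongr
          exact hFle y
      _ = _ := by
          rw [ENNReal.mul_rpow_of_nonneg _ _ hq1', ← ENNReal.rpow_mul, mul_assoc]
  have hP1 : P ^ (1 - q) ≠ ⊤ := ENNReal.rpow_ne_top_of_nonneg hq1' hfin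
  have key : P ≤ P ^ (1 - q) * (K * decayConv (σ * q) k (fun y => F y ^ q) x) := by
    refine iSup_le fun z => ?_
    calc F z * weight k (x - z) ^ (-σ) ≤ K * decayConv σ k F z * weight k (x - z) ^ (-σ) := by
          gcongr
          exact hrep z
      _ = K * ∫⁻ y, weight k (x - z) ^ (-σ) * (decay σ k (z - y) * F y) := by
          rw [lintegral_const_mul' _ _ (weight_rpow_ne_top _ _ _), decayConv]
          ring
      _ ≤ K * ∫⁻ y, P ^ (1 - q) * (decay (σ * q) k (x - y) * F y ^ q) := by
          refine mul_le_mul_right (lintegral_mono fun y => ?_) _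
          have h1 : weight k (x - z) ^ (-σ) * decay σ k (z - y) ≤ decay σ k (x - y) := by
            calc weight k (x - z) ^ (-σ) * decay σ k (z - y)
                ≤ weight k (x - z) ^ (-σ) * (weight k (x - z) ^ σ * decay σ k (x - y)) := by
                  gcongr
                  exact decay_le hσ k x z y
              _ = _ := by
                  rw [← mul_assoc, ← ENNReal.rpow_add _ _ (weight_ne_zero _ _) (weight_ne_top _ _)]
                  simp
          calc weight k (x - z) ^ (-σ) * (decay σ k (z - y) * F y)
              ≤ decay σ k (x - y) * (P ^ (1 - q) * (weight k (x - y) ^ (σ * (1 - q)) * F y ^ q)) := by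
                rw [← mul_assoc]
                exact mul_le_mul' h1 (hFq y)
            _ = P ^ (1 - q) * (2 ^ (k * d) * (weight k (x - y) ^ (-σ) *
                  weight k (x - y) ^ (σ * (1 - q))) * F y ^ q) := by
                rw [decay]
                ring
            _ = _ := by
                rw [← ENNReal.rpow_add _ _ (weight_ne_zero _ _) (weight_ne_top _ _), decay]
                congr 5
                ring
      _ = _ := by
          rw [lintegral_const_mul' _ _ hP1, decayConv]
          ring
  rcases eq_or_ne P 0 with h0 | h0
  · rw [h0, ENNReal.zero_rpow_of_pos hq]
    exact zero_le
  · have hPq : P = P ^ (1 - q) * P ^ q := by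
      rw [← ENNReal.rpow_add_of_nonneg _ _ hq1' hq.le]
      simp
    have hP0 : P ^ (1 - q) ≠ 0 := by
      simp [ENNReal.rpow_eq_zero_iff, h0, hfin]
    rw [← ENNReal.mul_le_mul_iff_right hP0 hP1, ← hPq]
    exact key

theorem decayConv_anti {L L' : ℝ} (h : L ≤ L') (k : ℕ) (w : E d → ℝ≥0∞) (x : E d) :
    decayConv L' k w x ≤ decayConv L k w x := by
  refine lintegral_mono fun y => ?_
  simp only [decay]
  gcongr
  exact one_le_weight _ _

/-- The Peetre-type inequality: a function of polynomial growth which is reproduced by rapidly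
decaying kernels at scale `2^{-k}` is controlled by its `L^q` means at that scale. -/
theorem rpow_le_weight_mul_decayConv {q L : ℝ} (hq : 0 < q) (hL : (d : ℝ) < L) {k : ℕ}
    {F : E d → ℝ≥0∞} (hF : Measurable F) {K : ℝ → ℝ≥0∞}
    (hK : ∀ σ, K σ ≠ ⊤) (hrep : ∀ σ, 0 ≤ σ → ∀ z, F z ≤ K σ * decayConv σ k F z)
    {B : ℝ≥0∞} {N : ℝ} (hB : B ≠ ⊤) (hN : 0 ≤ N) (hgrowth : ∀ y, F y ≤ B * weight k y ^ N)
    (x y : E d) :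
    F y ^ q ≤ ((1 + K (L / min 1 q)) ^ max 1 q * (1 + ∫⁻ z : E d, weight 0 z ^ (-L)) ^ max 1 q) *
      (weight k (x - y) ^ L * decayConv L k (fun y => F y ^ q) x) := by
  have hL0 : 0 ≤ L := (Nat.cast_nonneg d).trans hL.le
  set I := ∫⁻ z : E d, weight 0 z ^ (-L)
  rcases le_total 1 q with hq1 | hq1
  · rw [min_eq_left hq1, max_eq_right hq1, div_one]
    refine le_trans ?_ (mul_le_mul_right (decayConv_le_weight_mul hL0 k _ x y) _)
    have hmd : Measurable fun z => decay L k (y - z) :=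
      (measurable_decay L k).comp (measurable_const.sub measurable_id)
    have h := lintegral_mul_rpow_le volume hq1 hmd.aemeasurable hF.aemeasurable
    rw [lintegral_decay] at h
    calc F y ^ q ≤ (K L * decayConv L k F y) ^ q := by
          gcongr
          exact hrep L hL0 y
      _ = K L ^ q * decayConv L k F y ^ q := ENNReal.mul_rpow_of_nonneg _ _ hq.le
      _ ≤ (1 + K L) ^ q * ((1 + I) ^ q * decayConv L k (fun y => F y ^ q) y) := by
          gcongr
          · exact le_add_self
          · refine h.trans ?_
            rw [decayConv]
            gcongr
            calc I ^ (q - 1) ≤ (1 + I) ^ (q - 1) := by gcongr; exact le_add_self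
              _ ≤ _ := ENNReal.rpow_le_rpow_of_exponent_le le_self_add (by linarith)
      _ = _ := by ring
  · rw [min_eq_right hq1, max_eq_left hq1, ENNReal.rpow_one, ENNReal.rpow_one]
    set σ := L / q with hσ
    have hσq : σ * q = L := div_mul_cancel₀ _ hq.ne'
    have hσ0 : 0 ≤ σ := by positivity
    -- Polynomial growth makes the maximal function finite only for exponents at least the growth
    -- order `N`, which may exceed `σ`.
    have hgr : ∀ σ', N ≤ σ' → ∀ x, ⨆ z, F z * weight k (x - z) ^ (-σ') ≠ ⊤ := by
      intro σ' hσ' x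
      refine ne_top_of_le_ne_top (b := B * weight k x ^ N)
        (ENNReal.mul_ne_top hB (weight_rpow_ne_top _ _ _)) (iSup_le fun z => ?_)
      have h1 : weight k z ^ N ≤ weight k x ^ N * weight k (x - z) ^ N := by
        rw [← ENNReal.mul_rpow_of_nonneg _ _ hN, weight_sub_comm]
        gcongr
        simpa using weight_add_le k x (z - x)
      calc F z * weight k (x - z) ^ (-σ') ≤ B * (weight k x ^ N * weight k (x - z) ^ N) *
            weight k (x - z) ^ (-N) := by
            gcongr
            · exact (hgrowth z).trans (by gcongr)
            · exact one_le_weight _ _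
        _ = B * weight k x ^ N * (weight k (x - z) ^ N * weight k (x - z) ^ (-N)) := by ring
        _ = _ := by
          rw [← ENNReal.rpow_add _ _ (weight_ne_zero _ _) (weight_ne_top _ _)]
          simp
    set D := decayConv L k (fun y => F y ^ q) x with hD
    rcases eq_or_ne D ⊤ with hDt | hDt
    · rw [hDt, ENNReal.mul_top (weight_rpow_ne_zero _ _ _), ENNReal.mul_top]
      · exact le_top
      · simp
    -- A first pass with the larger exponent `max σ N` gives the inequality with a constant
    -- depending on `N`. It is used only to see that the maximal function with exponent `σ` is
    -- finite; the second pass, with `σ` itself, then has a constant independent of the growth of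
    -- `F`.
    have hqual : ∃ K' : ℝ≥0∞, K' ≠ ⊤ ∧ ∀ z, F z ^ q ≤ K' * decayConv L k (fun y => F y ^ q) z := by
      set σ' := max σ N
      refine ⟨K σ', hK _, fun z => ?_⟩
      have h := rpow_le_decayConv_of_iSup_lt_top hq hq1 (hσ0.trans (le_max_left σ N))
        (hrep σ' (hσ0.trans (le_max_left σ N))) z (hgr σ' (le_max_right σ N) z)
      calc F z ^ q ≤ (⨆ y, F y * weight k (z - y) ^ (-σ')) ^ q := by
            gcongr
            refine le_trans ?_ (le_iSup (fun y => F y * weight k (z - y) ^ (-σ')) z)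
            simp [weight]
        _ ≤ _ := h
        _ ≤ _ := by
            gcongr
            refine decayConv_anti ?_ _ _ _
            rw [← hσq]
            gcongr
            exact le_max_left σ N
    obtain ⟨K', hK', hKF⟩ := hqual
    have hpt : ∀ z, F z * weight k (x - z) ^ (-σ) ≤ (K' * D) ^ (1 / q) := by
      intro z
      rw [one_div, ENNReal.le_rpow_inv_iff hq, ENNReal.mul_rpow_of_nonneg _ _ hq.le,
        ← ENNReal.rpow_mul, neg_mul, hσq]
      calc F z ^ q * weight k (x - z) ^ (-L)
          ≤ K' * (weight k (x - z) ^ L * D) * weight k (x - z) ^ (-L) := by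
            gcongr
            refine (hKF z).trans ?_
            gcongr
            exact decayConv_le_weight_mul hL0 k _ x z
        _ = K' * D * (weight k (x - z) ^ L * weight k (x - z) ^ (-L)) := by ring
        _ = _ := by
          rw [← ENNReal.rpow_add _ _ (weight_ne_zero _ _) (weight_ne_top _ _)]
          simp
    have hfin : ⨆ z, F z * weight k (x - z) ^ (-σ) ≠ ⊤ :=
      ne_top_of_le_ne_top (ENNReal.rpow_ne_top_of_nonneg (by positivity)
        (ENNReal.mul_ne_top hK' hDt)) (iSup_le hpt)
    have h := rpow_le_decayConv_of_iSup_lt_top hq hq1 hσ0 (hrep σ hσ0) x hfin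
    rw [hσq] at h
    have h1 : (F y * weight k (x - y) ^ (-σ)) ^ q ≤ K σ * D := by
      refine le_trans ?_ h
      gcongr
      exact le_iSup (fun z => F z * weight k (x - z) ^ (-σ)) y
    rw [ENNReal.mul_rpow_of_nonneg _ _ hq.le, ← ENNReal.rpow_mul, neg_mul, hσq] at h1
    calc F y ^ q = F y ^ q * weight k (x - y) ^ (-L) * weight k (x - y) ^ L := by
          rw [mul_assoc, ← ENNReal.rpow_add _ _ (weight_ne_zero _ _) (weight_ne_top _ _)]
          simp
      _ ≤ K σ * D * weight k (x - y) ^ L := by gcongr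
      _ ≤ (1 + K σ) * (1 + I) * D * weight k (x - y) ^ L := by
          gcongr
          calc K σ ≤ (1 + K σ) * 1 := by rw [mul_one]; exact le_add_self
            _ ≤ _ := by gcongr; exact le_self_add
      _ = _ := by ring

/-! ### Summation over scales -/

/-- After the shift a cube of side `2^{-μ}` also sees the scales `μ - t ≤ k < μ`, which its Carleson
average does not control. There are at most `t` of them, and each is bounded by `B`. -/
theorem carleson_backward_shift_le (A : ℕ → E d → ℝ≥0∞) (hA : ∀ k, Measurable (A k)) {B : ℝ≥0∞}
    (hB : ∀ k x, A k x ≤ B) (hcar : carleson A ≤ B) (t : ℕ) :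
    carleson (fun l x => if t ≤ l then A (l - t) x else 0) ≤ (1 + t) * B := by
  refine carleson_le_iff.2 fun μ hμ n => ?_
  have hpt : ∀ x, ∑' l : Set.Ici μ, (if t ≤ (l : ℕ) then A (l - t) x else 0) ≤
      ∑' k : Set.Ici μ, A k x + t * B := by
    intro x
    have e1 : ∑' l : Set.Ici μ, (if t ≤ (l : ℕ) then A (l - t) x else 0) =
        ∑' l : ℕ, (Set.Ici μ).indicator (fun l => if t ≤ l then A (l - t) x else 0) l :=
      tsum_subtype (Set.Ici μ) fun l => if t ≤ l then A (l - t) x else 0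
    have e2 : ∑' k : Set.Ici μ, A k x = ∑' k : ℕ, (Set.Ici μ).indicator (fun k => A k x) k :=
      tsum_subtype _ (fun k => A k x)
    have e3 : ∑' l : ℕ, (Set.Ici μ).indicator (fun l => if t ≤ l then A (l - t) x else 0) l ≤
        ∑' k : ℕ, (Set.Ici μ).indicator (fun l => if t ≤ l then A (l - t) x else 0) (k + t) := by
      rw [← ENNReal.summable.sum_add_tsum_nat_add' (k := t), Finset.sum_eq_zero, zero_add]
      intro l hl
      rw [Finset.mem_range] at hl
      by_cases hlμ : l ∈ Set.Ici μ
      · rw [Set.indicator_of_mem hlμ, if_neg (by omega)]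
      · rw [Set.indicator_of_notMem hlμ]
    rw [e1, e2]
    refine e3.trans ?_
    -- If `k + t ≥ μ`, then either `k ≥ μ`, which is a term of the original sum, or `k` lies in `[μ
    -- - t, μ)`, where the uniform bound is used.
    calc ∑' k : ℕ, (Set.Ici μ).indicator (fun l => if t ≤ l then A (l - t) x else 0) (k + t)
        ≤ ∑' k : ℕ, ((Set.Ici μ).indicator (fun k => A k x) k +
            if k ∈ Finset.Ico (μ - t) μ then B else 0) := by
          refine ENNReal.tsum_le_tsum fun k => ?_
          by_cases h1 : k + t ∈ Set.Ici μ
          · rw [Set.indicator_of_mem h1, if_pos (by omega), Nat.add_sub_cancel]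
            by_cases h2 : k ∈ Set.Ici μ
            · rw [Set.indicator_of_mem h2]
              exact le_self_add
            · rw [Set.mem_Ici] at h1 h2
              rw [if_pos (by rw [Finset.mem_Ico]; omega)]
              exact (hB k x).trans le_add_self
          · rw [Set.indicator_of_notMem h1]
            exact zero_le
      _ = ∑' k : ℕ, (Set.Ici μ).indicator (fun k => A k x) k +
            ∑ k ∈ Finset.Ico (μ - t) μ, B := by
          rw [ENNReal.tsum_add, tsum_eq_sum (s := Finset.Ico (μ - t) μ)
            (f := fun k => if k ∈ Finset.Ico (μ - t) μ then B else 0)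
            (fun k hk => if_neg hk)]
          congr 1
          exact Finset.sum_congr rfl fun k hk => if_pos hk
      _ ≤ _ := by
          rw [Finset.sum_const, Nat.card_Ico, nsmul_eq_mul]
          gcongr
          omega
  calc ∫⁻ x in dyadicCube μ n, ∑' l : Set.Ici μ, (if t ≤ (l : ℕ) then A (l - t) x else 0)
      ≤ ∫⁻ x in dyadicCube μ n, (∑' k : Set.Ici μ, A k x + t * B) := lintegral_mono hpt
    _ = (∫⁻ x in dyadicCube μ n, ∑' k : Set.Ici μ, A k x) + t * B * volume (dyadicCube μ n) := by
        rw [lintegral_add_left (Measurable.tsum fun k : Set.Ici μ => hA k), setLIntegral_const]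
    _ ≤ volume (dyadicCube μ n) * B + t * B * volume (dyadicCube μ n) := by
        gcongr
        exact (carleson_le_iff.1 le_rfl μ hμ n).trans (by gcongr)
    _ = _ := by ring

/-- Summation over scales of off-diagonal estimates. -/
theorem exists_carleson_rpow_le {ε q L : ℝ} (hε : 0 < ε) (hq : 0 < q) (hL : 2 * (d : ℝ) < L) :
    ∃ C : ℝ≥0∞, C ≠ ⊤ ∧ ∀ (A : ℕ → E d → ℝ≥0∞), (∀ k, Measurable (A k)) → ∀ B : ℝ≥0∞,
      (∀ k x, A k x ≤ B) → carleson A ≤ B → ∀ (p : ℕ → E d → ℝ≥0∞) (C₀ : ℝ≥0∞), C₀ ≠ ⊤ →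
      (∀ l x, 1 ≤ l → p l x ≤ C₀ *
        (∑' t : ℕ, 2 ^ (-(ε * t)) * (if t ≤ l then A (l - t) x else 0) ^ (1 / q) +
          ∑' t : ℕ, 2 ^ (-(ε * t)) * decayConv L l (A (l + t)) x ^ (1 / q))) →
      carleson (fun l x => p l x ^ q) ≤ C₀ ^ q * (C * B) := by
  obtain ⟨C₁, δ, hC₁, hδ, h₁⟩ := exists_geometric_tsum_rpow_le hε hq
  obtain ⟨C₂, hC₂, h₂⟩ := exists_carleson_decayConv_le hL
  set Γ := ∑' t : ℕ, (2 : ℝ≥0∞) ^ (-(δ * t)) * (1 + t) with hΓ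
  have hΓt : Γ ≠ ⊤ := (tsum_geometric_lt_top hδ).ne
  have h2q : (2 : ℝ≥0∞) ^ q ≠ ⊤ := two_rpow_ne_top q
  refine ⟨2 ^ q * C₁ * (Γ + C₂ * Γ), by finiteness, ?_⟩
  intro A hA B hB hcar p C₀ hC₀ hp
  -- `X` carries the scales coarser by `t`, shifted back; `Y` carries the scales finer by `t`,
  -- shifted forward and averaged at scale `2^{-l}`.
  set X : ℕ → ℕ → E d → ℝ≥0∞ := fun t l x => if t ≤ l then A (l - t) x else 0 with hX
  set Y : ℕ → ℕ → E d → ℝ≥0∞ := fun t l => decayConv L l (A (l + t)) with hY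
  have hXm : ∀ t l, Measurable (X t l) := by
    intro t l
    simp only [hX]
    split_ifs
    · exact hA _
    · exact measurable_const
  have hYm : ∀ t l, Measurable (Y t l) := fun t l => measurable_decayConv L l (hA _)
  have hC₀q : C₀ ^ q ≠ ⊤ := ENNReal.rpow_ne_top_of_nonneg hq.le hC₀
  have hpt : ∀ l x, 1 ≤ l → p l x ^ q ≤ (C₀ ^ q * (2 ^ q * C₁)) *
      (∑' t : ℕ, 2 ^ (-(δ * t)) * X t l x + ∑' t : ℕ, 2 ^ (-(δ * t)) * Y t l x) := by
    intro l x hl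
    calc p l x ^ q ≤ (C₀ * (∑' t : ℕ, 2 ^ (-(ε * t)) * X t l x ^ (1 / q) +
          ∑' t : ℕ, 2 ^ (-(ε * t)) * Y t l x ^ (1 / q))) ^ q := by
          gcongr
          exact hp l x hl
      _ ≤ C₀ ^ q * (2 ^ q * ((∑' t : ℕ, 2 ^ (-(ε * t)) * X t l x ^ (1 / q)) ^ q +
          (∑' t : ℕ, 2 ^ (-(ε * t)) * Y t l x ^ (1 / q)) ^ q)) := by
          rw [ENNReal.mul_rpow_of_nonneg _ _ hq.le]
          gcongr
          exact add_rpow_le_two_rpow _ _ hq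
      _ ≤ C₀ ^ q * (2 ^ q * (C₁ * (∑' t : ℕ, 2 ^ (-(δ * t)) * X t l x) +
          C₁ * (∑' t : ℕ, 2 ^ (-(δ * t)) * Y t l x))) := by
          gcongr
          · exact h₁ fun t => X t l x
          · exact h₁ fun t => Y t l x
      _ = _ := by ring
  have hcX : ∀ t : ℕ, carleson (fun l x => (2 : ℝ≥0∞) ^ (-(δ * t)) * X t l x) ≤
      2 ^ (-(δ * t)) * (1 + t) * B := by
    intro t
    refine (carleson_const_mul_le (X t) (two_rpow_ne_top _)).trans ?_
    rw [mul_assoc]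
    gcongr
    exact carleson_backward_shift_le A hA hB hcar t
  -- The forward shift loses nothing. The factor `1 + t` is inserted only so that both sums share
  -- the constant `Γ`.
  have hcY : ∀ t : ℕ, carleson (fun l x => (2 : ℝ≥0∞) ^ (-(δ * t)) * Y t l x) ≤
      2 ^ (-(δ * t)) * (1 + t) * (C₂ * B) := by
    intro t
    refine (carleson_const_mul_le (Y t) (two_rpow_ne_top _)).trans ?_
    rw [mul_assoc]
    gcongr
    calc carleson (Y t) ≤ C₂ * carleson (fun l => A (l + t)) := h₂ _ fun k => hA _
      _ ≤ C₂ * B := by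
          gcongr
          exact (carleson_shift_le A t).trans hcar
      _ ≤ _ := le_mul_of_one_le_left' le_self_add
  calc carleson (fun l x => p l x ^ q)
      ≤ carleson (fun l x => (C₀ ^ q * (2 ^ q * C₁)) *
        (∑' t : ℕ, 2 ^ (-(δ * t)) * X t l x + ∑' t : ℕ, 2 ^ (-(δ * t)) * Y t l x)) :=
        carleson_mono fun l x hl => hpt l x hl
    _ ≤ (C₀ ^ q * (2 ^ q * C₁)) * carleson (fun l x =>
        ∑' t : ℕ, 2 ^ (-(δ * t)) * X t l x + ∑' t : ℕ, 2 ^ (-(δ * t)) * Y t l x) :=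
        carleson_const_mul_le _ (by finiteness)
    _ ≤ (C₀ ^ q * (2 ^ q * C₁)) * (∑' t : ℕ, 2 ^ (-(δ * t)) * (1 + t) * B +
        ∑' t : ℕ, 2 ^ (-(δ * t)) * (1 + t) * (C₂ * B)) := by
        gcongr
        refine (carleson_add_le fun l => Measurable.tsum fun t => (hXm t l).const_mul _).trans ?_
        refine add_le_add ?_ ?_
        · refine (carleson_tsum_le (fun t l x => (2 : ℝ≥0∞) ^ (-(δ * (t : ℕ))) * X t l x)
            fun t l => (hXm t l).const_mul _).trans ?_
          exact ENNReal.tsum_le_tsum hcX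
        · refine (carleson_tsum_le (fun t l x => (2 : ℝ≥0∞) ^ (-(δ * (t : ℕ))) * Y t l x)
            fun t l => (hYm t l).const_mul _).trans ?_
          exact ENNReal.tsum_le_tsum hcY
    _ = _ := by
        rw [ENNReal.tsum_mul_right, ENNReal.tsum_mul_right]
        ring

/-! ### Symbols -/

/-- The symbol bounds differentiate in `ξ` a derivative already taken in `x`. Joint smoothness of
the latter lets a continuous linear map be pulled out of these derivatives. -/
theorem contDiff_iteratedFDeriv_left {a : E d → E d → ℂ}
    (ha : ContDiff ℝ ∞ fun p : E d × E d => a p.1 p.2) (k : ℕ) :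
    ContDiff ℝ ∞ fun p : E d × E d => iteratedFDeriv ℝ k (fun y => a y p.2) p.1 := by
  induction k with
  | zero =>
    simp_rw [iteratedFDeriv_zero_eq_comp]
    exact (continuousMultilinearCurryFin0 ℝ (E d) ℂ).symm.contDiff.comp ha
  | succ k ih =>
    simp_rw [iteratedFDeriv_succ_eq_comp_left]
    have h1 : ContDiff ℝ ∞ fun p : E d × E d =>
        fderiv ℝ (fun x => iteratedFDeriv ℝ k (fun y => a y p.2) x) p.1 :=
      ContDiff.fderiv (f := fun (p : E d × E d) (x : E d) =>
        iteratedFDeriv ℝ k (fun y => a y p.2) x) (g := fun p => p.1)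
        (m := ∞) (n := ∞) (ih.comp (contDiff_snd.prodMk (contDiff_snd.comp contDiff_fst)))
        contDiff_fst le_rfl
    let T : (E d →L[ℝ] (E d [×k]→L[ℝ] ℂ)) →L[ℝ] (E d [×(k + 1)]→L[ℝ] ℂ) :=
      ((continuousMultilinearCurryLeftEquiv ℝ
        (fun _ : Fin (k + 1) => E d) ℂ).symm.toContinuousLinearEquiv.toContinuousLinearMap)
    exact T.contDiff.comp h1

theorem IsSymbol.contDiff_right {m : ℝ} {a : E d → E d → ℂ} (ha : IsSymbol m 1 1 a) (x : E d) :
    ContDiff ℝ ∞ (a x) :=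
  ha.smooth.comp (contDiff_const.prodMk contDiff_id)

theorem IsSymbol.contDiff_left {m : ℝ} {a : E d → E d → ℂ} (ha : IsSymbol m 1 1 a) (ξ : E d) :
    ContDiff ℝ ∞ fun x => a x ξ :=
  ha.smooth.comp (contDiff_id.prodMk contDiff_const)

theorem IsSymbol.continuous {m : ℝ} {a : E d → E d → ℂ} (ha : IsSymbol m 1 1 a) :
    Continuous fun p : E d × E d => a p.1 p.2 := ha.smooth.continuous

/-- The derivative of a symbol in the direction `v` of the space variable. -/
def spaceDeriv (a : E d → E d → ℂ) (v x ξ : E d) : ℂ := fderiv ℝ (fun y => a y ξ) x v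

theorem IsSymbol.hasFDerivAt_left {m : ℝ} {a : E d → E d → ℂ} (ha : IsSymbol m 1 1 a) (x ξ : E d) :
    HasFDerivAt (fun y => a y ξ) (fderiv ℝ (fun y => a y ξ) x) x :=
  ((ha.contDiff_left ξ).differentiable (by simp) x).hasFDerivAt

/-- Since `δ = 1`, a space derivative costs exactly one order: its bounds are those of `a` with `k +
1` in place of `k`, followed by the linear map that inserts `v` in the last slot. -/
theorem isSymbol_spaceDeriv {m : ℝ} {a : E d → E d → ℂ} (ha : IsSymbol m 1 1 a) (v : E d) :
    IsSymbol (m + 1) 1 1 (spaceDeriv a v) := by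
  constructor
  · have := ContDiff.fderiv (f := fun (p : E d × E d) (x : E d) => a x p.2) (g := fun p => p.1)
      (m := ∞) (n := ∞) (ha.smooth.comp (contDiff_snd.prodMk (contDiff_snd.comp contDiff_fst)))
      contDiff_fst le_rfl
    exact this.clm_apply contDiff_const
  · intro n k
    obtain ⟨C, hC⟩ := ha.bound n (k + 1)
    let T : (E d [×(k + 1)]→L[ℝ] ℂ) →L[ℝ] (E d [×k]→L[ℝ] ℂ) :=
      (ContinuousLinearMap.compContinuousMultilinearMapL ℝ (fun _ : Fin k => E d) (E d →L[ℝ] ℂ) ℂ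
        (ContinuousLinearMap.apply ℝ ℂ v)) ∘L
        (continuousMultilinearCurryRightEquiv' ℝ k (E d) ℂ).toContinuousLinearEquiv.toContinuousLinearMap
    refine ⟨‖T‖ * C, fun x ξ => ?_⟩
    have hT : (fun η => iteratedFDeriv ℝ k (fun y => spaceDeriv a v y η) x) =
        T ∘ fun η => iteratedFDeriv ℝ (k + 1) (fun y => a y η) x := by
      funext η
      have h1 : ContDiff ℝ ∞ (fderiv ℝ fun y => a y η) :=
        (ha.contDiff_left η).fderiv_right le_rfl
      have h2 := ContinuousLinearMap.iteratedFDeriv_comp_left (ContinuousLinearMap.apply ℝ ℂ v)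
        (h1.contDiffAt (x := x)) (i := k) (mod_cast le_top)
      have h3 : iteratedFDeriv ℝ k (fderiv ℝ fun y => a y η) x =
          continuousMultilinearCurryRightEquiv' ℝ k (E d) ℂ
            (iteratedFDeriv ℝ (k + 1) (fun y => a y η) x) := by
        rw [iteratedFDeriv_succ_eq_comp_right]
        simp
      change iteratedFDeriv ℝ k ((ContinuousLinearMap.apply ℝ ℂ v) ∘ fderiv ℝ fun y => a y η) x = _
      rw [h2, h3]
      rfl
    have hsm : ContDiff ℝ ∞ fun η => iteratedFDeriv ℝ (k + 1) (fun y => a y η) x :=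
      (contDiff_iteratedFDeriv_left ha.smooth (k + 1)).comp (contDiff_const.prodMk contDiff_id)
    rw [hT]
    refine (ContinuousLinearMap.norm_iteratedFDeriv_comp_left T (hsm.contDiffAt (x := ξ)) (n := n)
      (mod_cast le_top)).trans ?_
    rw [mul_assoc]
    gcongr
    refine (hC x ξ).trans_eq ?_
    congr 2
    push_cast
    ring

/-- The bounds for the frequency derivatives of a symbol. -/
theorem IsSymbol.exists_bound_right {m : ℝ} {a : E d → E d → ℂ} (ha : IsSymbol m 1 1 a) (n : ℕ) :
    ∃ C : ℝ, 0 ≤ C ∧ ∀ x ξ, ‖iteratedFDeriv ℝ n (a x) ξ‖ ≤ C * (1 + ‖ξ‖) ^ (m - n) := by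
  obtain ⟨C, hC⟩ := ha.bound n 0
  refine ⟨max C 0, le_max_right _ _, fun x ξ => ?_⟩
  have h1 : (fun η => iteratedFDeriv ℝ 0 (fun y => a y η) x) =
      (continuousMultilinearCurryFin0 ℝ (E d) ℂ).symm ∘ a x := by
    funext η
    rw [iteratedFDeriv_zero_eq_comp]
    rfl
  have h2 := hC x ξ
  rw [h1, LinearIsometryEquiv.norm_iteratedFDeriv_comp_left] at h2
  simp only [one_mul, CharP.cast_eq_zero, add_zero] at h2
  refine h2.trans ?_
  gcongr
  exact le_max_left _ _

/-! ### Frequency cutoffs -/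

/-- A frequency cutoff `lo` near the origin together with a frequency cutoff `hi` on an annulus. -/
structure Cutoff (d : ℕ) where
  lo : E d → ℂ
  hi : E d → ℂ
  contDiff_lo : ContDiff ℝ ∞ lo
  contDiff_hi : ContDiff ℝ ∞ hi
  lo_eq_zero : ∀ ξ, 4 < ‖ξ‖ → lo ξ = 0
  hi_eq_zero : ∀ ξ, ‖ξ‖ < 1 / 4 ∨ 4 < ‖ξ‖ → hi ξ = 0

namespace Cutoff

/-- The cutoff at frequency `2^k`. -/
def scaled (η : Cutoff d) (k : ℕ) (ξ : E d) : ℂ :=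
  if k = 0 then η.lo ξ else η.hi (((2 : ℝ) ^ k)⁻¹ • ξ)

theorem contDiff_scaled (η : Cutoff d) (k : ℕ) : ContDiff ℝ ∞ (η.scaled k) := by
  unfold scaled
  split_ifs
  · exact η.contDiff_lo
  · exact η.contDiff_hi.comp (contDiff_const_smul _)

/-- The frequency shell in which the cutoff at frequency `2^k` is supported. -/
def shell (k : ℕ) : Set (E d) := {ξ | (2 : ℝ) ^ k / 4 ≤ 1 + ‖ξ‖ ∧ ‖ξ‖ ≤ 4 * 2 ^ k}

theorem isClosed_shell (k : ℕ) : IsClosed (shell (d := d) k) := by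
  have h1 : IsClosed {ξ : E d | (2 : ℝ) ^ k / 4 ≤ 1 + ‖ξ‖} :=
    isClosed_le continuous_const (by fun_prop)
  have h2 : IsClosed {ξ : E d | ‖ξ‖ ≤ 4 * 2 ^ k} := isClosed_le (by fun_prop) continuous_const
  exact h1.inter h2

theorem support_scaled_subset (η : Cutoff d) (k : ℕ) : Function.support (η.scaled k) ⊆ shell k := by
  intro ξ hξ
  by_contra hn
  apply hξ
  unfold scaled
  simp only [shell, Set.mem_ofPred_eq, not_and_or, not_le] at hn
  have h2 : (0 : ℝ) < 2 ^ k := by positivity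
  split_ifs with hk
  · subst hk
    apply η.lo_eq_zero
    rcases hn with hn | hn
    · have := norm_nonneg ξ
      norm_num at hn
      linarith
    · simpa using hn
  · apply η.hi_eq_zero
    rw [norm_smul, norm_inv, norm_pow, Real.norm_ofNat, inv_mul_lt_iff₀ h2, lt_inv_mul_iff₀ h2]
    rcases hn with hn | hn
    · left; linarith
    · right; linarith

theorem tsupport_scaled_subset (η : Cutoff d) (k : ℕ) : tsupport (η.scaled k) ⊆ shell k :=
  closure_minimal (η.support_scaled_subset k) (isClosed_shell k)

theorem iteratedFDeriv_scaled_eq_zero (η : Cutoff d) (k n : ℕ) {ξ : E d} (hξ : ξ ∉ shell k) :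
    iteratedFDeriv ℝ n (η.scaled k) ξ = 0 := by
  by_contra h
  exact hξ (η.tsupport_scaled_subset k (support_iteratedFDeriv_subset n h))

theorem exists_bound_of_vanish {g : E d → ℂ} (hg : ContDiff ℝ ∞ g) (h0 : ∀ ξ, 4 < ‖ξ‖ → g ξ = 0)
    (n : ℕ) : ∃ C : ℝ, 0 ≤ C ∧ ∀ ξ, ‖iteratedFDeriv ℝ n g ξ‖ ≤ C := by
  have hc : HasCompactSupport g := HasCompactSupport.intro (isCompact_closedBall (0 : E d) 4)
    fun ξ hξ => h0 ξ (by simpa using hξ)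
  obtain ⟨C, hC⟩ := (hc.iteratedFDeriv n).exists_bound_of_continuous
    (hg.continuous_iteratedFDeriv (mod_cast le_top))
  exact ⟨C, (norm_nonneg _).trans (hC 0), hC⟩

/-- Uniform in `k`, because for `k ≥ 1` the cutoffs are dilates of one function; each derivative
brings a factor `2^{-k}`. -/
theorem exists_bound_scaled (η : Cutoff d) (n : ℕ) :
    ∃ C : ℝ, 0 ≤ C ∧ ∀ k ξ, ‖iteratedFDeriv ℝ n (η.scaled k) ξ‖ ≤ C * (((2 : ℝ) ^ k)⁻¹) ^ n := by
  obtain ⟨C₀, hC₀, h₀⟩ := exists_bound_of_vanish η.contDiff_lo η.lo_eq_zero n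
  obtain ⟨C₁, hC₁, h₁⟩ := exists_bound_of_vanish η.contDiff_hi (fun ξ h => η.hi_eq_zero ξ (.inr h)) n
  refine ⟨max C₀ C₁, hC₀.trans (le_max_left _ _), fun k ξ => ?_⟩
  by_cases hk : k = 0
  · subst hk
    have : η.scaled 0 = η.lo := by funext ξ; simp [scaled]
    rw [this]
    simpa using (Or.inl (h₀ ξ) : _ ∨ ‖iteratedFDeriv ℝ n η.lo ξ‖ ≤ C₁)
  · have : η.scaled k = fun ξ => η.hi (((2 : ℝ) ^ k)⁻¹ • ξ) := by funext ξ; simp [scaled, hk]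
    rw [this, iteratedFDeriv_comp_const_smul (i := n) _ (η.contDiff_hi.of_le (mod_cast le_top)),
      norm_smul, norm_pow, norm_inv, norm_pow, Real.norm_ofNat, mul_comm]
    gcongr
    exact (h₁ _).trans (le_max_right _ _)

/-- Multiplication of a cutoff by `2πi⟨v,·⟩`. -/
def mulInner (η : Cutoff d) (v : E d) : Cutoff d where
  lo ξ := 2 * Real.pi * Complex.I * (inner ℝ v ξ : ℝ) * η.lo ξ
  hi ξ := 2 * Real.pi * Complex.I * (inner ℝ v ξ : ℝ) * η.hi ξ
  contDiff_lo := by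
    have := η.contDiff_lo
    have h : ContDiff ℝ ∞ fun ξ : E d => ((inner ℝ v ξ : ℝ) : ℂ) :=
      Complex.ofRealCLM.contDiff.comp (contDiff_const.inner ℝ contDiff_id)
    fun_prop
  contDiff_hi := by
    have := η.contDiff_hi
    have h : ContDiff ℝ ∞ fun ξ : E d => ((inner ℝ v ξ : ℝ) : ℂ) :=
      Complex.ofRealCLM.contDiff.comp (contDiff_const.inner ℝ contDiff_id)
    fun_prop
  lo_eq_zero ξ h := by rw [η.lo_eq_zero ξ h, mul_zero]
  hi_eq_zero ξ h := by rw [η.hi_eq_zero ξ h, mul_zero]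

/-- The factor produced by differentiating the exponential amounts to `2^k` times a cutoff of the
same kind, so the kernel estimates apply to it again. -/
theorem scaled_mulInner (η : Cutoff d) (v : E d) (k : ℕ) (ξ : E d) :
    (2 : ℂ) ^ k * (η.mulInner v).scaled k ξ =
      2 * Real.pi * Complex.I * (inner ℝ v ξ : ℝ) * η.scaled k ξ := by
  unfold scaled mulInner
  split_ifs with hk
  · simp [hk]
  · simp only [inner_smul_right]
    push_cast
    field_simp

end Cutoff

/-- The bounds for a symbol localized at frequency `2^k`. -/
theorem IsSymbol.exists_bound_mul_scaled {m : ℝ} {a : E d → E d → ℂ} (ha : IsSymbol m 1 1 a)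
    (η : Cutoff d) (n : ℕ) :
    ∃ C : ℝ, 0 ≤ C ∧ ∀ k x ξ, ‖iteratedFDeriv ℝ n (fun ξ => a x ξ * η.scaled k ξ) ξ‖ ≤
      C * ((2 : ℝ) ^ (m * k) * (((2 : ℝ) ^ k)⁻¹) ^ n) := by
  choose A hA0 hA using ha.exists_bound_right
  choose B hB0 hB using η.exists_bound_scaled
  refine ⟨∑ i ∈ Finset.range (n + 1), (n.choose i : ℝ) * (A i * 5 ^ |m - i|) * B (n - i),
    Finset.sum_nonneg fun i _ => mul_nonneg (mul_nonneg (by positivity)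
      (mul_nonneg (hA0 i) (by positivity))) (hB0 _), fun k x ξ => ?_⟩
  refine (norm_iteratedFDeriv_mul_le (ha.contDiff_right x) (η.contDiff_scaled k) ξ
    (mod_cast le_top)).trans ?_
  rw [Finset.sum_mul]
  refine Finset.sum_le_sum fun i hi => ?_
  have hin : i ≤ n := by simpa [Nat.lt_succ_iff] using hi
  by_cases hξ : ξ ∈ Cutoff.shell k
  · obtain ⟨h1, h2⟩ := hξ
    have h2k : (1 : ℝ) ≤ 2 ^ k := one_le_pow₀ one_le_two
    have h2k0 : (0 : ℝ) < 2 ^ k := by positivity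
    -- On the shell the ratio of `1 + ‖ξ‖` to `2^k` lies between `1/4` and `5`; taking the exponent
    -- in absolute value covers both signs of `m - i`.
    have hpow : (1 + ‖ξ‖) ^ (m - i) ≤ 5 ^ |m - i| * ((2 : ℝ) ^ k) ^ (m - i) := by
      set r := (1 + ‖ξ‖) / 2 ^ k with hr
      have hr1 : 1 + ‖ξ‖ = r * 2 ^ k := by rw [hr]; field_simp
      have hr2 : 1 / 4 ≤ r := by rw [hr, le_div_iff₀ h2k0]; linarith
      have hr3 : r ≤ 5 := by rw [hr, div_le_iff₀ h2k0]; linarith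
      have hr0 : 0 < r := by linarith
      rw [hr1, Real.mul_rpow hr0.le h2k0.le]
      gcongr
      rcases le_total 0 (m - i) with hm | hm
      · rw [abs_of_nonneg hm]
        exact Real.rpow_le_rpow hr0.le hr3 hm
      · have h4 : r⁻¹ ≤ 5 := by
          rw [inv_le_comm₀ hr0 (by norm_num)]
          linarith
        rw [abs_of_nonpos hm, ← inv_inv (r ^ (m - (i : ℝ))), ← Real.rpow_neg hr0.le,
          ← Real.inv_rpow hr0.le]
        exact Real.rpow_le_rpow (by positivity) h4 (by linarith)
    have hsplit : ((2 : ℝ) ^ k) ^ (m - i) = 2 ^ (m * k) * (((2 : ℝ) ^ k)⁻¹) ^ i := by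
      rw [Real.rpow_sub h2k0, Real.rpow_natCast, ← Real.rpow_natCast 2 k, ← Real.rpow_mul (by norm_num),
        mul_comm (k : ℝ) m, inv_pow, div_eq_mul_inv]
    have hn : (((2 : ℝ) ^ k)⁻¹) ^ n = (((2 : ℝ) ^ k)⁻¹) ^ i * (((2 : ℝ) ^ k)⁻¹) ^ (n - i) := by
      rw [← pow_add, Nat.add_sub_cancel' hin]
    have h5 := (hA i x ξ).trans (mul_le_mul_of_nonneg_left hpow (hA0 i))
    rw [hsplit] at h5
    calc (n.choose i : ℝ) * ‖iteratedFDeriv ℝ i (a x) ξ‖ *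
          ‖iteratedFDeriv ℝ (n - i) (η.scaled k) ξ‖
        ≤ (n.choose i : ℝ) * (A i * (5 ^ |m - i| * (2 ^ (m * k) * (((2 : ℝ) ^ k)⁻¹) ^ i))) *
          (B (n - i) * (((2 : ℝ) ^ k)⁻¹) ^ (n - i)) := by
          have h6 : 0 ≤ A i * (5 ^ |m - i| * (2 ^ (m * k) * (((2 : ℝ) ^ k)⁻¹) ^ i)) :=
            mul_nonneg (hA0 i) (by positivity)
          gcongr
          exact hB _ _ _
      _ = _ := by rw [hn]; ring
  · rw [η.iteratedFDeriv_scaled_eq_zero k (n - i) hξ, norm_zero, mul_zero]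
    exact mul_nonneg (mul_nonneg (mul_nonneg (by positivity)
      (mul_nonneg (hA0 i) (by positivity))) (hB0 _)) (by positivity)

/-- Evaluate the Fourier transform of the `n`-th derivative, a multilinear form, at `(w, …, w)`. Its
modulus is `(2π‖w‖²)^n |𝓕 f(w)|`, while the operator norm returns `‖w‖^n`; cancel this power and
drop `(2π)^n ≥ 1`. -/
theorem pow_norm_mul_norm_fourier_le {f : E d → ℂ} (hf : ContDiff ℝ ∞ f)
    (hint : ∀ n : ℕ, Integrable (iteratedFDeriv ℝ n f)) (n : ℕ) (w : E d) :
    ‖w‖ ^ n * ‖𝓕 f w‖ ≤ ∫ v, ‖iteratedFDeriv ℝ n f v‖ := by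
  have h1 := congrFun (Real.fourier_iteratedFDeriv (N := ⊤) (n := n) hf (fun n _ => hint n) le_top) w
  have h2 : ‖𝓕 (iteratedFDeriv ℝ n f) w‖ ≤ ∫ v, ‖iteratedFDeriv ℝ n f v‖ := by
    rw [Real.fourier_eq]
    refine (norm_integral_le_integral_norm _).trans_eq ?_
    simp_rw [Circle.norm_smul]
  rcases (norm_nonneg w).eq_or_lt with hw | hw
  · rcases Nat.eq_zero_or_pos n with rfl | hn
    · refine le_trans ?_ h2
      have := ContinuousMultilinearMap.le_opNorm (𝓕 (iteratedFDeriv ℝ 0 f) w) (fun _ => w)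
      rw [h1] at this ⊢
      simpa using this
    · rw [← hw, zero_pow hn.ne', zero_mul]
      positivity
  have h3 := ContinuousMultilinearMap.le_opNorm (𝓕 (iteratedFDeriv ℝ n f) w) (fun _ => w)
  rw [h1, VectorFourier.fourierPowSMulRight_apply, ← h1] at h3
  have hin : ‖(innerSL ℝ) w w‖ = ‖w‖ ^ 2 := by
    rw [innerSL_apply_apply, real_inner_self_eq_norm_sq, norm_pow, norm_norm]
  simp only [norm_smul, norm_pow, norm_neg, norm_mul, Complex.norm_I, Finset.prod_const,
    Finset.card_univ, Fintype.card_fin, mul_one, neg_apply, hin, Complex.norm_real,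
    Complex.norm_ofNat] at h3
  have hpi : (1 : ℝ) ≤ (2 * ‖Real.pi‖) ^ n := by
    apply one_le_pow₀
    rw [Real.norm_of_nonneg Real.pi_pos.le]
    linarith [Real.pi_gt_three]
  have h4 : ‖w‖ ^ n * (‖w‖ ^ n * ‖𝓕 f w‖) ≤ ‖w‖ ^ n * ‖𝓕 (iteratedFDeriv ℝ n f) w‖ := by
    calc ‖w‖ ^ n * (‖w‖ ^ n * ‖𝓕 f w‖) = 1 * ((‖w‖ ^ 2) ^ n * ‖𝓕 f w‖) := by ring
      _ ≤ (2 * ‖Real.pi‖) ^ n * ((‖w‖ ^ 2) ^ n * ‖𝓕 f w‖) := by gcongr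
      _ ≤ ‖𝓕 (iteratedFDeriv ℝ n f) w‖ * ‖w‖ ^ n := h3
      _ = _ := mul_comm _ _
  exact (le_of_mul_le_mul_left h4 (by positivity)).trans h2

/-! ### Kernels -/

/-- The kernel of the symbol `a` localized at frequency `2^k` by a cutoff. -/
def kernel (η : Cutoff d) (a : E d → E d → ℂ) (k : ℕ) (x ζ : E d) : ℂ :=
  𝓕⁻ (fun ξ => a x ξ * η.scaled k ξ) ζ

theorem kernel_eq_integral (η : Cutoff d) (a : E d → E d → ℂ) (k : ℕ) (x ζ : E d) :
    kernel η a k x ζ = ∫ ξ, Real.fourierChar (inner ℝ ξ ζ) • (a x ξ * η.scaled k ξ) := by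
  rw [kernel, Real.fourierInv_eq]

theorem Cutoff.scaled_eq_zero (η : Cutoff d) (k : ℕ) {ξ : E d}
    (hξ : ξ ∉ Metric.closedBall (0 : E d) (4 * 2 ^ k)) : η.scaled k ξ = 0 := by
  by_contra h
  exact hξ (by simpa using (η.support_scaled_subset k h).2)

theorem Cutoff.hasCompactSupport_mul_scaled (η : Cutoff d) (k : ℕ) (g : E d → ℂ) :
    HasCompactSupport fun ξ => g ξ * η.scaled k ξ :=
  HasCompactSupport.intro (isCompact_closedBall (0 : E d) (4 * 2 ^ k)) fun ξ hξ => by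
    rw [η.scaled_eq_zero k hξ, mul_zero]

theorem IsSymbol.contDiff_mul_scaled {m : ℝ} {a : E d → E d → ℂ} (ha : IsSymbol m 1 1 a)
    (η : Cutoff d) (k : ℕ) (x : E d) : ContDiff ℝ ∞ fun ξ => a x ξ * η.scaled k ξ :=
  (ha.contDiff_right x).mul (η.contDiff_scaled k)

/-- The localized symbol lives in the ball of radius `4 · 2^k`, whose volume supplies the factor
`(2^k)^d`. -/
theorem IsSymbol.exists_integral_norm_iteratedFDeriv_le {m : ℝ} {a : E d → E d → ℂ}
    (ha : IsSymbol m 1 1 a) (η : Cutoff d) (n : ℕ) :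
    ∃ C : ℝ, 0 ≤ C ∧ ∀ k x, ∫ ξ, ‖iteratedFDeriv ℝ n (fun ξ => a x ξ * η.scaled k ξ) ξ‖ ≤
      C * ((2 : ℝ) ^ (m * k) * (((2 : ℝ) ^ k)⁻¹) ^ n * (2 ^ k) ^ d) := by
  obtain ⟨C, hC0, hC⟩ := ha.exists_bound_mul_scaled η n
  refine ⟨C * (4 ^ d * volume.real (Metric.ball (0 : E d) 1)), by positivity, fun k x => ?_⟩
  have hsupp : ∀ ξ ∉ Metric.closedBall (0 : E d) (4 * 2 ^ k),
      ‖iteratedFDeriv ℝ n (fun ξ => a x ξ * η.scaled k ξ) ξ‖ = 0 := by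
    intro ξ hξ
    by_contra h
    have h1 := support_iteratedFDeriv_subset (𝕜 := ℝ) n (norm_ne_zero_iff.1 h)
    refine hξ (closure_minimal ?_ Metric.isClosed_closedBall h1)
    intro ξ' h'
    by_contra h2
    exact h' (by simp only; rw [η.scaled_eq_zero k h2, mul_zero])
  rw [← setIntegral_eq_integral_of_forall_compl_eq_zero hsupp]
  have h1 := norm_setIntegral_le_of_norm_le_const (μ := volume)
    (s := Metric.closedBall (0 : E d) (4 * 2 ^ k))
    (f := fun ξ => ‖iteratedFDeriv ℝ n (fun ξ => a x ξ * η.scaled k ξ) ξ‖)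
    (C := C * ((2 : ℝ) ^ (m * k) * (((2 : ℝ) ^ k)⁻¹) ^ n)) measure_closedBall_lt_top
    (fun ξ _ => by rw [norm_norm]; exact hC k x ξ)
  refine (Real.le_norm_self _).trans (h1.trans_eq ?_)
  rw [Measure.addHaar_real_closedBall _ _ (by positivity), finrank_euclideanSpace_fin, mul_pow]
  ring

/-- Each power of `‖ζ‖` is paid for by a `ξ`-derivative of the localized symbol, which gains
`2^{-k}`. The powers `0` and `n` together control `(1 + 2^k‖ζ‖)^n`. -/
theorem IsSymbol.exists_norm_kernel_le {m : ℝ} {a : E d → E d → ℂ} (ha : IsSymbol m 1 1 a)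
    (η : Cutoff d) (n : ℕ) :
    ∃ C : ℝ, 0 ≤ C ∧ ∀ k x ζ, (1 + 2 ^ k * ‖ζ‖) ^ n * ‖kernel η a k x ζ‖ ≤
      C * ((2 : ℝ) ^ (m * k) * (2 ^ k) ^ d) := by
  choose B hB0 hB using ha.exists_integral_norm_iteratedFDeriv_le η
  refine ⟨2 ^ n * (B 0 + B n), by have := hB0 0; have := hB0 n; positivity, fun k x ζ => ?_⟩
  have key : ∀ i, (2 ^ k * ‖ζ‖) ^ i * ‖kernel η a k x ζ‖ ≤ B i * (2 ^ (m * k) * (2 ^ k) ^ d) := by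
    intro i
    have h1 := pow_norm_mul_norm_fourier_le (ha.contDiff_mul_scaled η k x) (fun n =>
      ((ha.contDiff_mul_scaled η k x).continuous_iteratedFDeriv
        (mod_cast le_top)).integrable_of_hasCompactSupport
        ((η.hasCompactSupport_mul_scaled k (a x)).iteratedFDeriv n)) i (-ζ)
    rw [norm_neg, ← Real.fourierInv_eq_fourier_neg] at h1
    have h2 : ((2 : ℝ) ^ k) ^ i * (((2 : ℝ) ^ k)⁻¹) ^ i = 1 := by
      rw [← mul_pow, mul_inv_cancel₀ (by positivity), one_pow]
    calc (2 ^ k * ‖ζ‖) ^ i * ‖kernel η a k x ζ‖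
        = (2 ^ k) ^ i * (‖ζ‖ ^ i * ‖kernel η a k x ζ‖) := by ring
      _ ≤ (2 ^ k) ^ i * (B i * ((2 : ℝ) ^ (m * k) * (((2 : ℝ) ^ k)⁻¹) ^ i * (2 ^ k) ^ d)) :=
          mul_le_mul_of_nonneg_left (h1.trans (hB i k x)) (by positivity)
      _ = ((2 : ℝ) ^ k) ^ i * (((2 : ℝ) ^ k)⁻¹) ^ i * (B i * (2 ^ (m * k) * (2 ^ k) ^ d)) := by ring
      _ = _ := by rw [h2, one_mul]
  have hadd : (1 + 2 ^ k * ‖ζ‖) ^ n ≤ 2 ^ n * ((2 ^ k * ‖ζ‖) ^ 0 + (2 ^ k * ‖ζ‖) ^ n) := by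
    refine (add_pow_le zero_le_one (by positivity) n).trans ?_
    rw [one_pow, pow_zero]
    gcongr
    · norm_num
    · omega
  calc (1 + 2 ^ k * ‖ζ‖) ^ n * ‖kernel η a k x ζ‖
      ≤ 2 ^ n * ((2 ^ k * ‖ζ‖) ^ 0 + (2 ^ k * ‖ζ‖) ^ n) * ‖kernel η a k x ζ‖ := by gcongr
    _ = 2 ^ n * ((2 ^ k * ‖ζ‖) ^ 0 * ‖kernel η a k x ζ‖ +
        (2 ^ k * ‖ζ‖) ^ n * ‖kernel η a k x ζ‖) := by ring
    _ ≤ 2 ^ n * (B 0 * (2 ^ (m * k) * (2 ^ k) ^ d) + B n * (2 ^ (m * k) * (2 ^ k) ^ d)) :=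
        mul_le_mul_of_nonneg_left (add_le_add (key 0) (key n)) (by positivity)
    _ = _ := by ring

theorem weight_eq_ofReal (k : ℕ) (y : E d) : weight k y = ENNReal.ofReal (1 + 2 ^ k * ‖y‖) := by
  rw [weight, ENNReal.ofReal_add zero_le_one (by positivity), ENNReal.ofReal_mul (by positivity),
    ENNReal.ofReal_pow (by norm_num), ofReal_norm]
  simp

/-- The kernel of a symbol of order `m` localized at frequency `2^k` decays rapidly at
scale `2^{-k}`. -/
theorem IsSymbol.exists_enorm_kernel_le {m : ℝ} {a : E d → E d → ℂ} (ha : IsSymbol m 1 1 a)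
    (η : Cutoff d) (M : ℝ) :
    ∃ C : ℝ≥0∞, C ≠ ⊤ ∧ ∀ k x ζ, ‖kernel η a k x ζ‖ₑ ≤ C * (2 ^ (m * k) * decay M k ζ) := by
  obtain ⟨C, hC0, hC⟩ := ha.exists_norm_kernel_le η ⌈M⌉₊
  refine ⟨ENNReal.ofReal C, ENNReal.ofReal_ne_top, fun k x ζ => ?_⟩
  have h1 := ENNReal.ofReal_le_ofReal (hC k x ζ)
  rw [ENNReal.ofReal_mul (by positivity), ENNReal.ofReal_mul hC0, ENNReal.ofReal_mul (by positivity),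
    ENNReal.ofReal_pow (by positivity), ← weight_eq_ofReal, ofReal_norm,
    ← ENNReal.ofReal_rpow_of_pos (by norm_num), ← pow_mul, ENNReal.ofReal_pow (by norm_num),
    ENNReal.ofReal_ofNat, mul_comm, ← ENNReal.rpow_natCast (weight k ζ)] at h1
  have h2 : weight k ζ ^ (-(⌈M⌉₊ : ℝ)) ≤ weight k ζ ^ (-M) :=
    ENNReal.rpow_le_rpow_of_exponent_le (one_le_weight k ζ) (neg_le_neg (Nat.le_ceil M))
  calc ‖kernel η a k x ζ‖ₑ
      ≤ ENNReal.ofReal C * (2 ^ (m * k) * 2 ^ (k * d)) * weight k ζ ^ (-(⌈M⌉₊ : ℝ)) := by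
        rw [ENNReal.rpow_neg, ← div_eq_mul_inv, ENNReal.le_div_iff_mul_le
          (.inl (weight_rpow_ne_zero k ζ _)) (.inl (weight_rpow_ne_top k ζ _))]
        exact h1
    _ ≤ ENNReal.ofReal C * (2 ^ (m * k) * 2 ^ (k * d)) * weight k ζ ^ (-M) := by gcongr
    _ = _ := by rw [decay]; ring

/-- Provides an integrable majorant for limits and derivatives under the integral at a fixed `k`, so
the dependence of `C` on `k` is harmless. -/
theorem IsSymbol.exists_bound_localized {m : ℝ} {a : E d → E d → ℂ} (ha : IsSymbol m 1 1 a)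
    (η : Cutoff d) (k : ℕ) : ∃ C : ℝ, 0 ≤ C ∧ ∀ x ξ, ‖a x ξ * η.scaled k ξ‖ ≤
      (Metric.closedBall (0 : E d) (4 * 2 ^ k)).indicator (fun _ => C) ξ := by
  obtain ⟨C, hC0, hC⟩ := ha.exists_bound_mul_scaled η 0
  refine ⟨C * ((2 : ℝ) ^ (m * k) * (((2 : ℝ) ^ k)⁻¹) ^ 0), by positivity, fun x ξ => ?_⟩
  by_cases hξ : ξ ∈ Metric.closedBall (0 : E d) (4 * 2 ^ k)
  · rw [Set.indicator_of_mem hξ]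
    simpa using hC k x ξ
  · rw [Set.indicator_of_notMem hξ, η.scaled_eq_zero k hξ, mul_zero, norm_zero]

theorem integrable_indicator_closedBall (r C : ℝ) :
    Integrable ((Metric.closedBall (0 : E d) r).indicator fun _ => C) :=
  (integrable_indicator_iff Metric.isClosed_closedBall.measurableSet).2
    (integrableOn_const measure_closedBall_lt_top.ne)

theorem continuous_fourierChar_coe : Continuous fun x : ℝ => (Real.fourierChar x : ℂ) :=
  Real.differentiable_fourierChar.continuous

theorem IsSymbol.continuous_kernel {m : ℝ} {a : E d → E d → ℂ} (ha : IsSymbol m 1 1 a)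
    (η : Cutoff d) (k : ℕ) : Continuous fun p : E d × E d => kernel η a k p.1 p.2 := by
  obtain ⟨C, hC0, hC⟩ := ha.exists_bound_localized η k
  simp_rw [kernel_eq_integral]
  have hc := ha.continuous
  have hη := (η.contDiff_scaled k).continuous
  refine continuous_of_dominated (bound := (Metric.closedBall (0 : E d) (4 * 2 ^ k)).indicator
    fun _ => C) (fun p => ?_) (fun p => .of_forall fun ξ => ?_)
    (integrable_indicator_closedBall _ _) (.of_forall fun ξ => ?_)
  · refine Continuous.aestronglyMeasurable ?_
    simp_rw [Circle.smul_def]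
    exact (continuous_fourierChar_coe.comp (by fun_prop)).smul
      ((hc.comp (continuous_const.prodMk continuous_id)).mul hη)
  · rw [Circle.norm_smul]
    exact hC _ _
  · simp_rw [Circle.smul_def]
    exact (continuous_fourierChar_coe.comp (by fun_prop)).smul
      ((hc.comp (continuous_fst.prodMk continuous_const)).mul continuous_const)

/-- The derivative of a kernel along the diagonal. -/
theorem IsSymbol.hasDerivAt_kernel {m : ℝ} {a : E d → E d → ℂ} (ha : IsSymbol m 1 1 a)
    (η : Cutoff d) (k : ℕ) (v x ζ : E d) (t : ℝ) :
    HasDerivAt (fun t : ℝ => kernel η a k (x + t • v) (ζ + t • v))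
      (kernel η (spaceDeriv a v) k (x + t • v) (ζ + t • v) +
        2 ^ k * kernel (η.mulInner v) a k (x + t • v) (ζ + t • v)) t := by
  obtain ⟨C₀, hC₀, h₀⟩ := ha.exists_bound_localized η k
  obtain ⟨C₁, hC₁, h₁⟩ := (isSymbol_spaceDeriv ha v).exists_bound_localized η k
  obtain ⟨C₂, hC₂, h₂⟩ := ha.exists_bound_localized (η.mulInner v) k
  have hc := ha.continuous
  have hc' := (isSymbol_spaceDeriv ha v).continuous
  have hη := (η.contDiff_scaled k).continuous
  have hη' := ((η.mulInner v).contDiff_scaled k).continuous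
  set B := Metric.closedBall (0 : E d) (4 * 2 ^ k)
  set g : ℝ → E d → ℂ := fun t ξ =>
    Real.fourierChar (inner ℝ ξ (ζ + t • v)) • (a (x + t • v) ξ * η.scaled k ξ)
  set g₁ : ℝ → E d → ℂ := fun t ξ =>
    Real.fourierChar (inner ℝ ξ (ζ + t • v)) • (spaceDeriv a v (x + t • v) ξ * η.scaled k ξ)
  set g₂ : ℝ → E d → ℂ := fun t ξ =>
    Real.fourierChar (inner ℝ ξ (ζ + t • v)) • (a (x + t • v) ξ * (η.mulInner v).scaled k ξ)
  have hg : ∀ t, Continuous (g t) := fun t => by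
    simp only [g, Circle.smul_def]
    exact (continuous_fourierChar_coe.comp (by fun_prop)).smul
      ((hc.comp (continuous_const.prodMk continuous_id)).mul hη)
  have hg₁ : ∀ t, Continuous (g₁ t) := fun t => by
    simp only [g₁, Circle.smul_def]
    exact (continuous_fourierChar_coe.comp (by fun_prop)).smul
      ((hc'.comp (continuous_const.prodMk continuous_id)).mul hη)
  have hg₂ : ∀ t, Continuous (g₂ t) := fun t => by
    simp only [g₂, Circle.smul_def]
    exact (continuous_fourierChar_coe.comp (by fun_prop)).smul
      ((hc.comp (continuous_const.prodMk continuous_id)).mul hη')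
  have hgb : ∀ t ξ, ‖g t ξ‖ ≤ B.indicator (fun _ => C₀) ξ := fun t ξ => by
    simp only [g, Circle.norm_smul]; exact h₀ _ _
  have hgb₁ : ∀ t ξ, ‖g₁ t ξ‖ ≤ B.indicator (fun _ => C₁) ξ := fun t ξ => by
    simp only [g₁, Circle.norm_smul]; exact h₁ _ _
  have hgb₂ : ∀ t ξ, ‖g₂ t ξ‖ ≤ B.indicator (fun _ => C₂) ξ := fun t ξ => by
    simp only [g₂, Circle.norm_smul]; exact h₂ _ _
  have hi₁ : ∀ t, Integrable (g₁ t) := fun t => (integrable_indicator_closedBall _ _).mono'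
    (hg₁ t).aestronglyMeasurable (.of_forall (hgb₁ t))
  have hi₂ : ∀ t, Integrable (g₂ t) := fun t => (integrable_indicator_closedBall _ _).mono'
    (hg₂ t).aestronglyMeasurable (.of_forall (hgb₂ t))
  -- Along the diagonal the derivative falls either on the space variable of the symbol or on the
  -- character. The latter brings down `2πi⟨v, ξ⟩`, which is absorbed into the cutoff at the price
  -- `2^k`.
  have hder : ∀ ξ t, HasDerivAt (fun t => g t ξ) (g₁ t ξ + 2 ^ k * g₂ t ξ) t := by
    intro ξ t
    have e1 : HasDerivAt (fun t : ℝ => inner ℝ ξ (ζ + t • v)) (inner ℝ ξ v) t := by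
      simp_rw [inner_add_right, inner_smul_right]
      simpa using ((hasDerivAt_id t).mul_const (inner ℝ ξ v)).const_add (inner ℝ ξ ζ)
    have e2 := (Real.hasDerivAt_fourierChar (inner ℝ ξ (ζ + t • v))).scomp t e1
    have e3 : HasDerivAt (fun t : ℝ => a (x + t • v) ξ) (spaceDeriv a v (x + t • v) ξ) t := by
      have := (ha.hasFDerivAt_left (x + t • v) ξ).comp_hasDerivAt t
        (((hasDerivAt_id t).smul_const v).const_add x)
      refine this.congr_deriv ?_
      simp [spaceDeriv]
    have e4 := e2.mul (e3.mul_const (η.scaled k ξ))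
    have hs := η.scaled_mulInner v k ξ
    simp only [g, g₁, g₂, Circle.smul_def, smul_eq_mul]
    refine e4.congr_deriv ?_
    simp only [Function.comp_apply, Complex.real_smul]
    rw [real_inner_comm] at hs
    linear_combination -(Real.fourierChar (inner ℝ ξ (ζ + t • v)) : ℂ) * a (x + t • v) ξ * hs
  have hmain := hasDerivAt_integral_of_dominated_loc_of_deriv_le (μ := volume) (F := g)
    (F' := fun t ξ => g₁ t ξ + 2 ^ k * g₂ t ξ) (x₀ := t) (s := Set.univ)
    (bound := fun ξ => B.indicator (fun _ => C₁) ξ + 2 ^ k * B.indicator (fun _ => C₂) ξ)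
    univ_mem (.of_forall fun t => (hg t).aestronglyMeasurable)
    ((integrable_indicator_closedBall _ _).mono' (hg t).aestronglyMeasurable (.of_forall (hgb t)))
    ((hg₁ t).add (continuous_const.mul (hg₂ t))).aestronglyMeasurable
    (.of_forall fun ξ t _ => by
      refine (norm_add_le _ _).trans ?_
      rw [norm_mul, norm_pow, Complex.norm_ofNat]
      gcongr
      · exact hgb₁ t ξ
      · exact hgb₂ t ξ)
    ((integrable_indicator_closedBall _ _).add ((integrable_indicator_closedBall _ _).const_mul _))
    (.of_forall fun ξ t _ => hder ξ t)
  simp_rw [kernel_eq_integral]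
  refine hmain.2.congr_deriv ?_
  rw [integral_add (hi₁ t) ((hi₂ t).const_mul _), integral_const_mul]

/-! ### Off-diagonal decay -/

/-- Dilations of a Schwartz function decay rapidly at the corresponding scale. -/
theorem exists_enorm_dilate_le (φ : 𝓢(E d, ℂ)) (L : ℝ) :
    ∃ C : ℝ≥0∞, C ≠ ⊤ ∧ ∀ (l : ℕ) z, ‖dilate φ l z‖ₑ ≤ C * decay L l z := by
  have h := fun x => SchwartzMap.one_add_le_sup_seminorm_apply (𝕜 := ℝ) (m := (⌈L⌉₊, 0)) le_rfl
    le_rfl φ x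
  set C := 2 ^ (⌈L⌉₊, 0).1 *
    (Finset.Iic (⌈L⌉₊, 0)).sup (fun m => SchwartzMap.seminorm ℝ m.1 m.2) φ
  have h0 : ∀ x, ‖φ x‖ₑ ≤ ENNReal.ofReal C * weight 0 x ^ (-L) := by
    intro x
    have h1 := ENNReal.ofReal_le_ofReal (h x)
    rw [norm_iteratedFDeriv_zero, ENNReal.ofReal_mul (by positivity),
      ENNReal.ofReal_pow (by positivity), ofReal_norm, mul_comm,
      show 1 + ‖x‖ = 1 + 2 ^ 0 * ‖x‖ by simp, ← weight_eq_ofReal, ← ENNReal.rpow_natCast] at h1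
    calc ‖φ x‖ₑ ≤ ENNReal.ofReal C * weight 0 x ^ (-(⌈L⌉₊ : ℝ)) := by
          rw [ENNReal.rpow_neg, ← div_eq_mul_inv, ENNReal.le_div_iff_mul_le
            (.inl (weight_rpow_ne_zero _ _ _)) (.inl (weight_rpow_ne_top _ _ _))]
          exact h1
      _ ≤ ENNReal.ofReal C * weight 0 x ^ (-L) := by
          gcongr
          · exact one_le_weight 0 x
          · exact Nat.le_ceil L
  refine ⟨ENNReal.ofReal C, ENNReal.ofReal_ne_top, fun l z => ?_⟩
  rw [dilate_apply, zpow_natCast, enorm_smul, decay, ← weight_two_pow_smul, mul_left_comm]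
  have : ‖((2 : ℝ) ^ l) ^ d‖ₑ = 2 ^ (l * d) := by
    rw [← pow_mul, enorm_pow]
    simp [enorm_eq_nnnorm]
  rw [this]
  gcongr
  exact h0 _

theorem exists_lintegral_dilate_mul_weight_le (φ : 𝓢(E d, ℂ)) (M : ℝ) :
    ∃ C : ℝ≥0∞, C ≠ ⊤ ∧ ∀ l : ℕ, ∫⁻ z, ‖dilate φ l z‖ₑ * weight l z ^ M ≤ C := by
  obtain ⟨C, hC, h⟩ := exists_enorm_dilate_le φ (M + d + 1)
  refine ⟨C * ∫⁻ z : E d, weight 0 z ^ (-((d : ℝ) + 1)),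
    ENNReal.mul_ne_top hC (lintegral_weight_lt_top (lt_add_one _)).ne, fun l => ?_⟩
  rw [← lintegral_decay _ l 0, ← lintegral_const_mul' _ _ hC]
  refine lintegral_mono fun z => ?_
  calc ‖dilate φ l z‖ₑ * weight l z ^ M ≤ C * decay (M + d + 1) l z * weight l z ^ M := by
        gcongr; exact h l z
    _ = C * decay (d + 1) l (0 - z) := by
        rw [zero_sub, decay, decay, weight_neg, mul_assoc, mul_assoc,
          ← ENNReal.rpow_add _ _ (weight_ne_zero _ _) (weight_ne_top _ _)]
        congr 4
        ring

/-- A Schwartz function whose Fourier transform is supported in `{1/2 ≤ |ξ| ≤ 2}`. -/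
def IsAnnular (φ : 𝓢(E d, ℂ)) : Prop := ∀ ξ, ‖ξ‖ < 1 / 2 ∨ 2 < ‖ξ‖ → 𝓕 φ ξ = 0

theorem IsLittlewoodPaley.isAnnular {φ : 𝓢(E d, ℂ)} (h : IsLittlewoodPaley φ) : IsAnnular φ := by
  intro ξ hξ
  by_contra hne
  obtain ⟨h1, h2⟩ := h.support_subset hne
  rcases hξ with h' | h' <;> linarith

/-- Schwartz functions with annular frequency support are divergences of such functions. -/
theorem IsAnnular.exists_eq_sum_lineDeriv {φ : 𝓢(E d, ℂ)} (hφ : IsAnnular φ) :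
    ∃ θ : Fin d → 𝓢(E d, ℂ), (∀ i, IsAnnular (θ i)) ∧
      φ = ∑ i, ∂_{EuclideanSpace.single i (1 : ℝ)} (θ i) := by
  -- `θ_i` is given the Fourier transform `ξ_i 𝓕φ(ξ) / (2πi|ξ|²)`. The singularity at the origin
  -- does not matter, since `𝓕φ` vanishes for `|ξ| < 1/2`.
  let g : Fin d → E d → ℂ := fun i ξ =>
    (2 * Real.pi * Complex.I)⁻¹ * ((ξ i * (‖ξ‖ ^ 2)⁻¹ : ℝ) * 𝓕 φ ξ)
  have hg0 : ∀ i ξ, 𝓕 φ ξ = 0 → g i ξ = 0 := fun i ξ h => by simp only [g, h, mul_zero]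
  have hsm : ∀ i, ContDiff ℝ ∞ (g i) := by
    intro i
    rw [contDiff_iff_contDiffAt]
    intro ξ
    by_cases hξ : ξ = 0
    · refine (contDiffAt_const (c := (0 : ℂ))).congr_of_eventuallyEq ?_
      rw [hξ]
      filter_upwards [Metric.ball_mem_nhds (0 : E d) (by norm_num : (0 : ℝ) < 1 / 2)] with ξ' h'
      exact hg0 i ξ' (hφ ξ' (.inl (by simpa using h')))
    · have h1 : ContDiffAt ℝ ∞ (fun ξ : E d => ξ i * (‖ξ‖ ^ 2)⁻¹) ξ := by
        refine ContDiffAt.mul ?_ (ContDiffAt.inv (contDiff_norm_sq ℝ).contDiffAt (by simpa using hξ))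
        exact (EuclideanSpace.proj (𝕜 := ℝ) i).contDiff.contDiffAt
      exact contDiffAt_const.mul ((Complex.ofRealCLM.contDiff.contDiffAt.comp ξ h1).mul
        ((𝓕 φ).smooth ⊤).contDiffAt)
  have hcs : ∀ i, HasCompactSupport (g i) := fun i =>
    HasCompactSupport.intro (isCompact_closedBall (0 : E d) 2) fun ξ hξ =>
      hg0 i ξ (hφ ξ (.inr (by simpa using hξ)))
  refine ⟨fun i => 𝓕⁻ ((hcs i).toSchwartzMap (hsm i)), fun i ξ hξ => ?_, ?_⟩
  · rw [FourierTransform.fourier_fourierInv_eq]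
    exact hg0 i ξ (hφ ξ hξ)
  · refine (FourierTransform.fourierEquiv (E := 𝓢(E d, ℂ)) (F := 𝓢(E d, ℂ)) ℂ).injective ?_
    rw [map_sum]
    simp only [FourierTransform.fourierEquiv_apply]
    ext ξ
    simp only [SchwartzMap.fourier_lineDerivOp_eq, FourierTransform.fourier_fourierInv_eq]
    rw [sum_apply]
    have htg : ∀ i : Fin d, (fun ξ : E d => inner ℝ ξ (EuclideanSpace.single i (1 : ℝ))).HasTemperateGrowth :=
      fun i => by fun_prop
    have hts : ∀ i ξ, ((hcs i).toSchwartzMap (hsm i)) ξ = g i ξ := fun _ _ => rfl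
    simp only [smul_apply, SchwartzMap.smulLeftCLM_apply_apply (htg _), hts, g]
    by_cases hξ : ξ = 0
    · subst hξ
      rw [hφ 0 (.inl (by norm_num))]
      simp
    · have hn : (‖ξ‖ : ℂ) ^ 2 ≠ 0 := by simpa using hξ
      have hsum : ((‖ξ‖ : ℂ)) ^ 2 = ∑ i, (ξ i : ℂ) ^ 2 := by
        have := EuclideanSpace.real_norm_sq_eq ξ
        exact_mod_cast this
      have : ∀ i : Fin d, (2 * ↑Real.pi * Complex.I) • (inner ℝ ξ (EuclideanSpace.single i (1 : ℝ)) •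
          ((2 * ↑Real.pi * Complex.I)⁻¹ * (((ξ i * (‖ξ‖ ^ 2)⁻¹ : ℝ) : ℂ) * 𝓕 φ ξ))) =
          (ξ i : ℂ) ^ 2 * (((‖ξ‖ : ℂ) ^ 2)⁻¹ * 𝓕 φ ξ) := by
        intro i
        have hpi : (2 * ↑Real.pi * Complex.I) ≠ 0 := Complex.two_pi_I_ne_zero
        have hin : inner ℝ ξ (EuclideanSpace.single i (1 : ℝ)) = ξ i := by
          simp [EuclideanSpace.inner_single_right]
        rw [hin]
        simp only [Complex.real_smul, smul_eq_mul]
        push_cast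
        generalize 2 * ↑Real.pi * Complex.I = c at hpi
        field_simp
      rw [Finset.sum_congr rfl fun i _ => this i, ← Finset.sum_mul, ← hsum,
        ← mul_assoc, mul_inv_cancel₀ hn, one_mul]

theorem dilate_sum {ι : Type*} (s : Finset ι) (θ : ι → 𝓢(E d, ℂ)) (l : ℤ) :
    dilate (∑ i ∈ s, θ i) l = ∑ i ∈ s, dilate (θ i) l := by
  unfold dilate
  rw [map_sum, Finset.smul_sum]

/-- The derivative of a dilation. -/
theorem hasLineDerivAt_dilate (θ : 𝓢(E d, ℂ)) (l : ℕ) (v y : E d) :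
    HasLineDerivAt ℝ (dilate θ l) (2 ^ l * dilate (∂_{v} θ) l y) y v := by
  have h2 : HasFDerivAt (dilate θ l) ((((2 : ℝ) ^ (l : ℤ)) ^ d) •
      (fderiv ℝ θ ((2 : ℝ) ^ (l : ℤ) • y) ∘L ((2 : ℝ) ^ (l : ℤ) • ContinuousLinearMap.id ℝ (E d)))) y := by
    have h3 : HasFDerivAt (fun y : E d => (2 : ℝ) ^ (l : ℤ) • y)
      ((2 : ℝ) ^ (l : ℤ) • ContinuousLinearMap.id ℝ (E d)) y :=
      (hasFDerivAt_id (𝕜 := ℝ) y).const_smul ((2 : ℝ) ^ (l : ℤ))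
    exact ((θ.differentiableAt (x := (2 : ℝ) ^ (l : ℤ) • y)).hasFDerivAt.comp y h3).const_smul _
  have h1 := h2.hasLineDerivAt v
  refine HasDerivAt.congr_deriv h1 ?_
  rw [dilate_apply, SchwartzMap.lineDerivOp_apply_eq_fderiv]
  simp
  ring

/-- The convolution of a dilated Schwartz function with a kernel along the diagonal. -/
def offDiag (φ : 𝓢(E d, ℂ)) (η : Cutoff d) (a : E d → E d → ℂ) (k l : ℕ) (x ζ : E d) : ℂ :=
  ∫ y, dilate φ l y * kernel η a k (x - y) (ζ - y)

theorem IsSymbol.exists_norm_kernel_le_const {m : ℝ} {a : E d → E d → ℂ} (ha : IsSymbol m 1 1 a)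
    (η : Cutoff d) (k : ℕ) : ∃ C : ℝ, ∀ x ζ, ‖kernel η a k x ζ‖ ≤ C := by
  obtain ⟨C, hC0, hC⟩ := ha.exists_norm_kernel_le η 0
  exact ⟨_, fun x ζ => by simpa using hC k x ζ⟩

theorem IsSymbol.continuous_kernel_sub {m : ℝ} {a : E d → E d → ℂ} (ha : IsSymbol m 1 1 a)
    (η : Cutoff d) (k : ℕ) (x ζ : E d) : Continuous fun y => kernel η a k (x - y) (ζ - y) := by
  have h : Continuous fun y : E d => (x - y, ζ - y) := by fun_prop
  exact Continuous.comp' (g := fun p : E d × E d => kernel η a k p.1 p.2)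
    (f := fun y : E d => (x - y, ζ - y)) (ha.continuous_kernel η k) h

theorem IsSymbol.integrable_mul_kernel {m : ℝ} {a : E d → E d → ℂ} (ha : IsSymbol m 1 1 a)
    (η : Cutoff d) (k : ℕ) (φ : 𝓢(E d, ℂ)) (x ζ : E d) :
    Integrable fun y => φ y * kernel η a k (x - y) (ζ - y) := by
  obtain ⟨C, hC⟩ := ha.exists_norm_kernel_le_const η k
  exact φ.integrable.mul_bdd (ha.continuous_kernel_sub η k x ζ).aestronglyMeasurable
    (.of_forall fun y => hC _ _)

/-- Integration by parts: a derivative of the dilated function is worth `2^l`, and moved to the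
kernel it becomes the diagonal derivative computed in `IsSymbol.hasDerivAt_kernel`. -/
theorem IsSymbol.offDiag_lineDeriv {m : ℝ} {a : E d → E d → ℂ} (ha : IsSymbol m 1 1 a)
    (η : Cutoff d) (θ : 𝓢(E d, ℂ)) (v : E d) (k l : ℕ) (x ζ : E d) :
    2 ^ l * offDiag (∂_{v} θ) η a k l x ζ =
      offDiag θ η (spaceDeriv a v) k l x ζ + 2 ^ k * offDiag θ (η.mulInner v) a k l x ζ := by
  have ha' := isSymbol_spaceDeriv ha v
  have i1 := ha'.integrable_mul_kernel η k (dilate θ l) x ζ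
  have i2 := ha.integrable_mul_kernel (η.mulInner v) k (dilate θ l) x ζ
  have hker : ∀ y, HasLineDerivAt ℝ (fun y => kernel η a k (x - y) (ζ - y))
      (-(kernel η (spaceDeriv a v) k (x - y) (ζ - y) +
        2 ^ k * kernel (η.mulInner v) a k (x - y) (ζ - y))) y v := by
    intro y
    have h1 := ha.hasDerivAt_kernel η k v (x - y) (ζ - y) (-0)
    have h2 := h1.scomp (0 : ℝ) (hasDerivAt_neg (0 : ℝ))
    simp only [neg_zero, zero_smul, add_zero] at h2
    unfold HasLineDerivAt
    convert h2 using 1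
    · funext t
      simp only [Function.comp_apply, neg_smul]
      congr 1 <;> abel
    · simp [add_comm]
  have hparts := integral_bilinear_hasLineDerivAt_right_eq_neg_left_of_integrable (μ := volume)
    (f := dilate θ l) (f' := fun y => 2 ^ l * dilate (∂_{v} θ) l y)
    (g := fun y => kernel η a k (x - y) (ζ - y)) (g' := fun y =>
      -(kernel η (spaceDeriv a v) k (x - y) (ζ - y) +
        2 ^ k * kernel (η.mulInner v) a k (x - y) (ζ - y))) (v := v)
    (B := ContinuousLinearMap.mul ℝ ℂ) ?_ ?_ ?_ (fun y _ => hasLineDerivAt_dilate θ l v y)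
    (fun y _ => hker y)
  · simp only [ContinuousLinearMap.mul_apply'] at hparts
    have e1 : ∀ y, dilate θ l y * -(kernel η (spaceDeriv a v) k (x - y) (ζ - y) +
        2 ^ k * kernel (η.mulInner v) a k (x - y) (ζ - y)) =
        -(dilate θ l y * kernel η (spaceDeriv a v) k (x - y) (ζ - y) +
        2 ^ k * (dilate θ l y * kernel (η.mulInner v) a k (x - y) (ζ - y))) := fun y => by ring
    simp_rw [e1] at hparts
    rw [integral_neg, neg_inj, integral_add i1 (i2.const_mul _), integral_const_mul] at hparts
    unfold offDiag
    rw [hparts, ← integral_const_mul]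
    simp_rw [mul_assoc]
  · simp only [ContinuousLinearMap.mul_apply', mul_assoc]
    exact (ha.integrable_mul_kernel η k (dilate (∂_{v} θ) l) x ζ).const_mul _
  · simp only [ContinuousLinearMap.mul_apply']
    refine ((i1.add (i2.const_mul (2 ^ k))).neg).congr (.of_forall fun y => ?_)
    simp only [Pi.neg_apply, Pi.add_apply]
    ring
  · exact ha.integrable_mul_kernel η k (dilate θ l) x ζ

/-- The convolution of a symbol kernel at frequency `2^k` with a Schwartz function at frequency
`2^l`, `l ≥ k`, is as small as one likes. -/
theorem exists_enorm_offDiag_le {M : ℝ} (hM : 0 ≤ M) (N : ℕ) :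
    ∀ {m : ℝ} {a : E d → E d → ℂ} (_ : IsSymbol m 1 1 a) (η : Cutoff d) {φ : 𝓢(E d, ℂ)}
      (_ : IsAnnular φ), ∃ C : ℝ≥0∞, C ≠ ⊤ ∧ ∀ k l : ℕ, k ≤ l → ∀ x ζ,
        ‖offDiag φ η a k l x ζ‖ₑ ≤ C * (2 ^ (m * k - N * ((l : ℝ) - k)) * decay M k ζ) := by
  -- The order, symbol, cutoff and Schwartz function are quantified inside the induction, because an
  -- integration by parts can change each of them.
  induction N with
  | zero =>
    intro m a ha η φ _
    obtain ⟨C, hC, h⟩ := ha.exists_enorm_kernel_le η M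
    obtain ⟨D, hD, h'⟩ := exists_lintegral_dilate_mul_weight_le φ M
    refine ⟨D * C, ENNReal.mul_ne_top hD hC, fun k l hkl x ζ => ?_⟩
    have hX : C * (2 ^ (m * k) * decay M k ζ) ≠ ⊤ := by
      refine ENNReal.mul_ne_top hC (ENNReal.mul_ne_top (two_rpow_ne_top _) ?_)
      unfold decay
      exact ENNReal.mul_ne_top (by finiteness) (weight_rpow_ne_top _ _ _)
    calc ‖offDiag φ η a k l x ζ‖ₑ
        ≤ ∫⁻ y, ‖dilate φ l y * kernel η a k (x - y) (ζ - y)‖ₑ := enorm_integral_le_lintegral_enorm _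
      _ ≤ ∫⁻ y, (‖dilate φ l y‖ₑ * weight l y ^ M) * (C * (2 ^ (m * k) * decay M k ζ)) := by
          refine lintegral_mono fun y => ?_
          rw [enorm_mul]
          -- Recentring the kernel from `ζ - y` to `ζ` costs the weight of `y` at scale `k`. As `k ≤
          -- l`, this is at most the weight at scale `l`, which is integrable against the dilated
          -- function uniformly in `l`.
          have h1 := decay_le hM k ζ (ζ - y) 0
          simp only [sub_zero, sub_sub_cancel] at h1
          calc ‖dilate φ l y‖ₑ * ‖kernel η a k (x - y) (ζ - y)‖ₑ
              ≤ ‖dilate φ l y‖ₑ * (C * (2 ^ (m * k) * (weight l y ^ M * decay M k ζ))) := by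
                gcongr
                refine (h k _ _).trans ?_
                gcongr
                refine h1.trans ?_
                gcongr
                exact weight_mono hkl y
            _ = _ := by ring
      _ ≤ D * (C * (2 ^ (m * k) * decay M k ζ)) := by
          rw [lintegral_mul_const' _ _ hX]
          gcongr
          exact h' l
      _ = _ := by simp [mul_assoc]
  | succ N ih =>
    intro m a ha η φ hφ
    obtain ⟨θ, hθ, rfl⟩ := hφ.exists_eq_sum_lineDeriv
    choose C hC h using fun i => ih (isSymbol_spaceDeriv ha (EuclideanSpace.single i 1)) η (hθ i)
    choose D hD h' using fun i => ih ha (η.mulInner (EuclideanSpace.single i 1)) (hθ i)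
    refine ⟨∑ i, (C i + D i), by simp [ENNReal.sum_eq_top, hC, hD], fun k l hkl x ζ => ?_⟩
    have hsum : offDiag (∑ i, ∂_{EuclideanSpace.single i (1 : ℝ)} (θ i)) η a k l x ζ =
        ∑ i, offDiag (∂_{EuclideanSpace.single i (1 : ℝ)} (θ i)) η a k l x ζ := by
      unfold offDiag
      rw [← integral_finsetSum _ fun i _ => ha.integrable_mul_kernel η k _ x ζ, dilate_sum]
      simp_rw [sum_apply, Finset.sum_mul]
    rw [hsum, Finset.sum_mul]
    refine (enorm_sum_le _ _).trans (Finset.sum_le_sum fun i _ => ?_)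
    -- Both terms carry an extra `2^k`, one through the order `m + 1` and the other as an explicit
    -- factor. Against the `2^l` on the left this is the gain `2^{k-l}`.
    have h2 : (2 : ℝ≥0∞) ^ (l : ℝ) * ‖offDiag (∂_{EuclideanSpace.single i (1 : ℝ)} (θ i)) η a k l x ζ‖ₑ ≤
        2 ^ (l : ℝ) * ((C i + D i) * (2 ^ (m * k - (N + 1 : ℕ) * ((l : ℝ) - k)) * decay M k ζ)) := by
      have e := congrArg enorm (ha.offDiag_lineDeriv η (θ i) (EuclideanSpace.single i 1) k l x ζ)
      have e2 : ∀ j : ℕ, ‖(2 : ℂ) ^ j‖ₑ = 2 ^ (j : ℝ) := fun j => by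
        rw [enorm_pow, ENNReal.rpow_natCast]; simp [enorm_eq_nnnorm]
      rw [enorm_mul, e2] at e
      rw [e]
      refine (enorm_add_le _ _).trans ?_
      rw [enorm_mul, e2]
      refine (add_le_add (h i k l hkl x ζ) (mul_le_mul_right (h' i k l hkl x ζ) _)).trans_eq ?_
      have p1 : (2 : ℝ≥0∞) ^ ((m + 1) * k - N * ((l : ℝ) - k)) =
          2 ^ (l : ℝ) * 2 ^ (m * k - (N + 1 : ℕ) * ((l : ℝ) - k)) := by
        rw [← two_rpow_add]; congr 1; push_cast; ring
      have p2 : (2 : ℝ≥0∞) ^ (k : ℝ) * 2 ^ (m * k - N * ((l : ℝ) - k)) =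
          2 ^ (l : ℝ) * 2 ^ (m * k - (N + 1 : ℕ) * ((l : ℝ) - k)) := by
        rw [← two_rpow_add, ← two_rpow_add]; congr 1; push_cast; ring
      rw [p1, mul_left_comm ((2 : ℝ≥0∞) ^ (k : ℝ)), ← mul_assoc ((2 : ℝ≥0∞) ^ (k : ℝ)), p2]
      ring
    exact (ENNReal.mul_le_mul_iff_right (two_rpow_ne_zero _) (two_rpow_ne_top _)).1 h2

/-! ### Littlewood-Paley pieces -/

/-- The convolution of two Schwartz functions. -/
def schwartzConv (κ φ : 𝓢(E d, ℂ)) : 𝓢(E d, ℂ) :=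
  SchwartzMap.convolution (ContinuousLinearMap.mul ℂ ℂ) κ φ

theorem schwartzConv_apply (κ φ : 𝓢(E d, ℂ)) (w : E d) :
    schwartzConv κ φ w = ∫ z, κ z * φ (w - z) := by
  rw [schwartzConv, SchwartzMap.convolution_apply]
  rfl

theorem fourier_schwartzConv (κ φ : 𝓢(E d, ℂ)) (ξ : E d) :
    𝓕 (schwartzConv κ φ) ξ = 𝓕 κ ξ * 𝓕 φ ξ := by
  rw [schwartzConv, SchwartzMap.fourier_convolution, SchwartzMap.pairing_apply_apply]
  rfl

theorem schwartz_ext_fourier {f g : 𝓢(E d, ℂ)} (h : ∀ ξ, 𝓕 f ξ = 𝓕 g ξ) : f = g :=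
  (FourierTransform.fourierEquiv (E := 𝓢(E d, ℂ)) (F := 𝓢(E d, ℂ)) ℂ).injective
    (SchwartzMap.ext h)

/-- Reproducing formula: convolution with `κ` does nothing if `κ^ = 1` on the support of `φ^`. -/
theorem conv_eq_integral_of_fourier (f : 𝓢'(E d, ℂ)) {κ φ : 𝓢(E d, ℂ)}
    (h : ∀ ξ, 𝓕 κ ξ * 𝓕 φ ξ = 𝓕 φ ξ) (x : E d) :
    conv φ f x = ∫ z, κ z * conv φ f (x - z) := by
  have h1 : schwartzConv κ φ = φ := schwartz_ext_fourier fun ξ => by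
    rw [fourier_schwartzConv, h]
  have h2 := (conv_eq_integral f κ φ _ (schwartzConv_apply κ φ) x).2
  rwa [h1] at h2

/-- The cutoff used to reproduce Littlewood-Paley pieces. -/
def stdCutoff (d : ℕ) : Cutoff d :=
  let f : ContDiffBump (0 : E d) := ⟨2, 4, by norm_num, by norm_num⟩
  let g : ContDiffBump (0 : E d) := ⟨1 / 4, 1 / 2, by norm_num, by norm_num⟩
  { lo := fun ξ => (f ξ : ℂ)
    hi := fun ξ => (f ξ * (1 - g ξ) : ℝ)
    contDiff_lo := Complex.ofRealCLM.contDiff.comp f.contDiff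
    contDiff_hi := Complex.ofRealCLM.contDiff.comp (f.contDiff.mul (contDiff_const.sub g.contDiff))
    lo_eq_zero := fun ξ hξ => by
      rw [f.zero_of_le_dist (by simpa [f] using hξ.le), Complex.ofReal_zero]
    hi_eq_zero := fun ξ hξ => by
      rcases hξ with hξ | hξ
      · rw [g.one_of_mem_closedBall (by simpa [g] using hξ.le)]
        simp
      · rw [f.zero_of_le_dist (by simpa [f] using hξ.le)]
        simp }

theorem stdCutoff_lo_eq_one {ξ : E d} (h : ‖ξ‖ ≤ 2) : (stdCutoff d).lo ξ = 1 := by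
  simp only [stdCutoff]
  rw [ContDiffBump.one_of_mem_closedBall _ (by simpa using h), Complex.ofReal_one]

theorem stdCutoff_hi_eq_one {ξ : E d} (h : 1 / 2 ≤ ‖ξ‖) (h' : ‖ξ‖ ≤ 2) :
    (stdCutoff d).hi ξ = 1 := by
  simp only [stdCutoff]
  rw [ContDiffBump.one_of_mem_closedBall _ (by simpa using h'),
    ContDiffBump.zero_of_le_dist _ (by simpa using h)]
  simp

theorem IsLittlewoodPaley.lowPassSymbol_eq_zero {φ : 𝓢(E d, ℂ)} (h : IsLittlewoodPaley φ)
    {ξ : E d} (hξ2 : 2 < ‖ξ‖) : lowPassSymbol φ ξ = 0 := by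
  have hne : ξ ≠ 0 := by
    rintro rfl
    norm_num at hξ2
  have hinj : Function.Injective (fun k : ℕ => (k : ℤ) + 1) := fun a b hab => by
    simpa using hab
  have hs : HasSum (fun k : ℕ => 𝓕 (dilate φ ((k : ℤ) + 1)) ξ) 1 := by
    refine (hinj.hasSum_iff (f := fun k : ℤ => 𝓕 (dilate φ k) ξ) ?_).2 (h.hasSum_one ξ hne)
    intro k hk
    apply h.fourier_dilate_eq_zero
    right
    have hk0 : k ≤ 0 := by
      by_contra hlt
      exact hk ⟨(k - 1).toNat, by simp only; omega⟩
    calc (2 : ℝ) ^ (k + 1) ≤ (2 : ℝ) ^ (1 : ℤ) := zpow_le_zpow_right₀ one_le_two (by omega)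
      _ < ‖ξ‖ := by simpa using hξ2
  simp [lowPassSymbol, hs.tsum_eq]

theorem fourier_lowPass {φ : 𝓢(E d, ℂ)} (h : IsLittlewoodPaley φ) (ξ : E d) :
    𝓕 (lowPass φ h) ξ = lowPassSymbol φ ξ := by
  rw [lowPass, FourierTransform.fourier_fourierInv_eq]
  rfl

/-- The cutoff is one on the spectrum of the kernel, so it can be inserted into the symbol or used
as a reproducing kernel at no cost. -/
theorem stdCutoff_scaled_mul_fourier_lpKernel {φ : 𝓢(E d, ℂ)} (h : IsLittlewoodPaley φ) (k : ℕ)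
    (ξ : E d) : (stdCutoff d).scaled k ξ * 𝓕 (lpKernel φ h k) ξ = 𝓕 (lpKernel φ h k) ξ := by
  by_cases h0 : 𝓕 (lpKernel φ h k) ξ = 0
  · rw [h0, mul_zero]
  suffices hs : (stdCutoff d).scaled k ξ = 1 by rw [hs, one_mul]
  unfold Cutoff.scaled
  unfold lpKernel at h0
  split_ifs at h0 ⊢ with hk
  · apply stdCutoff_lo_eq_one
    by_contra hlt
    rw [fourier_lowPass, h.lowPassSymbol_eq_zero (not_le.1 hlt)] at h0
    exact h0 rfl
  · rw [fourier_dilate, zpow_neg, zpow_natCast] at h0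
    obtain ⟨h1, h2⟩ := h.support_subset h0
    exact stdCutoff_hi_eq_one h1 h2

/-- With the constant symbol, the kernel estimates become estimates for the reproducing kernel of
the Littlewood-Paley pieces. -/
theorem isSymbol_one : IsSymbol 0 1 1 fun _ _ : E d => (1 : ℂ) := by
  refine ⟨contDiff_const, fun n k => ⟨1, fun x ξ => ?_⟩⟩
  rcases Nat.eq_zero_or_pos k with rfl | hk
  · rcases Nat.eq_zero_or_pos n with rfl | hn
    · simp
    · rw [iteratedFDeriv_zero_eq_comp]
      change ‖iteratedFDeriv ℝ n (fun _ => (continuousMultilinearCurryFin0 ℝ (E d) ℂ).symm 1) ξ‖ ≤ _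
      rw [iteratedFDeriv_const_of_ne hn.ne', Pi.zero_apply, norm_zero]
      positivity
  · simp only [iteratedFDeriv_const_of_ne hk.ne', Pi.zero_apply]
    have : iteratedFDeriv ℝ n (fun _ : E d => (0 : E d [×k]→L[ℝ] ℂ)) ξ = 0 := by
      rw [iteratedFDeriv_fun_zero]; rfl
    rw [this, norm_zero]
    positivity

/-- The Schwartz function whose Fourier transform is a localized symbol. -/
def kernelSchwartz {m : ℝ} {a : E d → E d → ℂ} (ha : IsSymbol m 1 1 a) (η : Cutoff d) (k : ℕ)
    (x : E d) : 𝓢(E d, ℂ) :=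
  𝓕⁻ ((η.hasCompactSupport_mul_scaled k (a x)).toSchwartzMap (ha.contDiff_mul_scaled η k x))

theorem kernelSchwartz_apply {m : ℝ} {a : E d → E d → ℂ} (ha : IsSymbol m 1 1 a) (η : Cutoff d)
    (k : ℕ) (x ζ : E d) : kernelSchwartz ha η k x ζ = kernel η a k x ζ := by
  rw [kernelSchwartz, SchwartzMap.fourierInv_coe]
  rfl

theorem fourier_kernelSchwartz {m : ℝ} {a : E d → E d → ℂ} (ha : IsSymbol m 1 1 a) (η : Cutoff d)
    (k : ℕ) (x ξ : E d) : 𝓕 (kernelSchwartz ha η k x) ξ = a x ξ * η.scaled k ξ := by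
  rw [kernelSchwartz, FourierTransform.fourier_fourierInv_eq]
  rfl

theorem continuous_lpPiece {φ : 𝓢(E d, ℂ)} (h : IsLittlewoodPaley φ) (k : ℕ) (f : 𝓢'(E d, ℂ)) :
    Continuous (lpPiece φ h k f) := continuous_conv _ _

/-- The reproducing formula combined with the kernel bound for the constant symbol. The constant
depends neither on `k` nor on `f`. -/
theorem exists_enorm_lpPiece_le_decayConv {φ : 𝓢(E d, ℂ)} (h : IsLittlewoodPaley φ) (σ : ℝ) :
    ∃ C : ℝ≥0∞, C ≠ ⊤ ∧ ∀ k (f : 𝓢'(E d, ℂ)) z,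
      ‖lpPiece φ h k f z‖ₑ ≤ C * decayConv σ k (fun y => ‖lpPiece φ h k f y‖ₑ) z := by
  obtain ⟨C, hC, hK⟩ := isSymbol_one.exists_enorm_kernel_le (stdCutoff d) σ
  refine ⟨C, hC, fun k f z => ?_⟩
  have h1 := conv_eq_integral_of_fourier f (κ := kernelSchwartz isSymbol_one (stdCutoff d) k 0)
    (φ := lpKernel φ h k) (fun ξ => by
      rw [fourier_kernelSchwartz, one_mul, stdCutoff_scaled_mul_fourier_lpKernel]) z
  change lpPiece φ h k f z = ∫ y, _ * lpPiece φ h k f (z - y) at h1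
  calc ‖lpPiece φ h k f z‖ₑ
      ≤ ∫⁻ y, ‖kernelSchwartz isSymbol_one (stdCutoff d) k 0 y * lpPiece φ h k f (z - y)‖ₑ := by
        conv_lhs => rw [h1]
        exact enorm_integral_le_lintegral_enorm _
    _ ≤ ∫⁻ y, C * (decay σ k y * ‖lpPiece φ h k f (z - y)‖ₑ) := by
        refine lintegral_mono fun y => ?_
        rw [enorm_mul, ← mul_assoc]
        gcongr
        rw [kernelSchwartz_apply]
        simpa using hK k 0 y
    _ = C * decayConv σ k (fun y => ‖lpPiece φ h k f y‖ₑ) z := by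
        rw [lintegral_const_mul' _ _ hC, decayConv,
          ← lintegral_sub_left_eq_self (fun y => decay σ k (z - y) * ‖lpPiece φ h k f y‖ₑ) z]
        simp_rw [sub_sub_cancel]

/-- Peetre's inequality for Littlewood-Paley pieces. -/
theorem exists_lpPiece_rpow_le {φ : 𝓢(E d, ℂ)} (h : IsLittlewoodPaley φ) {q L : ℝ} (hq : 0 < q)
    (hL : (d : ℝ) < L) : ∃ C : ℝ≥0∞, C ≠ ⊤ ∧ ∀ k (f : 𝓢'(E d, ℂ)) x y,
      ‖lpPiece φ h k f y‖ₑ ^ q ≤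
        C * (weight k (x - y) ^ L * decayConv L k (fun y => ‖lpPiece φ h k f y‖ₑ ^ q) x) := by
  choose K hK hrep using exists_enorm_lpPiece_le_decayConv h
  refine ⟨(1 + K (L / min 1 q)) ^ max 1 q * (1 + ∫⁻ z : E d, weight 0 z ^ (-L)) ^ max 1 q, ?_,
    fun k f x y => ?_⟩
  · have h1 := hK (L / min 1 q)
    have h2 := (lintegral_weight_lt_top hL).ne
    have h3 : 0 ≤ max 1 q := zero_le_one.trans (le_max_left _ _)
    exact ENNReal.mul_ne_top (ENNReal.rpow_ne_top_of_nonneg h3 (by finiteness))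
      (ENNReal.rpow_ne_top_of_nonneg h3 (by finiteness))
  · obtain ⟨B, N, hB, hgrowth⟩ := exists_norm_conv_le (lpKernel φ h k) f
    refine rpow_le_weight_mul_decayConv hq hL (continuous_lpPiece h k f).enorm.measurable hK
      (fun σ _ z => hrep σ k f z) (B := ENNReal.ofReal B) (N := N) ENNReal.ofReal_ne_top
      (Nat.cast_nonneg N) (fun y => ?_) x y
    have h1 := ENNReal.ofReal_le_ofReal (hgrowth y)
    rw [ofReal_norm, ENNReal.ofReal_mul hB, ENNReal.ofReal_pow (by positivity),
      show 1 + ‖y‖ = 1 + 2 ^ 0 * ‖y‖ by simp, ← weight_eq_ofReal, ← ENNReal.rpow_natCast] at h1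
    refine h1.trans ?_
    gcongr
    exact weight_mono (Nat.zero_le k) y

/-- The weighted powers of the Littlewood-Paley pieces. -/
def powPiece (φ : 𝓢(E d, ℂ)) (h : IsLittlewoodPaley φ) (σ q : ℝ) (f : 𝓢'(E d, ℂ)) (k : ℕ)
    (y : E d) : ℝ≥0∞ := 2 ^ (σ * k * q) * ‖lpPiece φ h k f y‖ₑ ^ q

theorem measurable_powPiece {φ : 𝓢(E d, ℂ)} (h : IsLittlewoodPaley φ) (σ q : ℝ) (f : 𝓢'(E d, ℂ))
    (k : ℕ) : Measurable (powPiece φ h σ q f k) :=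
  ((continuous_lpPiece h k f).enorm.measurable.pow_const _).const_mul _

theorem triebelLizorkinNorm_eq (φ : 𝓢(E d, ℂ)) (h : IsLittlewoodPaley φ) (σ q : ℝ)
    (f : 𝓢'(E d, ℂ)) : triebelLizorkinNorm φ h σ q f = eLpNorm (lpPiece φ h 0 f) ⊤ volume +
      ⨆ (μ : ℕ) (_ : 1 ≤ μ) (n : Fin d → ℤ), ((volume (dyadicCube μ n))⁻¹ *
        ∫⁻ x in dyadicCube μ n, ∑' k : Set.Ici μ, powPiece φ h σ q f k x) ^ (1 / q) := by
  unfold triebelLizorkinNorm powPiece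
  simp only [← ENNReal.ofReal_rpow_of_pos (zero_lt_two' ℝ), ENNReal.ofReal_ofNat]

/-- The norm takes the `q`-th root of each average before the supremum, whereas `carleson` takes
none; raising to the power `q` is done cube by cube. -/
theorem carleson_powPiece_le {φ : 𝓢(E d, ℂ)} (h : IsLittlewoodPaley φ) (σ : ℝ) {q : ℝ} (hq : 0 < q)
    (f : 𝓢'(E d, ℂ)) : carleson (powPiece φ h σ q f) ≤ triebelLizorkinNorm φ h σ q f ^ q := by
  refine iSup_le fun μ => iSup_le fun hμ => iSup_le fun n => ?_
  rw [← ENNReal.rpow_inv_le_iff hq, ← one_div q, triebelLizorkinNorm_eq]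
  refine le_trans ?_ le_add_self
  exact le_iSup_of_le μ (le_iSup_of_le hμ (le_iSup_of_le n le_rfl))

theorem triebelLizorkinNorm_le {φ : 𝓢(E d, ℂ)} (h : IsLittlewoodPaley φ) (σ : ℝ) {q : ℝ}
    (hq : 0 < q) (f : 𝓢'(E d, ℂ)) : triebelLizorkinNorm φ h σ q f ≤
      eLpNorm (lpPiece φ h 0 f) ⊤ volume + carleson (powPiece φ h σ q f) ^ (1 / q) := by
  rw [triebelLizorkinNorm_eq]
  gcongr
  refine iSup_le fun μ => iSup_le fun hμ => iSup_le fun n => ?_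
  gcongr
  exact le_iSup_of_le μ (le_iSup_of_le hμ (le_iSup_of_le n le_rfl))

theorem exists_powPiece_le {φ : 𝓢(E d, ℂ)} (h : IsLittlewoodPaley φ) {q L : ℝ} (hq : 0 < q)
    (hL : (d : ℝ) < L) : ∃ C : ℝ≥0∞, C ≠ ⊤ ∧ ∀ σ k (f : 𝓢'(E d, ℂ)) x y,
      powPiece φ h σ q f k y ≤
        C * (weight k (x - y) ^ L * decayConv L k (powPiece φ h σ q f k) x) := by
  obtain ⟨C, hC, hle⟩ := exists_lpPiece_rpow_le h hq hL
  refine ⟨C, hC, fun σ k f x y => ?_⟩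
  have : decayConv L k (powPiece φ h σ q f k) x = 2 ^ (σ * k * q) *
      decayConv L k (fun y => ‖lpPiece φ h k f y‖ₑ ^ q) x := by
    unfold decayConv powPiece
    rw [← lintegral_const_mul' _ _ (two_rpow_ne_top _)]
    congr 1 with y
    ring
  rw [this]
  calc powPiece φ h σ q f k y ≤ 2 ^ (σ * k * q) * (C * (weight k (x - y) ^ L *
        decayConv L k (fun y => ‖lpPiece φ h k f y‖ₑ ^ q) x)) := by
        unfold powPiece
        gcongr
        exact hle k f x y
    _ = _ := by ring

/-- The averaged pieces of `f` are bounded, and form a Carleson sequence. -/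
theorem exists_decayConv_powPiece_le {φ : 𝓢(E d, ℂ)} (h : IsLittlewoodPaley φ) {q L : ℝ}
    (hq : 0 < q) (hL : 2 * (d : ℝ) < L) :
    ∃ C : ℝ≥0∞, C ≠ ⊤ ∧ ∀ σ (f : 𝓢'(E d, ℂ)),
      (∀ k x, decayConv L k (powPiece φ h σ q f k) x ≤ C * triebelLizorkinNorm φ h σ q f ^ q) ∧
      carleson (fun k => decayConv L k (powPiece φ h σ q f k)) ≤
        C * triebelLizorkinNorm φ h σ q f ^ q := by
  have hd0 : (0 : ℝ) ≤ d := Nat.cast_nonneg d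
  obtain ⟨C₁, hC₁, h₁⟩ := exists_carleson_decayConv_le hL
  obtain ⟨C₂, hC₂, h₂⟩ := exists_slowlyVarying_le_carleson d (L := L) (by linarith)
  set I := ∫⁻ z : E d, weight 0 z ^ (-L)
  have hI : I ≠ ⊤ := (lintegral_weight_lt_top (by linarith)).ne
  refine ⟨C₁ + C₂ * C₁ + I, by finiteness, fun σ f => ?_⟩
  have hcar : carleson (fun k => decayConv L k (powPiece φ h σ q f k)) ≤
      C₁ * triebelLizorkinNorm φ h σ q f ^ q :=
    (h₁ _ (measurable_powPiece h σ q f)).trans (by gcongr; exact carleson_powPiece_le h σ hq f)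
  refine ⟨fun k x => ?_, hcar.trans (by gcongr; exact le_self_add.trans le_self_add)⟩
  -- The Carleson supremum only sees scales `k ≥ 1`, so `k = 0` is controlled by the `L^∞` part of
  -- the norm; the remaining scales follow from slow variation.
  rcases Nat.eq_zero_or_pos k with rfl | hk
  · have h3 : ∀ᵐ y, powPiece φ h σ q f 0 y ≤ triebelLizorkinNorm φ h σ q f ^ q := by
      filter_upwards [enorm_ae_le_eLpNormEssSup (lpPiece φ h 0 f) volume] with y hy
      unfold powPiece
      simp only [CharP.cast_eq_zero, mul_zero, zero_mul, ENNReal.rpow_zero, one_mul]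
      gcongr
      refine hy.trans ?_
      rw [← eLpNorm_exponent_top]
      exact le_self_add
    calc decayConv L 0 (powPiece φ h σ q f 0) x
        ≤ ∫⁻ y, decay L 0 (x - y) * triebelLizorkinNorm φ h σ q f ^ q := by
          refine lintegral_mono_ae ?_
          filter_upwards [h3] with y hy
          gcongr
      _ = I * triebelLizorkinNorm φ h σ q f ^ q := by
          have hm : Measurable fun y : E d => decay L 0 (x - y) :=
            (measurable_decay L 0).comp (measurable_const.sub measurable_id)
          rw [lintegral_mul_const _ hm, lintegral_decay]
      _ ≤ _ := by gcongr; exact le_add_self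
  · calc decayConv L k (powPiece φ h σ q f k) x
        ≤ C₂ * carleson (fun k => decayConv L k (powPiece φ h σ q f k)) :=
          h₂ (fun k => decayConv L k (powPiece φ h σ q f k))
            (fun k => slowlyVarying_decayConv (by linarith) k _) k hk x
      _ ≤ C₂ * (C₁ * triebelLizorkinNorm φ h σ q f ^ q) := by gcongr
      _ ≤ _ := by
        rw [← mul_assoc]
        gcongr
        exact le_add_self.trans le_self_add

/-! ### Operators with kernels localized at frequency `2^k` -/

theorem integrable_of_enorm_le {X : Type*} [MeasurableSpace X] {μ : Measure X} {F : X → ℂ}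
    {h : X → ℝ≥0∞} (hF : AEStronglyMeasurable F μ) (hle : ∀ x, ‖F x‖ₑ ≤ h x)
    (hh : ∫⁻ x, h x ∂μ ≠ ⊤) : Integrable F μ :=
  ⟨hF, (lintegral_mono hle).trans_lt hh.lt_top⟩

/-- The operator with kernel `K_k(w,·)` applied to `F`, evaluated at `x`. -/
def applyKernel (a : E d → E d → ℂ) (k : ℕ) (F : E d → ℂ) (w x : E d) : ℂ :=
  ∫ ζ, kernel (stdCutoff d) a k w ζ * F (x - ζ)

theorem decay_ne_top (L : ℝ) (k : ℕ) (y : E d) : decay L k y ≠ ⊤ :=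
  ENNReal.mul_ne_top (by finiteness) (weight_rpow_ne_top _ _ _)

theorem enorm_integral_mul_le {κ F : E d → ℂ} {C : ℝ≥0∞} (hC : C ≠ ⊤) {M : ℝ} {k : ℕ}
    (hκ : ∀ ζ, ‖κ ζ‖ₑ ≤ C * decay M k ζ) (x : E d) :
    ∫⁻ ζ, ‖κ ζ * F (x - ζ)‖ₑ ≤ C * ∫⁻ ζ, decay M k ζ * ‖F (x - ζ)‖ₑ := by
  rw [← lintegral_const_mul' _ _ hC]
  refine lintegral_mono fun ζ => ?_
  rw [enorm_mul, ← mul_assoc]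
  gcongr
  exact hκ ζ

section applyKernel

variable {m : ℝ} {a : E d → E d → ℂ} {F : E d → ℂ} {C : ℝ≥0∞} {M : ℝ} {k : ℕ}

theorem enorm_applyKernel_le (hC : C ≠ ⊤)
    (hK : ∀ w ζ, ‖kernel (stdCutoff d) a k w ζ‖ₑ ≤ C * decay M k ζ) (w x : E d) :
    ‖applyKernel a k F w x‖ₑ ≤ C * ∫⁻ ζ, decay M k ζ * ‖F (x - ζ)‖ₑ :=
  (enorm_integral_le_lintegral_enorm _).trans (enorm_integral_mul_le hC (hK w) x)

theorem stronglyMeasurable_applyKernel (ha : IsSymbol m 1 1 a) (hF : Continuous F) :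
    StronglyMeasurable fun p : E d × E d => applyKernel a k F p.1 p.2 := by
  have hc := ha.continuous_kernel (stdCutoff d) k
  have h1 : Continuous fun p : (E d × E d) × E d =>
      kernel (stdCutoff d) a k p.1.1 p.2 * F (p.1.2 - p.2) := by
    refine Continuous.mul ?_ (by fun_prop)
    exact Continuous.comp' (g := fun p : E d × E d => kernel (stdCutoff d) a k p.1 p.2)
      (f := fun p : (E d × E d) × E d => (p.1.1, p.2)) hc (by fun_prop)
  exact h1.stronglyMeasurable.integral_prod_right'

/-- The space variable `w` of the symbol is kept apart from the point `x`, because the sum over `j`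
averages in `w` alone. Continuity in `w` at fixed `x` is what the approximate identity requires. -/
theorem continuous_applyKernel_left (ha : IsSymbol m 1 1 a) (hF : Continuous F) (hC : C ≠ ⊤)
    (hK : ∀ w ζ, ‖kernel (stdCutoff d) a k w ζ‖ₑ ≤ C * decay M k ζ) {x : E d}
    (hx : ∫⁻ ζ, decay M k ζ * ‖F (x - ζ)‖ₑ ≠ ⊤) : Continuous fun w => applyKernel a k F w x := by
  have hc := ha.continuous_kernel (stdCutoff d) k
  refine continuous_of_dominated (bound := fun ζ => (C * (decay M k ζ * ‖F (x - ζ)‖ₑ)).toReal)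
    (fun w => Continuous.aestronglyMeasurable ?_) (fun w => .of_forall fun ζ => ?_) ?_
    (.of_forall fun ζ => ?_)
  · refine Continuous.mul ?_ (by fun_prop)
    exact Continuous.comp' (g := fun p : E d × E d => kernel (stdCutoff d) a k p.1 p.2)
      (f := fun ζ : E d => (w, ζ)) hc (by fun_prop)
  · rw [← toReal_enorm]
    refine ENNReal.toReal_mono
      (ENNReal.mul_ne_top hC (ENNReal.mul_ne_top (decay_ne_top _ _ _) enorm_ne_top)) ?_
    rw [enorm_mul, ← mul_assoc]
    gcongr
    exact hK w ζ
  · refine integrable_toReal_of_lintegral_ne_top ?_ ?_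
    · refine Measurable.aemeasurable (Measurable.const_mul ?_ _)
      exact (measurable_decay M k).mul
        (hF.comp (continuous_const.sub continuous_id)).enorm.measurable
    · rw [lintegral_const_mul' _ _ hC]
      exact ENNReal.mul_ne_top hC hx
  · refine Continuous.mul ?_ continuous_const
    exact Continuous.comp' (g := fun p : E d × E d => kernel (stdCutoff d) a k p.1 p.2)
      (f := fun w : E d => (w, ζ)) hc (by fun_prop)

/-- The kernel obtained by averaging in the space variable. -/
def avgKernel (κ : 𝓢(E d, ℂ)) (a : E d → E d → ℂ) (k : ℕ) (x ζ : E d) : ℂ :=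
  ∫ z, κ z * kernel (stdCutoff d) a k (x - z) ζ

theorem integrable_avgKernel_prod (ha : IsSymbol m 1 1 a) (κ : 𝓢(E d, ℂ)) (hF : Continuous F)
    (hC : C ≠ ⊤) (hK : ∀ w ζ, ‖kernel (stdCutoff d) a k w ζ‖ₑ ≤ C * decay M k ζ) {x : E d}
    (hx : ∫⁻ ζ, decay M k ζ * ‖F (x - ζ)‖ₑ ≠ ⊤) :
    Integrable (fun p : E d × E d => κ p.1 * kernel (stdCutoff d) a k (x - p.1) p.2 * F (x - p.2))
      (volume.prod volume) := by
  have hc := ha.continuous_kernel (stdCutoff d) k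
  have hmeas : Measurable fun ζ : E d => decay M k ζ * ‖F (x - ζ)‖ₑ :=
    (measurable_decay M k).mul (hF.comp (continuous_const.sub continuous_id)).enorm.measurable
  refine integrable_of_enorm_le (h := fun p : E d × E d =>
    ‖κ p.1‖ₑ * (C * (decay M k p.2 * ‖F (x - p.2)‖ₑ))) (Continuous.aestronglyMeasurable ?_)
    (fun p => ?_) ?_
  · have h1 : Continuous fun p : E d × E d => κ p.1 := κ.continuous.comp continuous_fst
    have h2 : Continuous fun p : E d × E d => kernel (stdCutoff d) a k (x - p.1) p.2 :=
      Continuous.comp' (g := fun p : E d × E d => kernel (stdCutoff d) a k p.1 p.2)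
        (f := fun p : E d × E d => (x - p.1, p.2)) hc (by fun_prop)
    exact (h1.mul h2).mul (by fun_prop)
  · rw [enorm_mul, enorm_mul, mul_assoc, ← mul_assoc C]
    gcongr
    exact hK _ _
  · rw [lintegral_prod_mul κ.continuous.enorm.measurable.aemeasurable
      (hmeas.const_mul C).aemeasurable, lintegral_const_mul' _ _ hC]
    exact ENNReal.mul_ne_top κ.integrable.2.ne (ENNReal.mul_ne_top hC hx)

/-- Fubini: averaging the kernel in its space variable is the same as averaging `applyKernel` over
`w` about `w = x`, with the second argument kept at `x`. -/
theorem integral_avgKernel_mul (ha : IsSymbol m 1 1 a) (κ : 𝓢(E d, ℂ)) (hF : Continuous F)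
    (hC : C ≠ ⊤) (hK : ∀ w ζ, ‖kernel (stdCutoff d) a k w ζ‖ₑ ≤ C * decay M k ζ) {x : E d}
    (hx : ∫⁻ ζ, decay M k ζ * ‖F (x - ζ)‖ₑ ≠ ⊤) :
    ∫ ζ, avgKernel κ a k x ζ * F (x - ζ) = ∫ z, κ z * applyKernel a k F (x - z) x := by
  have h := integral_integral_swap
    (f := fun z ζ => κ z * kernel (stdCutoff d) a k (x - z) ζ * F (x - ζ))
    (integrable_avgKernel_prod ha κ hF hC hK hx)
  simp only [avgKernel, applyKernel]
  simp_rw [← integral_mul_const, ← integral_const_mul, ← mul_assoc]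
  exact h.symm

theorem enorm_avgKernel_le (κ : 𝓢(E d, ℂ))
    (hK : ∀ w ζ, ‖kernel (stdCutoff d) a k w ζ‖ₑ ≤ C * decay M k ζ) (x ζ : E d) :
    ‖avgKernel κ a k x ζ‖ₑ ≤ (∫⁻ z, ‖κ z‖ₑ) * C * decay M k ζ := by
  refine (enorm_integral_le_lintegral_enorm _).trans ?_
  rw [mul_assoc, ← lintegral_mul_const _ κ.continuous.enorm.measurable]
  refine lintegral_mono fun z => ?_
  rw [enorm_mul]
  gcongr
  exact hK _ _

theorem continuous_avgKernel (ha : IsSymbol m 1 1 a) (κ : 𝓢(E d, ℂ)) (x : E d) :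
    Continuous (avgKernel κ a k x) := by
  obtain ⟨B, hB⟩ := ha.exists_norm_kernel_le_const (stdCutoff d) k
  have hc := ha.continuous_kernel (stdCutoff d) k
  refine continuous_of_dominated (bound := fun z => ‖κ z‖ * B)
    (fun ζ => Continuous.aestronglyMeasurable ?_) (fun ζ => .of_forall fun z => ?_)
    (κ.integrable.norm.mul_const B) (.of_forall fun z => ?_)
  · refine κ.continuous.mul ?_
    exact Continuous.comp' (g := fun p : E d × E d => kernel (stdCutoff d) a k p.1 p.2)
      (f := fun z : E d => (x - z, ζ)) hc (by fun_prop)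
  · rw [norm_mul]
    gcongr
    exact hB _ _
  · refine continuous_const.mul ?_
    exact Continuous.comp' (g := fun p : E d × E d => kernel (stdCutoff d) a k p.1 p.2)
      (f := fun ζ : E d => (x - z, ζ)) hc (by fun_prop)

/-- The Fourier transform of an averaged kernel is the averaged symbol. -/
theorem fourier_avgKernel (ha : IsSymbol m 1 1 a) (κ : 𝓢(E d, ℂ)) (k : ℕ) (x ξ : E d) :
    𝓕 (avgKernel κ a k x) ξ = (∫ z, κ z * a (x - z) ξ) * (stdCutoff d).scaled k ξ := by
  obtain ⟨C, hC, hK⟩ := ha.exists_enorm_kernel_le (stdCutoff d) (d + 1)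
  have hC' : C * 2 ^ (m * k) ≠ ⊤ := ENNReal.mul_ne_top hC (two_rpow_ne_top _)
  have hK' : ∀ w ζ, ‖kernel (stdCutoff d) a k w ζ‖ₑ ≤ C * 2 ^ (m * k) * decay (d + 1) k ζ :=
    fun w ζ => (hK k w ζ).trans_eq (mul_assoc _ _ _).symm
  -- The Fourier transform is treated as the kernel operator applied to a character and evaluated at
  -- the origin; a character has modulus one, so the decay of the kernel alone justifies Fubini.
  set F : E d → ℂ := fun y => Real.fourierChar (inner ℝ y ξ) with hFdef
  have hF : Continuous F := continuous_fourierChar_coe.comp (by fun_prop)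
  have hF1 : ∀ y, ‖F y‖ₑ = 1 := fun y => by
    rw [← ofReal_norm, Circle.norm_coe, ENNReal.ofReal_one]
  have h0 : ∫⁻ ζ : E d, decay (d + 1) k ζ * ‖F (0 - ζ)‖ₑ ≠ ⊤ := by
    simp only [hF1, mul_one]
    have := lintegral_decay (d := d) (d + 1) k 0
    simp only [decay, zero_sub, weight_neg] at this ⊢
    rw [this]
    exact (lintegral_weight_lt_top (lt_add_one _)).ne
  have hint : Integrable (Function.uncurry fun z ζ =>
      κ z * kernel (stdCutoff d) a k (x - z) ζ * F (0 - ζ)) (volume.prod volume) := by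
    have h1 : Continuous fun p : E d × E d => κ p.1 := κ.continuous.comp continuous_fst
    have h2 : Continuous fun p : E d × E d => kernel (stdCutoff d) a k (x - p.1) p.2 :=
      Continuous.comp' (g := fun p : E d × E d => kernel (stdCutoff d) a k p.1 p.2)
        (f := fun p : E d × E d => (x - p.1, p.2)) (ha.continuous_kernel (stdCutoff d) k)
        (by fun_prop)
    have hm1 : Measurable (decay (d := d) (d + 1) k) := measurable_decay _ k
    refine integrable_of_enorm_le (h := fun p : E d × E d =>
      ‖κ p.1‖ₑ * (C * 2 ^ (m * k) * decay (d + 1) k p.2)) (Continuous.aestronglyMeasurable ?_)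
      (fun p => ?_) ?_
    · exact (h1.mul h2).mul (by fun_prop)
    · simp only [Function.uncurry]
      rw [enorm_mul, enorm_mul, hF1, mul_one]
      gcongr
      exact hK' _ _
    · rw [lintegral_prod_mul κ.continuous.enorm.measurable.aemeasurable
        (hm1.const_mul _).aemeasurable, lintegral_const_mul' _ _ hC']
      refine ENNReal.mul_ne_top κ.integrable.2.ne (ENNReal.mul_ne_top hC' ?_)
      simpa only [hF1, mul_one] using h0
  have hswap := integral_integral_swap hint
  rw [Real.fourier_eq]
  have e1 : ∀ ζ, Real.fourierChar (-(inner ℝ ζ ξ)) • avgKernel κ a k x ζ =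
      ∫ z, κ z * kernel (stdCutoff d) a k (x - z) ζ * F (0 - ζ) := by
    intro ζ
    rw [integral_mul_const, Circle.smul_def, smul_eq_mul, mul_comm]
    simp [avgKernel, F, inner_neg_left]
  simp_rw [e1]
  rw [← hswap, ← integral_mul_const]
  congr 1 with z
  have e2 := fourier_kernelSchwartz ha (stdCutoff d) k (x - z) ξ
  rw [SchwartzMap.fourier_coe, Real.fourier_eq] at e2
  rw [mul_assoc, ← e2, ← integral_const_mul]
  congr 1 with ζ
  rw [kernelSchwartz_apply, Circle.smul_def, smul_eq_mul]
  simp only [F, zero_sub, inner_neg_left]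
  ring

end applyKernel

/-! ### The pieces of a pseudo-differential operator -/

/-- The averaged kernel has finite moments of every order, so its Fourier transform is smooth. That
transform is compactly supported because of the cutoff, hence Schwartz, and Fourier inversion
identifies its inverse transform with the averaged kernel. -/
theorem exists_schwartz_fourier_eq_avgKernel {m : ℝ} {a : E d → E d → ℂ} (ha : IsSymbol m 1 1 a)
    (κ : 𝓢(E d, ℂ)) (k : ℕ) (x : E d) : ∃ K : 𝓢(E d, ℂ), (∀ ζ, K ζ = avgKernel κ a k x ζ) ∧
      ∀ ξ, 𝓕 K ξ = (∫ z, κ z * a (x - z) ξ) * (stdCutoff d).scaled k ξ := by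
  have hcont := continuous_avgKernel ha κ x (k := k)
  have hint : ∀ n : ℕ, Integrable fun ζ => ‖ζ‖ ^ n * ‖avgKernel κ a k x ζ‖ := by
    intro n
    obtain ⟨C, hC, hK⟩ := ha.exists_enorm_kernel_le (stdCutoff d) (n + (d + 1))
    have hC' : C * 2 ^ (m * k) ≠ ⊤ := ENNReal.mul_ne_top hC (two_rpow_ne_top _)
    have hK' : ∀ w ζ, ‖kernel (stdCutoff d) a k w ζ‖ₑ ≤
        C * 2 ^ (m * k) * decay (n + (d + 1)) k ζ :=
      fun w ζ => (hK k w ζ).trans_eq (mul_assoc _ _ _).symm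
    have hD : (∫⁻ z, ‖κ z‖ₑ) * (C * 2 ^ (m * k)) ≠ ⊤ := ENNReal.mul_ne_top κ.integrable.2.ne hC'
    refine ⟨((continuous_norm.pow n).mul hcont.norm).aestronglyMeasurable, ?_⟩
    refine lt_of_le_of_lt (b := ∫⁻ ζ, (∫⁻ z, ‖κ z‖ₑ) * (C * 2 ^ (m * k)) * decay (d + 1) k ζ)
      (lintegral_mono fun ζ => ?_) ?_
    · rw [enorm_mul, enorm_pow, enorm_norm, enorm_norm]
      have h1 : ‖ζ‖ₑ ^ n ≤ weight k ζ ^ (n : ℝ) := by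
        rw [ENNReal.rpow_natCast]
        gcongr
        unfold weight
        calc ‖ζ‖ₑ = 1 * ‖ζ‖ₑ := (one_mul _).symm
          _ ≤ 2 ^ k * ‖ζ‖ₑ := by gcongr; exact one_le_pow₀ one_le_two
          _ ≤ _ := le_add_self
      calc ‖ζ‖ₑ ^ n * ‖avgKernel κ a k x ζ‖ₑ ≤ weight k ζ ^ (n : ℝ) *
            ((∫⁻ z, ‖κ z‖ₑ) * (C * 2 ^ (m * k)) * decay (n + (d + 1)) k ζ) := by
            gcongr
            exact enorm_avgKernel_le κ hK' x ζ
        _ = (∫⁻ z, ‖κ z‖ₑ) * (C * 2 ^ (m * k)) * (2 ^ (k * d) *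
            (weight k ζ ^ (n : ℝ) * weight k ζ ^ (-((n : ℝ) + (d + 1))))) := by rw [decay]; ring
        _ = _ := by
            rw [← ENNReal.rpow_add _ _ (weight_ne_zero _ _) (weight_ne_top _ _), decay]
            congr 4
            ring
    · rw [lintegral_const_mul' _ _ hD]
      refine (ENNReal.mul_ne_top hD ?_).lt_top
      have := lintegral_decay (d := d) (d + 1) k 0
      simp only [decay, zero_sub, weight_neg] at this ⊢
      rw [this]
      exact (lintegral_weight_lt_top (lt_add_one _)).ne
  have hint0 : Integrable (avgKernel κ a k x) := by
    have := hint 0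
    simp only [pow_zero, one_mul] at this
    exact (integrable_norm_iff hcont.aestronglyMeasurable).1 this
  set p : E d → ℂ := fun ξ => (∫ z, κ z * a (x - z) ξ) * (stdCutoff d).scaled k ξ with hp
  have hpF : 𝓕 (avgKernel κ a k x) = p := funext fun ξ => fourier_avgKernel ha κ k x ξ
  have hsm : ContDiff ℝ ∞ p := by
    rw [← hpF]
    exact Real.contDiff_fourier (N := ⊤) fun n _ => hint n
  have hcs : HasCompactSupport p := (stdCutoff d).hasCompactSupport_mul_scaled k _
  refine ⟨𝓕⁻ (hcs.toSchwartzMap hsm), fun ζ => ?_, fun ξ => ?_⟩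
  · rw [SchwartzMap.fourierInv_coe]
    change 𝓕⁻ p ζ = _
    rw [← hpF]
    refine congrFun (hcont.fourierInv_fourier_eq hint0 ?_) ζ
    rw [hpF]
    exact hsm.continuous.integrable_of_hasCompactSupport hcs
  · rw [FourierTransform.fourier_fourierInv_eq]
    rfl

theorem fourierChar_eq_exp (t : ℝ) :
    (Real.fourierChar t : ℂ) = Complex.exp (2 * Real.pi * Complex.I * (t : ℝ)) := by
  rw [Real.fourierChar_apply]
  congr 1
  push_cast
  ring

theorem fourierInv_reflectAt (H : 𝓢(E d, ℂ)) (x ξ : E d) :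
    𝓕⁻ (reflectAt H x) ξ =
      𝓕 H ξ * Complex.exp (2 * Real.pi * Complex.I * (inner ℝ x ξ : ℝ)) := by
  rw [SchwartzMap.fourierInv_coe, SchwartzMap.fourier_coe, Real.fourierInv_eq, Real.fourier_eq,
    ← integral_mul_const, ← integral_sub_left_eq_self _ _ x]
  congr 1 with y
  rw [reflectAt_apply, sub_sub_cancel, ← fourierChar_eq_exp, inner_sub_left, sub_eq_neg_add,
    AddChar.map_add_eq_mul, Circle.smul_def, Circle.smul_def, Circle.coe_mul]
  simp only [smul_eq_mul]
  ring

/-- The test function with the prescribed values is the inverse Fourier transform of the reflection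
of `K * φ_k`, where `K` is the averaged kernel. Associativity of convolution then turns the pairing
with `𝓕 f` into an integral against `Π_k f`. -/
theorem isPseudoDiffFunction_symbolPiece {φ : 𝓢(E d, ℂ)} (h : IsLittlewoodPaley φ) {m : ℝ}
    {a : E d → E d → ℂ} (ha : IsSymbol m 1 1 a) (j k : ℕ) (f : 𝓢'(E d, ℂ)) :
    IsPseudoDiffFunction (symbolPiece φ h a j k) f fun x =>
      ∫ ζ, avgKernel (lpKernel φ h j) a k x ζ * lpPiece φ h k f (x - ζ) := by
  intro x
  obtain ⟨K, hK, hFK⟩ := exists_schwartz_fourier_eq_avgKernel ha (lpKernel φ h j) k x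
  refine ⟨𝓕⁻ (reflectAt (schwartzConv K (lpKernel φ h k)) x), fun ξ => ?_, ?_⟩
  · rw [fourierInv_reflectAt, fourier_schwartzConv, hFK, symbolPiece, mul_assoc (∫ z, _),
      stdCutoff_scaled_mul_fourier_lpKernel]
  · rw [TemperedDistribution.fourier_apply, FourierTransform.fourier_fourierInv_eq]
    have h2 := (conv_eq_integral f K (lpKernel φ h k) _ (schwartzConv_apply _ _) x).2
    simp_rw [hK] at h2
    exact h2.symm

/-- A bounded measurable function is a tempered distribution. -/
theorem exists_isRegularDistribution {F : E d → ℂ} (hF : StronglyMeasurable F) {C : ℝ}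
    (hC : ∀ x, ‖F x‖ ≤ C) : ∃ v : 𝓢'(E d, ℂ), IsRegularDistribution v F := by
  have hmem : MemLp F ⊤ volume := memLp_top_of_bound hF.aestronglyMeasurable C (.of_forall hC)
  refine ⟨(hmem.toLp F : Lp ℂ ⊤ (volume : Measure (E d))), fun g => ⟨?_, ?_⟩⟩
  · simp_rw [mul_comm (F _)]
    exact g.integrable.mul_bdd hF.aestronglyMeasurable (.of_forall hC)
  · rw [Lp.toTemperedDistribution_apply]
    refine integral_congr_ae ?_
    filter_upwards [hmem.coeFn_toLp] with x hx
    rw [hx, smul_eq_mul, mul_comm]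

theorem IsLittlewoodPaley.fourier_zero {φ : 𝓢(E d, ℂ)} (h : IsLittlewoodPaley φ) : 𝓕 φ 0 = 0 :=
  h.isAnnular 0 (.inl (by norm_num))

theorem IsLittlewoodPaley.summable_fourier_dilate {φ : 𝓢(E d, ℂ)} (h : IsLittlewoodPaley φ)
    (ξ : E d) : Summable fun k : ℕ => 𝓕 (dilate φ ((k : ℤ) + 1)) ξ := by
  by_cases hξ : ξ = 0
  · subst hξ
    simp only [fourier_dilate, smul_zero, h.fourier_zero]
    exact summable_zero
  · exact (h.hasSum_one ξ hξ).summable.comp_injective (i := fun k : ℕ => (k : ℤ) + 1)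
      fun a b hab => by simpa using hab

/-- The partial sums of the Littlewood-Paley kernels are dilations of the low-pass kernel. -/
theorem sum_lpKernel {φ : 𝓢(E d, ℂ)} (h : IsLittlewoodPaley φ) (N : ℕ) :
    ∑ j ∈ Finset.range (N + 1), lpKernel φ h j = dilate (lowPass φ h) N := by
  have hsum : ∀ s : Finset ℕ, ∀ g : ℕ → 𝓢(E d, ℂ), ∀ ξ, 𝓕 (∑ j ∈ s, g j) ξ = ∑ j ∈ s, 𝓕 (g j) ξ := by
    intro s g ξ
    have := map_sum (FourierTransform.fourierEquiv (E := 𝓢(E d, ℂ)) (F := 𝓢(E d, ℂ)) ℂ) g s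
    simp only [FourierTransform.fourierEquiv_apply] at this
    rw [this, sum_apply]
  refine schwartz_ext_fourier fun ξ => ?_
  rw [hsum, Finset.sum_range_succ', fourier_dilate, fourier_lowPass]
  have e0 : lpKernel φ h 0 = lowPass φ h := by simp [lpKernel]
  have e1 : ∀ j : ℕ, lpKernel φ h (j + 1) = dilate φ ((j : ℤ) + 1) := fun j => by simp [lpKernel]
  simp only [e0, e1, fourier_lowPass, lowPassSymbol]
  -- Dilating by `2^N` shifts the index by `N`, so the tail from `N + 1` on is the dilated tail of
  -- the low-pass symbol.
  have e2 : ∀ k : ℕ, 𝓕 (dilate φ ((k : ℤ) + 1)) ((2 : ℝ) ^ (-(N : ℤ)) • ξ) =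
      𝓕 (dilate φ (((k + N : ℕ) : ℤ) + 1)) ξ := by
    intro k
    rw [fourier_dilate, fourier_dilate, smul_smul, ← zpow_add₀ (by norm_num)]
    congr 3
    push_cast
    ring
  simp_rw [e2]
  have := (h.summable_fourier_dilate ξ).sum_add_tsum_nat_add N
  rw [← this]
  ring

/-- The integral is the Fourier transform at the origin, where every dilate of `φ` has Fourier
transform zero. -/
theorem integral_lowPass {φ : 𝓢(E d, ℂ)} (h : IsLittlewoodPaley φ) : ∫ z, lowPass φ h z = 1 := by
  have h1 := fourier_lowPass h 0
  rw [SchwartzMap.fourier_coe, Real.fourier_eq] at h1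
  simpa [lowPassSymbol, fourier_dilate, h.fourier_zero] using h1

/-- The dilations of a Schwartz function with integral one are an approximate identity. -/
theorem tendsto_integral_dilate_mul {Φ : 𝓢(E d, ℂ)} (hΦ : ∫ z, Φ z = 1) {g : E d → ℂ}
    (hg : Continuous g) {C : ℝ} (hC : ∀ w, ‖g w‖ ≤ C) (x : E d) :
    Tendsto (fun N : ℕ => ∫ z, dilate Φ N z * g (x - z)) atTop (nhds (g x)) := by
  have h1 : ∀ N : ℕ, ∫ z, dilate Φ N z * g (x - z) =
      ∫ w, Φ w * g (x - ((2 : ℝ) ^ N)⁻¹ • w) := by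
    intro N
    have h2 := Measure.integral_comp_smul (volume : Measure (E d))
      (fun w => Φ w * g (x - ((2 : ℝ) ^ N)⁻¹ • w)) ((2 : ℝ) ^ N)
    rw [finrank_euclideanSpace_fin, abs_of_pos (by positivity)] at h2
    have h3 : (((2 : ℝ) ^ N) ^ d) • ∫ z, Φ ((2 : ℝ) ^ N • z) *
        g (x - ((2 : ℝ) ^ N)⁻¹ • (2 : ℝ) ^ N • z) = ∫ w, Φ w * g (x - ((2 : ℝ) ^ N)⁻¹ • w) := by
      rw [h2, smul_smul, mul_inv_cancel₀ (by positivity), one_smul]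
    rw [← h3, ← integral_smul]
    congr 1 with z
    rw [dilate_apply, zpow_natCast, smul_smul, inv_mul_cancel₀ (by positivity), one_smul,
      smul_mul_assoc]
  simp_rw [h1]
  have h4 : g x = ∫ w, Φ w * g x := by rw [integral_mul_const, hΦ, one_mul]
  rw [h4]
  refine tendsto_integral_of_dominated_convergence (fun w => ‖Φ w‖ * C)
    (fun N => (Φ.continuous.mul (by fun_prop)).aestronglyMeasurable) (Φ.integrable.norm.mul_const C)
    (fun N => .of_forall fun w => ?_) (.of_forall fun w => ?_)
  · rw [norm_mul]
    gcongr
    exact hC _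
  · refine Tendsto.const_mul _ ((hg.tendsto _).comp ?_)
    have h5 : Tendsto (fun N : ℕ => ((2 : ℝ) ^ N)⁻¹) atTop (nhds 0) :=
      tendsto_inv_atTop_zero.comp (tendsto_pow_atTop_atTop_of_one_lt one_lt_two)
    simpa using tendsto_const_nhds.sub (h5.smul_const w) (a := x)

/-! ### Convergence of the series defining the operator -/

theorem stronglyMeasurable_applyKernel_comp {X : Type*} [MeasurableSpace X] {m : ℝ}
    {a : E d → E d → ℂ} (ha : IsSymbol m 1 1 a) {F : E d → ℂ} (hF : Continuous F) (k : ℕ)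
    {p r : X → E d} (hp : Measurable p) (hr : Measurable r) :
    StronglyMeasurable fun t => applyKernel a k F (p t) (r t) :=
  StronglyMeasurable.comp_measurable (f := fun p : E d × E d => applyKernel a k F p.1 p.2)
    (g := fun t => (p t, r t)) (stronglyMeasurable_applyKernel ha hF) (hp.prodMk hr)

theorem integral_norm_dilate (Φ : 𝓢(E d, ℂ)) (N : ℕ) : ∫ z, ‖dilate Φ N z‖ = ∫ z, ‖Φ z‖ := by
  have h2 := Measure.integral_comp_smul (volume : Measure (E d)) (fun w => ‖Φ w‖) ((2 : ℝ) ^ N)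
  rw [finrank_euclideanSpace_fin, abs_of_pos (by positivity)] at h2
  have h3 : (((2 : ℝ) ^ N) ^ d) • ∫ z, ‖Φ ((2 : ℝ) ^ N • z)‖ = ∫ w, ‖Φ w‖ := by
    rw [h2, smul_smul, mul_inv_cancel₀ (by positivity), one_smul]
  rw [← h3, ← integral_smul]
  congr 1 with z
  rw [dilate_apply, zpow_natCast, norm_smul, Real.norm_of_nonneg (by positivity), smul_eq_mul]

theorem norm_integral_schwartz_mul_le (ψ : 𝓢(E d, ℂ)) {g : E d → ℂ} {C : ℝ}
    (hC : ∀ w, ‖g w‖ ≤ C) : ‖∫ z, ψ z * g z‖ ≤ (∫ z, ‖ψ z‖) * C := by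
  rw [← integral_mul_const]
  refine norm_integral_le_of_norm_le (ψ.integrable.norm.mul_const C) (.of_forall fun z => ?_)
  rw [norm_mul]
  gcongr
  exact hC z

/-- The contribution of the frequencies of size `2^k` of `f` to `T_[a] f`. -/
def pdoPiece (φ : 𝓢(E d, ℂ)) (h : IsLittlewoodPaley φ) (a : E d → E d → ℂ) (f : 𝓢'(E d, ℂ))
    (k : ℕ) (x : E d) : ℂ := applyKernel a k (lpPiece φ h k f) x x

theorem measurable_pdoPiece {φ : 𝓢(E d, ℂ)} (h : IsLittlewoodPaley φ) {m : ℝ} {a : E d → E d → ℂ}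
    (ha : IsSymbol m 1 1 a) (f : 𝓢'(E d, ℂ)) (k : ℕ) : Measurable (pdoPiece φ h a f k) :=
  (stronglyMeasurable_applyKernel_comp ha (continuous_lpPiece h k f) k measurable_id
    measurable_id).measurable

/-- For fixed `k` the sum over `j ≤ N` convolves `w ↦ applyKernel a k _ w x` with an `L^1`-bounded
approximate identity, so it tends to the value at `w = x`, which is `pdoPiece`. The summable bound
`b` then allows dominated convergence, first in the sum over `k` at each point and then in the
integral against a test function. -/
theorem exists_isPseudoDiff {φ : 𝓢(E d, ℂ)} (h : IsLittlewoodPaley φ) {m : ℝ}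
    {a : E d → E d → ℂ} (ha : IsSymbol m 1 1 a) {f : 𝓢'(E d, ℂ)} {M : ℝ}
    (hfin : ∀ k x, ∫⁻ ζ, decay M k ζ * ‖lpPiece φ h k f (x - ζ)‖ₑ ≠ ⊤) {b : ℕ → ℝ}
    (hb : Summable b) (hB : ∀ k w x, ‖applyKernel a k (lpPiece φ h k f) w x‖ ≤ b k) :
    ∃ u : 𝓢'(E d, ℂ), IsPseudoDiff φ h a f u ∧
      IsRegularDistribution u fun x => ∑' k, pdoPiece φ h a f k x := by
  obtain ⟨C, hC, hK⟩ := ha.exists_enorm_kernel_le (stdCutoff d) M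
  have hC' : ∀ k : ℕ, C * 2 ^ (m * k) ≠ ⊤ := fun k => ENNReal.mul_ne_top hC (two_rpow_ne_top _)
  have hK' : ∀ k w ζ, ‖kernel (stdCutoff d) a k w ζ‖ₑ ≤ C * 2 ^ (m * k) * decay M k ζ :=
    fun k w ζ => (hK k w ζ).trans_eq (mul_assoc _ _ _).symm
  have hcont := fun k => continuous_lpPiece h k f
  have hb0 : ∀ k, 0 ≤ b k := fun k => (norm_nonneg _).trans (hB k 0 0)
  set F : ℕ → ℕ → E d → ℂ := fun j k x =>
    ∫ ζ, avgKernel (lpKernel φ h j) a k x ζ * lpPiece φ h k f (x - ζ) with hFdef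
  have hF : ∀ j k x, F j k x =
      ∫ z, lpKernel φ h j z * applyKernel a k (lpPiece φ h k f) (x - z) x := fun j k x =>
    integral_avgKernel_mul ha _ (hcont k) (hC' k) (hK' k) (hfin k x)
  have hFm : ∀ j k, StronglyMeasurable (F j k) := by
    intro j k
    have h1 : StronglyMeasurable fun p : E d × E d =>
        lpKernel φ h j p.2 * applyKernel a k (lpPiece φ h k f) (p.1 - p.2) p.1 :=
      ((lpKernel φ h j).continuous.stronglyMeasurable.comp_measurable measurable_snd).mul
        (stronglyMeasurable_applyKernel_comp ha (hcont k) k (measurable_fst.sub measurable_snd)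
          measurable_fst)
    have h2 := h1.integral_prod_right' (ν := volume)
    convert h2 using 1
    funext x
    exact hF j k x
  have hFb : ∀ j k x, ‖F j k x‖ ≤ (∫ z, ‖lpKernel φ h j z‖) * b k := fun j k x => by
    rw [hF]
    exact norm_integral_schwartz_mul_le _ fun w => hB k _ _
  choose v hv using fun j k => exists_isRegularDistribution (hFm j k) (hFb j k)
  set U : E d → ℂ := fun x => ∑' k, pdoPiece φ h a f k x with hU
  have hUb : ∀ x, ‖U x‖ ≤ ∑' k, b k := fun x =>
    tsum_of_norm_bounded hb.hasSum fun k => hB k x x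
  have hUm : Measurable U := Measurable.tsum fun k => measurable_pdoPiece h ha f k
  obtain ⟨u, hu⟩ := exists_isRegularDistribution hUm.stronglyMeasurable hUb
  refine ⟨u, ⟨F, v, fun j k => isPseudoDiffFunction_symbolPiece h ha j k f, hv, ?_⟩, hu⟩
  rw [PointwiseConvergenceCLM.tendsto_iff_forall_tendsto]
  intro g
  set S : ℕ → E d → ℂ := fun N x => ∑ k ∈ Finset.range (N + 1),
    ∑ j ∈ Finset.range (N + 1), F j k x with hS
  set Φ := lowPass φ h
  have hint : ∀ k x (ψ : 𝓢(E d, ℂ)),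
      Integrable fun z => ψ z * applyKernel a k (lpPiece φ h k f) (x - z) x := fun k x ψ =>
    ψ.integrable.mul_bdd (stronglyMeasurable_applyKernel_comp ha (hcont k) k
      (measurable_const.sub measurable_id) measurable_const).aestronglyMeasurable
      (.of_forall fun z => hB k _ _)
  have hS1 : ∀ N k x, ∑ j ∈ Finset.range (N + 1), F j k x =
      ∫ z, dilate Φ N z * applyKernel a k (lpPiece φ h k f) (x - z) x := by
    intro N k x
    simp_rw [hF]
    rw [← integral_finsetSum _ fun j _ => hint k x _, ← sum_lpKernel h N]
    simp_rw [sum_apply, Finset.sum_mul]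
  have hS1b : ∀ N k x, ‖∑ j ∈ Finset.range (N + 1), F j k x‖ ≤ (∫ z, ‖Φ z‖) * b k := by
    intro N k x
    rw [hS1, ← integral_norm_dilate Φ N]
    exact norm_integral_schwartz_mul_le _ fun w => hB k _ _
  have hsumm : Summable fun k => (∫ z, ‖Φ z‖) * b k := hb.mul_left _
  have hlim : ∀ x, Tendsto (fun N => S N x) atTop (nhds (U x)) := by
    intro x
    have h1 : ∀ N, S N x = ∑' k, if k ∈ Finset.range (N + 1) then
        ∑ j ∈ Finset.range (N + 1), F j k x else 0 := by
      intro N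
      rw [tsum_eq_sum (s := Finset.range (N + 1)) fun k hk => if_neg hk]
      exact Finset.sum_congr rfl fun k hk => (if_pos hk).symm
    simp_rw [h1]
    -- Both sums are truncated at the same `N`; the truncation in `k` is written as a series whose
    -- terms vanish for `k > N`, so that one limit handles both indices.
    refine tendsto_tsum_of_dominated_convergence hsumm (fun k => ?_) (.of_forall fun N k => ?_)
    · have h2 := tendsto_integral_dilate_mul (integral_lowPass h)
        (continuous_applyKernel_left ha (hcont k) (hC' k) (hK' k) (hfin k x))
        (fun w => hB k w x) x
      refine h2.congr' ?_
      filter_upwards [eventually_ge_atTop k] with N hN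
      rw [if_pos (Finset.mem_range.2 (Nat.lt_succ_of_le hN)), hS1]
    · split_ifs
      · exact hS1b N k x
      · rw [norm_zero]
        exact mul_nonneg (integral_nonneg fun _ => norm_nonneg _) (hb0 k)
  have hval : ∀ N, (∑ k ∈ Finset.range (N + 1), ∑ j ∈ Finset.range (N + 1), v j k) g =
      ∫ x, S N x * g x := by
    intro N
    rw [sum_apply]
    simp_rw [sum_apply, (hv _ _ g).2]
    simp only [hS, Finset.sum_mul]
    rw [integral_finsetSum _ fun k _ => integrable_finsetSum _ fun j _ => (hv j k g).1]
    exact Finset.sum_congr rfl fun k _ => (integral_finsetSum _ fun j _ => (hv j k g).1).symm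
  simp_rw [hval]
  rw [(hu g).2]
  refine tendsto_integral_of_dominated_convergence
    (fun x => (∑' k, (∫ z, ‖Φ z‖) * b k) * ‖g x‖) (fun N => ?_) (g.integrable.norm.const_mul _)
    (fun N => .of_forall fun x => ?_) (.of_forall fun x => (hlim x).mul_const _)
  · refine AEStronglyMeasurable.mul ?_ g.continuous.aestronglyMeasurable
    exact (Finset.stronglyMeasurable_fun_sum _ fun k _ =>
      Finset.stronglyMeasurable_fun_sum _ fun j _ => hFm j k).aestronglyMeasurable
  · rw [norm_mul]
    gcongr
    refine (norm_sum_le _ _).trans ((Finset.sum_le_sum fun k _ => hS1b N k x).trans ?_)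
    exact hsumm.sum_le_tsum _ fun k _ =>
      mul_nonneg (integral_nonneg fun _ => norm_nonneg _) (hb0 k)

/-- Littlewood-Paley pieces of a series of bounded functions. -/
theorem enorm_lpPiece_le_tsum {φ : 𝓢(E d, ℂ)} (h : IsLittlewoodPaley φ) {G : ℕ → E d → ℂ}
    (hG : ∀ k, Measurable (G k)) {b : ℕ → ℝ} (hb : Summable b) (hB : ∀ k x, ‖G k x‖ ≤ b k)
    {u : 𝓢'(E d, ℂ)} (hu : IsRegularDistribution u fun x => ∑' k, G k x) (l : ℕ) (x : E d) :
    ‖lpPiece φ h l u x‖ₑ ≤ ∑' k, ‖∫ y, lpKernel φ h l y * G k (x - y)‖ₑ := by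
  set ψ := lpKernel φ h l
  have hb0 : ∀ k, 0 ≤ b k := fun k => (norm_nonneg _).trans (hB k 0)
  have hint : ∀ k, Integrable fun y => ψ y * G k (x - y) := fun k =>
    ψ.integrable.mul_bdd ((hG k).comp (measurable_const.sub measurable_id)).aestronglyMeasurable
      (.of_forall fun z => hB k _)
  have h1 : lpPiece φ h l u x = ∑' k, ∫ y, ψ y * G k (x - y) := by
    rw [integral_tsum_of_summable_integral_norm hint]
    · simp_rw [tsum_mul_left]
      change u (reflectAt ψ x) = _
      rw [(hu _).2, ← integral_sub_left_eq_self _ _ x]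
      congr 1 with y
      rw [reflectAt_apply, sub_sub_cancel, mul_comm]
    · refine Summable.of_nonneg_of_le (fun k => integral_nonneg fun _ => norm_nonneg _)
        (fun k => ?_) (hb.mul_left (∫ y, ‖ψ y‖))
      rw [← integral_mul_const]
      refine integral_mono (hint k).norm (ψ.integrable.norm.mul_const _) fun y => ?_
      simp only [norm_mul]
      gcongr
      exact hB k _
  rw [h1]
  exact enorm_tsum_le_tsum_enorm

/-! ### Boundedness -/

/-- The averages of the weighted powers of the Littlewood-Paley pieces. -/
abbrev avgPiece (φ : 𝓢(E d, ℂ)) (h : IsLittlewoodPaley φ) (L σ q : ℝ) (f : 𝓢'(E d, ℂ)) (k : ℕ) :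
    E d → ℝ≥0∞ := decayConv L k (powPiece φ h σ q f k)

theorem measurable_avgPiece {φ : 𝓢(E d, ℂ)} (h : IsLittlewoodPaley φ) (L σ q : ℝ)
    (f : 𝓢'(E d, ℂ)) (k : ℕ) : Measurable (avgPiece φ h L σ q f k) :=
  measurable_decayConv L k (measurable_powPiece h σ q f k)

theorem enorm_lpPiece_eq {φ : 𝓢(E d, ℂ)} (h : IsLittlewoodPaley φ) (σ : ℝ) {q : ℝ} (hq : 0 < q)
    (f : 𝓢'(E d, ℂ)) (k : ℕ) (y : E d) :
    ‖lpPiece φ h k f y‖ₑ = 2 ^ (-(σ * k)) * powPiece φ h σ q f k y ^ (1 / q) := by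
  rw [powPiece, ENNReal.mul_rpow_of_nonneg _ _ (by positivity), ← ENNReal.rpow_mul,
    ← ENNReal.rpow_mul, mul_one_div_cancel hq.ne', ENNReal.rpow_one, mul_assoc (σ * k),
    mul_one_div_cancel hq.ne', mul_one, ← mul_assoc, ← two_rpow_add, neg_add_cancel,
    ENNReal.rpow_zero, one_mul]

/-- Peetre's inequality transfers the value at `x - ζ` to an average at `x` for a price of `L/q`
powers of the weight. The kernel decay `L/q + (d + 1)` pays for this and leaves `d + 1` for
integrability. -/
theorem exists_lintegral_decay_mul_lpPiece_le {φ : 𝓢(E d, ℂ)} (h : IsLittlewoodPaley φ) {q L : ℝ}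
    (hq : 0 < q) (hL : (d : ℝ) < L) (σ : ℝ) : ∃ C : ℝ≥0∞, C ≠ ⊤ ∧ ∀ k (f : 𝓢'(E d, ℂ)) x,
      ∫⁻ ζ, decay (L / q + (d + 1)) k ζ * ‖lpPiece φ h k f (x - ζ)‖ₑ ≤
        C * (2 ^ (-(σ * k)) * avgPiece φ h L σ q f k x ^ (1 / q)) := by
  obtain ⟨C, hC, hle⟩ := exists_powPiece_le h hq hL
  have hq' : 0 ≤ 1 / q := by positivity
  refine ⟨C ^ (1 / q) * ∫⁻ z : E d, weight 0 z ^ (-((d : ℝ) + 1)),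
    ENNReal.mul_ne_top (ENNReal.rpow_ne_top_of_nonneg hq' hC)
      (lintegral_weight_lt_top (lt_add_one _)).ne, fun k f x => ?_⟩
  set A := avgPiece φ h L σ q f k x
  have hm : Measurable fun ζ : E d => decay (d + 1) k (0 - ζ) :=
    (measurable_decay _ k).comp (measurable_const.sub measurable_id)
  calc ∫⁻ ζ, decay (L / q + (d + 1)) k ζ * ‖lpPiece φ h k f (x - ζ)‖ₑ
      ≤ ∫⁻ ζ, decay (d + 1) k (0 - ζ) * (C ^ (1 / q) * (2 ^ (-(σ * k)) * A ^ (1 / q))) := by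
        refine lintegral_mono fun ζ => ?_
        have h1 := hle σ k f x (x - ζ)
        rw [sub_sub_cancel] at h1
        have h2 : powPiece φ h σ q f k (x - ζ) ^ (1 / q) ≤
            C ^ (1 / q) * (weight k ζ ^ (L / q) * A ^ (1 / q)) := by
          refine (ENNReal.rpow_le_rpow h1 hq').trans_eq ?_
          rw [ENNReal.mul_rpow_of_nonneg _ _ hq', ENNReal.mul_rpow_of_nonneg _ _ hq',
            ← ENNReal.rpow_mul, mul_one_div]
        rw [enorm_lpPiece_eq h σ hq]
        calc decay (L / q + (d + 1)) k ζ * (2 ^ (-(σ * k)) * powPiece φ h σ q f k (x - ζ) ^ (1 / q))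
            ≤ decay (L / q + (d + 1)) k ζ *
              (2 ^ (-(σ * k)) * (C ^ (1 / q) * (weight k ζ ^ (L / q) * A ^ (1 / q)))) := by gcongr
          _ = 2 ^ (k * d) * (weight k ζ ^ (-(L / q + (d + 1))) * weight k ζ ^ (L / q)) *
              (C ^ (1 / q) * (2 ^ (-(σ * k)) * A ^ (1 / q))) := by rw [decay]; ring
          _ = _ := by
              rw [← ENNReal.rpow_add _ _ (weight_ne_zero _ _) (weight_ne_top _ _), decay, zero_sub,
                weight_neg]
              congr 3
              ring
    _ = _ := by
        rw [lintegral_mul_const _ hm, lintegral_decay]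
        ring

/-- The kernel contributes `2^{mk}` and the normalization of the pieces `2^{-(s+m)k}`. The bound is
uniform in `w` because the kernel estimates are, which is what the averaging over `w` needs. -/
theorem IsSymbol.exists_enorm_applyKernel_le {φ : 𝓢(E d, ℂ)} (h : IsLittlewoodPaley φ) {m : ℝ}
    {a : E d → E d → ℂ} (ha : IsSymbol m 1 1 a) {q L : ℝ} (hq : 0 < q) (hL : (d : ℝ) < L) (s : ℝ) :
    ∃ C : ℝ≥0∞, C ≠ ⊤ ∧ ∀ k (f : 𝓢'(E d, ℂ)) w x,
      ‖applyKernel a k (lpPiece φ h k f) w x‖ₑ ≤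
        C * (2 ^ (-(s * k)) * avgPiece φ h L (s + m) q f k x ^ (1 / q)) := by
  obtain ⟨C₁, hC₁, h₁⟩ := exists_lintegral_decay_mul_lpPiece_le h hq hL (s + m)
  obtain ⟨C₂, hC₂, h₂⟩ := ha.exists_enorm_kernel_le (stdCutoff d) (L / q + (d + 1))
  refine ⟨C₂ * C₁, ENNReal.mul_ne_top hC₂ hC₁, fun k f w x => ?_⟩
  refine (enorm_applyKernel_le (C := C₂ * 2 ^ (m * k)) (M := L / q + (d + 1))
    (ENNReal.mul_ne_top hC₂ (two_rpow_ne_top _))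
    (fun w ζ => (h₂ k w ζ).trans_eq (mul_assoc _ _ _).symm) w x).trans ?_
  refine (mul_le_mul_right (h₁ k f x) _).trans_eq ?_
  have : (2 : ℝ≥0∞) ^ (-(s * k)) = 2 ^ (m * k) * 2 ^ (-((s + m) * k)) := by
    rw [← two_rpow_add]; congr 1; ring
  rw [this]
  ring

/-- A kernel operator at frequency `2^k` followed by a convolution is again a kernel operator. -/
theorem integral_dilate_mul_applyKernel {m : ℝ} {a : E d → E d → ℂ} {F : E d → ℂ} {C B : ℝ≥0∞}
    {M : ℝ} {k : ℕ} (ha : IsSymbol m 1 1 a) (ψ : 𝓢(E d, ℂ)) (l : ℕ) (hF : Continuous F)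
    (hC : C ≠ ⊤) (hK : ∀ w ζ, ‖kernel (stdCutoff d) a k w ζ‖ₑ ≤ C * decay M k ζ) (hB : B ≠ ⊤)
    (hx : ∀ x, ∫⁻ ζ, decay M k ζ * ‖F (x - ζ)‖ₑ ≤ B) (x : E d) :
    ∫ y, dilate ψ l y * applyKernel a k F (x - y) (x - y) =
      ∫ ζ, offDiag ψ (stdCutoff d) a k l x ζ * F (x - ζ) := by
  have hc := ha.continuous_kernel (stdCutoff d) k
  have e1 : ∀ y, applyKernel a k F (x - y) (x - y) =
      ∫ ζ, kernel (stdCutoff d) a k (x - y) (ζ - y) * F (x - ζ) := by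
    intro y
    rw [applyKernel, ← integral_sub_right_eq_self _ y]
    congr 1 with ζ
    rw [sub_sub_sub_cancel_right]
  have hint : Integrable (Function.uncurry fun y ζ =>
      dilate ψ l y * kernel (stdCutoff d) a k (x - y) (ζ - y) * F (x - ζ))
      (volume.prod volume) := by
    have hd : Measurable fun p : E d × E d => decay M k (p.2 - p.1) :=
      (measurable_decay M k).comp (measurable_snd.sub measurable_fst)
    have hFm : Measurable fun p : E d × E d => ‖F (x - p.2)‖ₑ := by
      have : Continuous fun p : E d × E d => F (x - p.2) := by fun_prop
      exact this.enorm.measurable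
    have hψ : Measurable fun p : E d × E d => ‖dilate ψ l p.1‖ₑ :=
      (dilate ψ l).continuous.enorm.measurable.comp measurable_fst
    refine integrable_of_enorm_le (h := fun p : E d × E d =>
      ‖dilate ψ l p.1‖ₑ * (C * (decay M k (p.2 - p.1) * ‖F (x - p.2)‖ₑ)))
      (Continuous.aestronglyMeasurable ?_) (fun p => ?_) ?_
    · have h1 : Continuous fun p : E d × E d => dilate ψ l p.1 :=
        (dilate ψ l).continuous.comp continuous_fst
      have h2 : Continuous fun p : E d × E d => kernel (stdCutoff d) a k (x - p.1) (p.2 - p.1) :=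
        Continuous.comp' (g := fun p : E d × E d => kernel (stdCutoff d) a k p.1 p.2)
          (f := fun p : E d × E d => (x - p.1, p.2 - p.1)) hc (by fun_prop)
      exact (h1.mul h2).mul (by fun_prop)
    · simp only [Function.uncurry]
      rw [enorm_mul, enorm_mul, mul_assoc, ← mul_assoc C]
      gcongr
      exact hK _ _
    · have hmeas : Measurable fun p : E d × E d =>
          ‖dilate ψ l p.1‖ₑ * (C * (decay M k (p.2 - p.1) * ‖F (x - p.2)‖ₑ)) :=
        hψ.mul ((hd.mul hFm).const_mul C)
      rw [lintegral_prod _ hmeas.aemeasurable]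
      refine ne_top_of_le_ne_top (b := ∫⁻ y, ‖dilate ψ l y‖ₑ * (C * B)) ?_
        (lintegral_mono fun y => ?_)
      · rw [lintegral_mul_const _ (dilate ψ l).continuous.enorm.measurable]
        exact ENNReal.mul_ne_top (dilate ψ l).integrable.2.ne (ENNReal.mul_ne_top hC hB)
      · simp only
        rw [lintegral_const_mul' _ _ enorm_ne_top, lintegral_const_mul' _ _ hC]
        gcongr
        refine le_trans (le_of_eq ?_) (hx (x - y))
        rw [← lintegral_sub_right_eq_self (fun ζ => decay M k ζ * ‖F (x - y - ζ)‖ₑ) y]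
        congr 1 with ζ
        rw [sub_sub_sub_cancel_right]
  have hswap := integral_integral_swap hint
  simp_rw [e1, offDiag, ← integral_mul_const, ← integral_const_mul, ← mul_assoc]
  exact hswap

/-- The high Littlewood-Paley pieces of the contribution of the frequencies of size `2^k`. -/
theorem IsSymbol.exists_enorm_conv_pdoPiece_le_of_le {φ : 𝓢(E d, ℂ)} (h : IsLittlewoodPaley φ)
    {m : ℝ} {a : E d → E d → ℂ} (ha : IsSymbol m 1 1 a) {q L : ℝ} (hq : 0 < q) (hL : (d : ℝ) < L)
    (s : ℝ) (N : ℕ) : ∃ C : ℝ≥0∞, C ≠ ⊤ ∧ ∀ (f : 𝓢'(E d, ℂ)) (B : ℝ≥0∞), B ≠ ⊤ →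
      (∀ k x, avgPiece φ h L (s + m) q f k x ≤ B) → ∀ k l, k ≤ l → 1 ≤ l → ∀ x,
      ‖∫ y, lpKernel φ h l y * pdoPiece φ h a f k (x - y)‖ₑ ≤
        C * (2 ^ (-(s * k) - N * ((l : ℝ) - k)) * avgPiece φ h L (s + m) q f k x ^ (1 / q)) := by
  have hM : 0 ≤ L / q + (d + 1) := by
    have : (0 : ℝ) ≤ d := Nat.cast_nonneg d
    have : 0 ≤ L / q := div_nonneg (by linarith) hq.le
    positivity
  obtain ⟨C₁, hC₁, h₁⟩ := exists_lintegral_decay_mul_lpPiece_le h hq hL (s + m)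
  obtain ⟨C₂, hC₂, h₂⟩ := ha.exists_enorm_kernel_le (stdCutoff d) (L / q + (d + 1))
  obtain ⟨C₃, hC₃, h₃⟩ := exists_enorm_offDiag_le hM N ha (stdCutoff d) h.isAnnular
  refine ⟨C₃ * C₁, ENNReal.mul_ne_top hC₃ hC₁, fun f B hB hA k l hkl hl x => ?_⟩
  have hlp : lpKernel φ h l = dilate φ l := if_neg (by omega)
  -- The uniform bound `B` enters only to justify Fubini; the final constant does not depend on it.
  have hfub := integral_dilate_mul_applyKernel (C := C₂ * 2 ^ (m * k)) (k := k) ha φ l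
    (continuous_lpPiece h k f) (ENNReal.mul_ne_top hC₂ (two_rpow_ne_top _))
    (fun w ζ => (h₂ k w ζ).trans_eq (mul_assoc _ _ _).symm)
    (B := C₁ * (2 ^ (-((s + m) * k)) * B ^ (1 / q)))
    (ENNReal.mul_ne_top hC₁ (ENNReal.mul_ne_top (two_rpow_ne_top _)
      (ENNReal.rpow_ne_top_of_nonneg (by positivity) hB)))
    (fun x => (h₁ k f x).trans (by gcongr; exact hA k x)) x
  rw [hlp]
  simp only [pdoPiece]
  rw [hfub]
  refine (enorm_integral_le_lintegral_enorm _).trans ?_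
  refine (enorm_integral_mul_le (C := C₃ * 2 ^ (m * k - N * ((l : ℝ) - k)))
    (ENNReal.mul_ne_top hC₃ (two_rpow_ne_top _))
    (fun ζ => (h₃ k l hkl x ζ).trans_eq (mul_assoc _ _ _).symm) x).trans ?_
  refine (mul_le_mul_right (h₁ k f x) _).trans_eq ?_
  have : (2 : ℝ≥0∞) ^ (-(s * k) - N * ((l : ℝ) - k)) =
      2 ^ (m * k - N * ((l : ℝ) - k)) * 2 ^ (-((s + m) * k)) := by
    rw [← two_rpow_add]; congr 1; ring
  rw [this]
  ring

/-- The low Littlewood-Paley pieces of the contribution of the frequencies of size `2^k`. -/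
theorem IsSymbol.exists_enorm_conv_pdoPiece_le_of_ge {φ : 𝓢(E d, ℂ)} (h : IsLittlewoodPaley φ)
    {m : ℝ} {a : E d → E d → ℂ} (ha : IsSymbol m 1 1 a) {q L : ℝ} (hq : 0 < q) (hL : (d : ℝ) < L)
    (s : ℝ) : ∃ C : ℝ≥0∞, C ≠ ⊤ ∧ ∀ (f : 𝓢'(E d, ℂ)) k l, l ≤ k → 1 ≤ l → ∀ x,
      ‖∫ y, lpKernel φ h l y * pdoPiece φ h a f k (x - y)‖ₑ ≤
        C * (2 ^ (-(s * k)) * (2 ^ (tau d q * ((k : ℝ) - l)) *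
          decayConv L l (avgPiece φ h L (s + m) q f k) x ^ (1 / q))) := by
  have hL0 : 0 ≤ L := (Nat.cast_nonneg d).trans hL.le
  obtain ⟨C₁, hC₁, h₁⟩ := ha.exists_enorm_applyKernel_le h hq hL s
  obtain ⟨C₂, hC₂, h₂⟩ := exists_enorm_dilate_le φ (L / min 1 q)
  obtain ⟨C₃, hC₃, h₃⟩ := exists_lintegral_decay_mul_rpow_le (d := d) hq hL
  refine ⟨C₂ * C₁ * C₃, ENNReal.mul_ne_top (ENNReal.mul_ne_top hC₂ hC₁) hC₃,
    fun f k l hkl hl x => ?_⟩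
  have hlp : lpKernel φ h l = dilate φ l := if_neg (by omega)
  have hD : C₂ * (C₁ * 2 ^ (-(s * k))) ≠ ⊤ :=
    ENNReal.mul_ne_top hC₂ (ENNReal.mul_ne_top hC₁ (two_rpow_ne_top _))
  rw [hlp]
  calc ‖∫ y, dilate φ l y * pdoPiece φ h a f k (x - y)‖ₑ
      ≤ ∫⁻ y, ‖dilate φ l y * pdoPiece φ h a f k (x - y)‖ₑ := enorm_integral_le_lintegral_enorm _
    _ ≤ ∫⁻ y, C₂ * (C₁ * 2 ^ (-(s * k))) * (decay (L / min 1 q) l y *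
          avgPiece φ h L (s + m) q f k (x - y) ^ (1 / q)) := by
        refine lintegral_mono fun y => ?_
        rw [enorm_mul]
        -- No cancellation is used here, only the size of `pdoPiece`. The decay exponent `L / min 1
        -- q` of `φ_l` was chosen to match `exists_lintegral_decay_mul_rpow_le`.
        have h4 : ‖pdoPiece φ h a f k (x - y)‖ₑ ≤ _ := h₁ k f (x - y) (x - y)
        generalize avgPiece φ h L (s + m) q f k (x - y) ^ (1 / q) = X at h4 ⊢
        calc _ ≤ C₂ * decay (L / min 1 q) l y * (C₁ * (2 ^ (-(s * k)) * X)) :=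
              mul_le_mul' (h₂ l y) h4
          _ = _ := by ring
    _ = C₂ * (C₁ * 2 ^ (-(s * k))) * ∫⁻ y, decay (L / min 1 q) l (x - y) *
          avgPiece φ h L (s + m) q f k y ^ (1 / q) := by
        rw [lintegral_const_mul' _ _ hD, ← lintegral_sub_left_eq_self (fun y =>
          decay (L / min 1 q) l (x - y) * avgPiece φ h L (s + m) q f k y ^ (1 / q)) x]
        simp_rw [sub_sub_cancel]
    _ ≤ C₂ * (C₁ * 2 ^ (-(s * k))) * (C₃ * (2 ^ (tau d q * ((k : ℝ) - l)) *
          decayConv L l (avgPiece φ h L (s + m) q f k) x ^ (1 / q))) := by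
        gcongr
        exact h₃ l k hkl _ (measurable_avgPiece h L (s + m) q f k) (slowlyVarying_decayConv hL0 k _) x
    _ = _ := by ring

/-- The diagonal term `k = l` is counted in both sums, which makes the two halves symmetric and is
harmless for an upper bound. -/
theorem tsum_le_tsum_sub_add_tsum_add (g : ℕ → ℝ≥0∞) (l : ℕ) :
    ∑' k, g k ≤ ∑' t, (if t ≤ l then g (l - t) else 0) + ∑' t, g (l + t) := by
  rw [← Summable.sum_add_tsum_nat_add' (f := g) (k := l + 1) ENNReal.summable]
  gcongr ?_ + ?_
  · rw [← Finset.sum_range_reflect]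
    refine le_trans (Finset.sum_le_sum fun t ht => ?_) (ENNReal.sum_le_tsum (Finset.range (l + 1)))
    rw [if_pos (Nat.lt_succ_iff.1 (Finset.mem_range.1 ht)), Nat.add_sub_cancel]
  · refine le_trans (le_of_eq ?_) (ENNReal.tsum_comp_le_tsum_of_injective
      (f := fun t : ℕ => t + 1) (fun a b hab => by simpa using hab) fun t => g (l + t))
    congr 1 with t
    congr 1
    ring

theorem tau_nonneg (d : ℕ) {q : ℝ} (hq : 0 < q) : 0 ≤ tau d q := by
  unfold tau
  have h1 : 0 < min 1 q := lt_min one_pos hq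
  rw [sub_nonneg, le_div_iff₀ h1]
  exact mul_le_of_le_one_right (Nat.cast_nonneg d) (min_le_left 1 q)

/-- The lowest piece needs no gain in frequency: summing the uniform bounds of the contributions is
enough. -/
theorem enorm_lpPiece_zero_le {φ : 𝓢(E d, ℂ)} (h : IsLittlewoodPaley φ) {G : ℕ → E d → ℂ}
    {b : ℕ → ℝ≥0∞} (hB : ∀ k x, ‖G k x‖ₑ ≤ b k) (x : E d) :
    ∑' k, ‖∫ y, lpKernel φ h 0 y * G k (x - y)‖ₑ ≤ (∫⁻ y, ‖lpKernel φ h 0 y‖ₑ) * ∑' k, b k := by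
  rw [← ENNReal.tsum_mul_left]
  refine ENNReal.tsum_le_tsum fun k => (enorm_integral_le_lintegral_enorm _).trans ?_
  rw [← lintegral_mul_const _ (lpKernel φ h 0).continuous.enorm.measurable]
  refine lintegral_mono fun y => ?_
  rw [enorm_mul]
  gcongr
  exact hB k _

theorem tsum_two_rpow_ne_top {s : ℝ} (hs : 0 < s) : ∑' k : ℕ, (2 : ℝ≥0∞) ^ (-(s * k)) ≠ ⊤ := by
  refine ne_top_of_le_ne_top (tsum_geometric_lt_top hs).ne (ENNReal.tsum_le_tsum fun k => ?_)
  exact le_mul_of_one_le_right' le_self_add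

/-- The pointwise bound for the Littlewood-Paley pieces of `T_[a] f`. -/
theorem IsSymbol.exists_enorm_lpPiece_le {φ : 𝓢(E d, ℂ)} (h : IsLittlewoodPaley φ)
    {m : ℝ} {a : E d → E d → ℂ} (ha : IsSymbol m 1 1 a) {q L s : ℝ} (hq : 0 < q)
    (hL : (d : ℝ) < L) : ∃ C : ℝ≥0∞, C ≠ ⊤ ∧ ∀ (f : 𝓢'(E d, ℂ)) (B : ℝ≥0∞), B ≠ ⊤ →
      (∀ k x, avgPiece φ h L (s + m) q f k x ≤ B) → ∀ l : ℕ, 1 ≤ l → ∀ x,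
      2 ^ (s * l) * ∑' k, ‖∫ y, lpKernel φ h l y * pdoPiece φ h a f k (x - y)‖ₑ ≤ C *
        (∑' t : ℕ, 2 ^ (-((s - tau d q) * t)) *
            (if t ≤ l then avgPiece φ h L (s + m) q f (l - t) x else 0) ^ (1 / q) +
          ∑' t : ℕ, 2 ^ (-((s - tau d q) * t)) *
            decayConv L l (avgPiece φ h L (s + m) q f (l + t)) x ^ (1 / q)) := by
  set ε := s - tau d q with hε
  -- The number of integrations by parts: for `k = l - t` the total exponent is `(s - N) t`, which
  -- is at most `-ε t` once `N ≥ s + ε`.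
  set N := ⌈s + ε⌉₊
  obtain ⟨C₁, hC₁, h₁⟩ := ha.exists_enorm_conv_pdoPiece_le_of_le h hq hL s N
  obtain ⟨C₂, hC₂, h₂⟩ := ha.exists_enorm_conv_pdoPiece_le_of_ge h hq hL s
  refine ⟨C₁ + C₂, ENNReal.add_ne_top.2 ⟨hC₁, hC₂⟩, fun f B hB hA l hl x => ?_⟩
  set g : ℕ → ℝ≥0∞ := fun k => ‖∫ y, lpKernel φ h l y * pdoPiece φ h a f k (x - y)‖ₑ
  refine (mul_le_mul_right (tsum_le_tsum_sub_add_tsum_add g l) _).trans ?_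
  rw [mul_add, mul_add, ← ENNReal.tsum_mul_left, ← ENNReal.tsum_mul_left, ← ENNReal.tsum_mul_left,
    ← ENNReal.tsum_mul_left]
  refine add_le_add (ENNReal.tsum_le_tsum fun t => ?_) (ENNReal.tsum_le_tsum fun t => ?_)
  · split_ifs with ht
    · have h3 := h₁ f B hB hA (l - t) l (Nat.sub_le _ _) hl x
      generalize avgPiece φ h L (s + m) q f (l - t) x ^ (1 / q) = X at h3 ⊢
      have h4 : (2 : ℝ≥0∞) ^ (s * l) *
          2 ^ (-(s * ((l - t : ℕ) : ℝ)) - N * ((l : ℝ) - ((l - t : ℕ) : ℝ))) ≤ 2 ^ (-(ε * t)) := by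
        rw [← two_rpow_add]
        refine ENNReal.rpow_le_rpow_of_exponent_le one_le_two ?_
        rw [Nat.cast_sub ht]
        have h5 : s + ε ≤ N := Nat.le_ceil _
        have h6 : (0 : ℝ) ≤ t := Nat.cast_nonneg t
        nlinarith
      calc 2 ^ (s * l) * g (l - t) ≤ 2 ^ (s * l) * (C₁ *
            (2 ^ (-(s * ((l - t : ℕ) : ℝ)) - N * ((l : ℝ) - ((l - t : ℕ) : ℝ))) * X)) := by
            gcongr
        _ = C₁ * (2 ^ (s * l) *
            2 ^ (-(s * ((l - t : ℕ) : ℝ)) - N * ((l : ℝ) - ((l - t : ℕ) : ℝ))) * X) := by ring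
        _ ≤ (C₁ + C₂) * (2 ^ (-(ε * t)) * X) := by
            gcongr
            exact le_self_add
    · simp
  · have h3 := h₂ f (l + t) l (Nat.le_add_right l t) hl x
    generalize decayConv L l (avgPiece φ h L (s + m) q f (l + t)) x ^ (1 / q) = X at h3 ⊢
    have h4 : (2 : ℝ≥0∞) ^ (s * l) * (2 ^ (-(s * ((l + t : ℕ) : ℝ))) *
        2 ^ (tau d q * (((l + t : ℕ) : ℝ) - l))) = 2 ^ (-(ε * t)) := by
      rw [← two_rpow_add, ← two_rpow_add, hε]
      congr 1
      push_cast
      ring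
    calc 2 ^ (s * l) * g (l + t) ≤ 2 ^ (s * l) * (C₂ * (2 ^ (-(s * ((l + t : ℕ) : ℝ))) *
          (2 ^ (tau d q * (((l + t : ℕ) : ℝ) - l)) * X))) := by gcongr
      _ = C₂ * ((2 : ℝ≥0∞) ^ (s * l) * (2 ^ (-(s * ((l + t : ℕ) : ℝ))) *
          2 ^ (tau d q * (((l + t : ℕ) : ℝ) - l))) * X) := by ring
      _ ≤ (C₁ + C₂) * (2 ^ (-(ε * t)) * X) := by
          rw [h4]
          gcongr
          exact le_add_self

/-- Pseudo-differential operators of type `1,1` are bounded on `F_∞^{s,q}` for `s > τ_q`. -/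
theorem IsSymbol.exists_triebelLizorkinNorm_le {φ : 𝓢(E d, ℂ)} (h : IsLittlewoodPaley φ)
    {m q s : ℝ} (hq : 0 < q) {a : E d → E d → ℂ} (ha : IsSymbol m 1 1 a) (hs : tau d q < s) :
    ∃ C : ℝ≥0∞, C ≠ ⊤ ∧ ∀ f ∈ triebelLizorkin φ h (s + m) q, ∃ u : 𝓢'(E d, ℂ),
      IsPseudoDiff φ h a f u ∧
      triebelLizorkinNorm φ h s q u ≤ C * triebelLizorkinNorm φ h (s + m) q f := by
  -- Positivity of `s` makes `∑ 2^{-sk}` finite, which gives both the existence of the limit and the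
  -- bound for the lowest piece.
  have hs0 : 0 < s := (tau_nonneg d hq).trans_lt hs
  have hd0 : (0 : ℝ) ≤ d := Nat.cast_nonneg d
  have hq' : 0 ≤ 1 / q := by positivity
  -- Any exponent above `2d` would do: the stability of the Carleson supremum under averaging
  -- requires it.
  set L : ℝ := 2 * d + 1
  have hL2 : 2 * (d : ℝ) < L := lt_add_one _
  have hL : (d : ℝ) < L := by linarith
  obtain ⟨C₁, hC₁, h₁⟩ := exists_lintegral_decay_mul_lpPiece_le h hq hL (s + m)
  obtain ⟨C₂, hC₂, h₂⟩ := ha.exists_enorm_applyKernel_le h hq hL s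
  obtain ⟨C₃, hC₃, h₃⟩ := exists_decayConv_powPiece_le h hq hL2
  obtain ⟨C₄, hC₄, h₄⟩ := ha.exists_enorm_lpPiece_le h hq hL (s := s)
  obtain ⟨C₅, hC₅, h₅⟩ := exists_carleson_rpow_le (d := d) (sub_pos.2 hs) hq hL2
  set Γ := ∑' k : ℕ, (2 : ℝ≥0∞) ^ (-(s * k))
  have hΓ : Γ ≠ ⊤ := tsum_two_rpow_ne_top hs0
  set I := ∫⁻ y, ‖lpKernel φ h 0 y‖ₑ
  have hI : I ≠ ⊤ := (lpKernel φ h 0).integrable.2.ne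
  have hC₃q : C₃ ^ (1 / q) ≠ ⊤ := ENNReal.rpow_ne_top_of_nonneg hq' hC₃
  have hC₅q : C₅ ^ (1 / q) ≠ ⊤ := ENNReal.rpow_ne_top_of_nonneg hq' hC₅
  refine ⟨I * Γ * (C₂ * C₃ ^ (1 / q)) + C₄ * (C₅ ^ (1 / q) * C₃ ^ (1 / q)), by finiteness,
    fun f hf => ?_⟩
  set T := triebelLizorkinNorm φ h (s + m) q f
  have hT : T ≠ ⊤ := ne_of_lt hf
  set A := fun k => avgPiece φ h L (s + m) q f k
  obtain ⟨hA, hcar⟩ := h₃ (s + m) f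
  have hBt : C₃ * T ^ q ≠ ⊤ := ENNReal.mul_ne_top hC₃ (ENNReal.rpow_ne_top_of_nonneg hq.le hT)
  have hroot : (C₃ * T ^ q) ^ (1 / q) = C₃ ^ (1 / q) * T := by
    rw [ENNReal.mul_rpow_of_nonneg _ _ hq', ← ENNReal.rpow_mul, mul_one_div_cancel hq.ne',
      ENNReal.rpow_one]
  have hAroot : ∀ k x, A k x ^ (1 / q) ≤ C₃ ^ (1 / q) * T := fun k x => by
    rw [← hroot]
    exact ENNReal.rpow_le_rpow (hA k x) hq'
  -- Uniform bounds for the contributions of the single frequencies, summable in `k` and linear in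
  -- the norm `T` of `f`.
  set b : ℕ → ℝ≥0∞ := fun k => C₂ * (2 ^ (-(s * k)) * (C₃ ^ (1 / q) * T)) with hb
  have hbt : ∑' k, b k = Γ * (C₂ * C₃ ^ (1 / q)) * T := by
    simp only [hb, Γ]
    rw [ENNReal.tsum_mul_left, ENNReal.tsum_mul_right]
    ring
  have hbfin : ∑' k, b k ≠ ⊤ := by
    rw [hbt]
    finiteness
  have hker : ∀ k w x, ‖applyKernel a k (lpPiece φ h k f) w x‖ₑ ≤ b k := fun k w x =>
    (h₂ k f w x).trans (by simp only [hb]; gcongr; exact hAroot k x)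
  have hkerR : ∀ k w x, ‖applyKernel a k (lpPiece φ h k f) w x‖ ≤ (b k).toReal := fun k w x => by
    rw [← toReal_enorm]
    exact ENNReal.toReal_mono (ENNReal.ne_top_of_tsum_ne_top hbfin k) (hker k w x)
  have hbs : Summable fun k => (b k).toReal := ENNReal.summable_toReal hbfin
  obtain ⟨u, hu, hreg⟩ := exists_isPseudoDiff h ha (M := L / q + (d + 1)) (fun k x => by
    refine ne_top_of_le_ne_top ?_ (h₁ k f x)
    exact ENNReal.mul_ne_top hC₁ (ENNReal.mul_ne_top (two_rpow_ne_top _)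
      (ne_top_of_le_ne_top (ENNReal.mul_ne_top hC₃q hT) (hAroot k x)))) hbs hkerR
  refine ⟨u, hu, ?_⟩
  have hpiece := enorm_lpPiece_le_tsum h (measurable_pdoPiece h ha f) hbs
    (fun k x => hkerR k x x) hreg
  have hlow : eLpNorm (lpPiece φ h 0 u) ⊤ volume ≤ I * Γ * (C₂ * C₃ ^ (1 / q)) * T := by
    rw [eLpNorm_exponent_top]
    refine eLpNormEssSup_le_of_ae_enorm_bound (.of_forall fun x => (hpiece 0 x).trans ?_)
    refine (enorm_lpPiece_zero_le h (fun k x => hker k x x) x).trans_eq ?_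
    rw [hbt]
    ring
  have hpow : ∀ l x, powPiece φ h s q u l x = (2 ^ (s * l) * ‖lpPiece φ h l u x‖ₑ) ^ q := by
    intro l x
    rw [ENNReal.mul_rpow_of_nonneg _ _ hq.le, ← ENNReal.rpow_mul, powPiece]
  -- The uniform bound and the Carleson bound for `A` share the value `B = C₃ T^q`; the sum over
  -- scales then bounds the `q`-th powers, and the root taken below makes the estimate linear in
  -- `T`.
  have hhigh : carleson (powPiece φ h s q u) ≤ C₄ ^ q * (C₅ * (C₃ * T ^ q)) := by
    have h6 := h₅ A (fun k => measurable_avgPiece h L (s + m) q f k) (C₃ * T ^ q) hA hcar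
      (fun l x => 2 ^ (s * l) * ‖lpPiece φ h l u x‖ₑ) C₄ hC₄ fun l x hl =>
        (mul_le_mul_right (hpiece l x) _).trans (h₄ f _ hBt hA l hl x)
    refine le_trans (le_of_eq ?_) h6
    congr 1
    funext l x
    exact hpow l x
  calc triebelLizorkinNorm φ h s q u
      ≤ I * Γ * (C₂ * C₃ ^ (1 / q)) * T + (C₄ ^ q * (C₅ * (C₃ * T ^ q))) ^ (1 / q) := by
        refine (triebelLizorkinNorm_le h s hq u).trans (add_le_add hlow ?_)
        exact ENNReal.rpow_le_rpow hhigh hq'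
    _ = _ := by
        rw [ENNReal.mul_rpow_of_nonneg _ _ hq', ENNReal.mul_rpow_of_nonneg _ _ hq', hroot,
          ← ENNReal.rpow_mul, mul_one_div_cancel hq.ne', ENNReal.rpow_one]
        ring

end TypeOneOne

end

theorem corollary2p2 {d : ℕ} (hd : 1 ≤ d)
    (φ : SchwartzMap (TypeOneOne.E d) ℂ) (hφ : TypeOneOne.IsLittlewoodPaley φ)
    (m q s : ℝ) (hq : 0 < q) (a : TypeOneOne.E d → TypeOneOne.E d → ℂ)
    (ha : TypeOneOne.IsSymbol m 1 1 a) (hs : TypeOneOne.tau d q < s) :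
    ∃ C : NNReal, ∀ f ∈ TypeOneOne.triebelLizorkin φ hφ (s + m) q,
      ∃ u ∈ TypeOneOne.triebelLizorkin φ hφ s q,
        TypeOneOne.IsPseudoDiff φ hφ a f u ∧
        TypeOneOne.triebelLizorkinNorm φ hφ s q u ≤
          C * TypeOneOne.triebelLizorkinNorm φ hφ (s + m) q f := by
  obtain ⟨C, hC, h⟩ := ha.exists_triebelLizorkinNorm_le hφ hq hs
  lift C to NNReal using hC
  refine ⟨C, fun f hf => ?_⟩
  obtain ⟨u, hu, hle⟩ := h f hf
  exact ⟨u, hle.trans_lt (ENNReal.mul_lt_top ENNReal.coe_lt_top hf), hu, hle⟩
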